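/- **Conventions.** $\mathbb H=\{z\in\mathbb C:\operatorname{Im}z>0\}$ and $\widehat\varphi(\xi)=\int_{\mathbb R}\varphi(x)e^{-2\pi i x\xi}\,dx$. A real-valued locally finite measure $\mu$ on $\mathbb R$ is a difference of two nonnegative locally finite Borel measures; $|\mu|$ is its total variation, and its degree is $$\deg(\mu)=\min\Big\{n\in\mathbb Z:\int_{\mathbb R}\frac{d|\mu|(t)}{(1+t^2)^{n/2}}<\infty\Big\}.$$ The measure $\mu$ is strongly tempered if every Schwartz function is $|\mu|$-integrable. A function $a:\mathbb R\to\mathbb C$ is locally summable if its support is countable and $\sum_{|\lambda|\le T}|a(\lambda)|<\infty$ for all $T>0$; a locally summable $a$ has exponential growth if $\sum_{\lambda}|a(\lambda)|e^{-c|\lambda|}<\infty$ for some $c>0$. A pair $(\mu,a)$ is a real-antipodal Fourier summation pair (FS-pair) if $\mu$ is a strongly tempered real-valued locally finite measure, $a$ is locally summable, $a(-\lambda)=\overline{a(\lambda)}$ for all $\lambda\in\mathbb R$, and $\int_{\mathbb R}\widehat\varphi\,d\mu=\sum_{\lambda\in\mathbb R}a(\lambda)\varphi(\lambda)$ for every $\varphi\in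 C_c^\infty(\mathbb R)$. A set $\tau\subset\mathbb R$ is relatively dense if for some $l>0$ it meets every interval $(x,x+l)$. A holomorphic $g:\mathbb H\to\mathbb C$ is almost periodic, $g\in\mathrm{AP}(\mathbb H)$, if for all $0<\alpha<\beta<\infty$ and $\varepsilon>0$ there is a relatively dense set $\tau$ such that $\sup_{\alpha<\operatorname{Im}z<\beta}|g(z)-g(z+t)|\le\varepsilon$ for all $t\in\tau$. A holomorphic $g$ on $\mathbb H$ is of bounded type if $g=P/Q$ with $P,Q$ bounded holomorphic functions on $\mathbb H$, $Q\not\equiv0$. **Theorem 1.** Let $(\mu,a)$ be a real-antipodal FS-pair such that $\deg(\mu)\le2$ and $a$ has exponential growth. Then: (I) the limit $$f(z)=\tfrac12a(0)+\lim_{T\to\infty}\sum_{0<\lambda<T}a(\lambda)\Big(1-\frac{\lambda}{T}\Big)e^{2\pi i\lambda z}\qquad(1)$$ exists uniformly on compact subsets of $\mathbb H$ (and so $f$ is holomorphic in $\mathbb H$); (II) there is $c_1>0$ such that $f(\cdot+ic_1)\in\mathrm{AP}(\mathbb H)$; (III) there are $c_2,B>0$ with $c_2\ge c_1$ such that for every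 trigonometric polynomial $p(x)=\sum_{n=1}^Np_ne^{2\pi i\theta_nx}$ with distinct frequencies $\theta_n\in[0,\infty)$, $$\limsup_{T\to\infty}\Big|\frac1{2T}\int_{-T}^Tf(x+ic_2)\overline{p(x)}\,dx\Big|\le B\max_n|p_n|;$$ (IV) $\exp(f)$ is of bounded type and $\limsup_{y\to\infty}\operatorname{Re}f(iy)/y=0$. Conversely, let $f:\mathbb H\to\mathbb C$ be a holomorphic function for which (II), (III) and (IV) hold. Then there is $c\ge0$ such that the limit $$\mathcal Ef(\lambda)=\lim_{T\to\infty}\frac1{2T}\int_{-T+iy}^{T+iy}f(z)e^{-2\pi i\lambda z}\,dz$$ exists for every $\lambda\in\mathbb R$ and $y>c$, is independent of $y$, vanishes for $\lambda<0$, and defines a locally summable function of exponential growth, with $\sum_{\lambda}|\mathcal Ef(\lambda)|e^{-2\pi y|\lambda|}<\infty$ for every $y>c$. Moreover, there is a unique real-valued locally finite measure $\mu$ with $\deg(\mu)\le2$ such that $$\frac{f(z)+\overline{f(w)}}{z-\overline w}=\frac1{2\pi i}\int_{\mathbb R}\frac{d\mu(t)}{(z-t)(\overline w-t)}\qquad\text{for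 all }z,w\in\mathbb H.$$ Furthermore, if $a(\lambda)=\mathcal Ef(\lambda)$ for $\lambda>0$, $a(0)=2\operatorname{Re}\mathcal Ef(0)$ and $a(\lambda)=\overline{\mathcal Ef(-\lambda)}$ for $\lambda<0$, then $(\mu,a)$ is a real-antipodal FS-pair, and identity (1) holds up to an additive imaginary constant, namely with $f$ replaced by $f-i\operatorname{Im}\mathcal Ef(0)$, uniformly on compact subsets of $\mathbb H$ (so (1) itself holds when $\mathcal Ef(0)$ is real). -/

import Mathlib

open Set Filter Topology MeasureTheory
open scoped FourierTransform SchwartzMap ContDiff ComplexConjugate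

noncomputable section

/-- The open upper half-plane, as a subset of `ℂ`. -/
def upperHalf : Set ℂ := {z : ℂ | 0 < z.im}

/-- A real-valued locally finite measure on `ℝ`, i.e. `μ = μ₁ - μ₂` with `μ₁`, `μ₂` nonnegative
locally finite Borel measures. It is stored through its Jordan decomposition (`μ₁` and `μ₂` mutually
singular), which exists and is unique, so that equality of structures is equality of measures.
The total mass of both parts may be infinite. -/
structure RealLocFinMeasure where
  pos : Measure ℝ
  neg : Measure ℝ
  pos_locFin : IsLocallyFiniteMeasure pos
  neg_locFin : IsLocallyFiniteMeasure neg
  mutuallySingular : pos ⟂ₘ neg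

namespace RealLocFinMeasure

/-- The total variation `|μ|`. -/
def variation (μ : RealLocFinMeasure) : Measure ℝ := μ.pos + μ.neg

/-- `∫ g dμ`, meaningful when `g` is integrable with respect to `|μ|`. -/
def integral (μ : RealLocFinMeasure) (g : ℝ → ℂ) : ℂ := (∫ t, g t ∂μ.pos) - ∫ t, g t ∂μ.neg

/-- `μ` is strongly tempered: Schwartz functions are `|μ|`-integrable. -/
def StronglyTempered (μ : RealLocFinMeasure) : Prop :=
  ∀ φ : 𝓢(ℝ, ℂ), Integrable (fun t => φ t) μ.variation

/-- The degree: the least integer `n` with `∫ (1 + t²)^(-n/2) d|μ|(t) < ∞`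
(`⊤` if there is no such `n`, `⊥` if every `n` is one). -/
def degree (μ : RealLocFinMeasure) : EReal :=
  sInf ((fun n : ℤ => ((n : ℝ) : EReal)) ''
    {n : ℤ | ∫⁻ t, ENNReal.ofReal ((1 + t ^ 2) ^ (-(n : ℝ) / 2)) ∂μ.variation < ⊤})

end RealLocFinMeasure

/-- `a` has countable support and is absolutely summable over bounded sets. -/
def LocallySummable (a : ℝ → ℂ) : Prop :=
  (Function.support a).Countable ∧
    ∀ T : ℝ, 0 < T → Summable ((Icc (-T) T).indicator fun l => ‖a l‖)

/-- `(μ, a)` is a real-antipodal Fourier summation pair (`μ` is real-valued by its type). -/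
structure IsRealAntipodalFSPair (μ : RealLocFinMeasure) (a : ℝ → ℂ) : Prop where
  stronglyTempered : μ.StronglyTempered
  locallySummable : LocallySummable a
  summation : ∀ φ : ℝ → ℂ, ContDiff ℝ ∞ φ → HasCompactSupport φ →
    HasSum (fun l : ℝ => a l * φ l) (μ.integral (𝓕 φ))
  antipodal : ∀ l : ℝ, a (-l) = conj (a l)

/-- Exponential growth: `∑ |a(λ)| e^{-c|λ|} < ∞` for some `c > 0`. -/
def HasExpGrowth (a : ℝ → ℂ) : Prop :=
  ∃ c : ℝ, 0 < c ∧ Summable fun l : ℝ => ‖a l‖ * Real.exp (-c * |l|)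

/-- The Fejér sum `∑_{0 < λ < T} a(λ) (1 - λ/T) e^{2πiλz}`. -/
def fejerSum (a : ℝ → ℂ) (T : ℝ) (z : ℂ) : ℂ :=
  ∑' l : ℝ, (Ioo 0 T).indicator
    (fun l : ℝ => a l * ((1 - l / T : ℝ) : ℂ) * Complex.exp (2 * Real.pi * Complex.I * l * z)) l

/-- `F T → f` as `T → ∞`, uniformly on compact subsets of the upper half-plane. -/
def TendstoOnCompacts (F : ℝ → ℂ → ℂ) (f : ℂ → ℂ) : Prop :=
  ∀ K : Set ℂ, IsCompact K → K ⊆ upperHalf → TendstoUniformlyOn F f atTop K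

def RelativelyDense (τ : Set ℝ) : Prop :=
  ∃ l : ℝ, 0 < l ∧ ∀ x : ℝ, (Ioo x (x + l) ∩ τ).Nonempty

/-- Holomorphic almost periodic functions in the upper half-plane. -/
def IsAlmostPeriodicH (f : ℂ → ℂ) : Prop :=
  DifferentiableOn ℂ f upperHalf ∧
    ∀ α β ε : ℝ, 0 < α → α < β → 0 < ε →
      ∃ τ : Set ℝ, RelativelyDense τ ∧
        ∀ t ∈ τ, ∀ z : ℂ, α < z.im → z.im < β → ‖f z - f (z + t)‖ ≤ ε

/-- The trigonometric polynomial `∑ₙ pₙ e^{2πiθₙx}`. -/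
def trigPoly {N : ℕ} (θ : Fin N → ℝ) (p : Fin N → ℂ) (x : ℝ) : ℂ :=
  ∑ n, p n * Complex.exp (2 * Real.pi * Complex.I * θ n * x)

/-- On the line `Im z = c₂`, the mean values of `f` against the trigonometric polynomials with
(distinct) nonnegative frequencies are bounded by `B` times the largest coefficient. -/
def BoundedCoeffs (f : ℂ → ℂ) (c₂ B : ℝ) : Prop :=
  ∀ (N : ℕ) (θ : Fin N → ℝ) (p : Fin N → ℂ), Function.Injective θ → (∀ n, 0 ≤ θ n) →
    limsup (fun T : ℝ => ((‖1 / (2 * T : ℂ) *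
        ∫ x in (-T)..T, f (x + c₂ * Complex.I) * conj (trigPoly θ p x)‖ : ℝ) : EReal)) atTop
      ≤ ((B * ⨆ n, ‖p n‖ : ℝ) : EReal)

/-- Conditions (II) and (III), which share the constant `c₁`. -/
def ConditionsIIandIII (f : ℂ → ℂ) : Prop :=
  ∃ c₁ : ℝ, 0 < c₁ ∧ IsAlmostPeriodicH (fun z => f (z + c₁ * Complex.I)) ∧
    ∃ c₂ B : ℝ, 0 < c₂ ∧ 0 < B ∧ c₁ ≤ c₂ ∧ BoundedCoeffs f c₂ B

/-- `g = P / Q` (as meromorphic functions) with `P`, `Q` bounded holomorphic in the upper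
half-plane and `Q` not identically zero. -/
def IsBoundedType (g : ℂ → ℂ) : Prop :=
  ∃ P Q : ℂ → ℂ, DifferentiableOn ℂ P upperHalf ∧ DifferentiableOn ℂ Q upperHalf ∧
    (∃ M : ℝ, ∀ z ∈ upperHalf, ‖P z‖ ≤ M ∧ ‖Q z‖ ≤ M) ∧
    (∃ z ∈ upperHalf, Q z ≠ 0) ∧ ∀ z ∈ upperHalf, g z * Q z = P z

/-- Condition (IV): `exp f` is of bounded type, with mean type zero. -/
def ConditionIV (f : ℂ → ℂ) : Prop :=
  IsBoundedType (fun z => Complex.exp (f z)) ∧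
    limsup (fun y : ℝ => (((f (y * Complex.I)).re / y : ℝ) : EReal)) atTop = 0

/-- `(1/2T) ∫_{-T+iy}^{T+iy} f(z) e^{-2πiλz} dz`. -/
def bohrMean (f : ℂ → ℂ) (l y T : ℝ) : ℂ :=
  1 / (2 * T : ℂ) * ∫ x in (-T)..T, f (x + y * Complex.I) *
    Complex.exp (-(2 * Real.pi * Complex.I * l * (x + y * Complex.I)))

/-- The kernel identity relating `f` and `μ`. -/
def KernelIdentity (f : ℂ → ℂ) (μ : RealLocFinMeasure) : Prop :=
  ∀ z ∈ upperHalf, ∀ w ∈ upperHalf,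
    (f z + conj (f w)) / (z - conj w) =
      1 / (2 * Real.pi * Complex.I) * μ.integral fun t => 1 / ((z - t) * (conj w - t))

/-- The antipodal coefficient function built from `E` on `[0, ∞)`. -/
def antipodalCoeff (E : ℝ → ℂ) (l : ℝ) : ℂ :=
  if 0 < l then E l else if l = 0 then ((2 * (E 0).re : ℝ) : ℂ) else conj (E (-l))

end

noncomputable section

/-! ### Measures of degree at most two -/

/-! Both halves rest on the identity f(z) + conj f(w) = L(z,w), where L(z,w) = (2πi)⁻¹ (z - w̄) ∫
dμ(t)/((z-t)(w̄-t)). The kernel is O(1/(1+t²)), so degree at most two makes it integrable.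

Direct half. The summation formula is tested on a Fejér tent that carries e^{2πiλz} on the positive
side and e^{2πiλw̄} on the negative side. The Fourier transform of this tent differs from the kernel
of L(z,w) by O(1/T)(1+t²)⁻¹. Hence the Fejér sums satisfy S_T(z) + conj S_T(w) → L(z,w). Exponential
growth makes S_T converge at one high point w, and this forces convergence on the whole half-plane
(`IsRealAntipodalFSPair.exists_limit`). High up, f is an absolutely convergent exponential series,
which gives (II) and (III). Splitting μ into its two parts writes f, up to an imaginary constant, as
a difference of functions with nonnegative real part, which gives (IV).

Converse half. In the disc model Jensen's formula bounds the circle means of the positive part of Re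
f, and a weak limit of Poisson representations produces a measure on the circle. The boundary point
at infinity can only contribute a multiple of Im z, and mean type zero excludes it
(`ConditionIV.exists_measure`). Poisson inversion makes μ unique (`KernelIdentity.measure_unique`).

The identity also gives quadratic growth of f above every positive height, so Gaussian means can be
moved from one horizontal line to another. Therefore the Bohr coefficients do not depend on the
height (`exists_bohr_coeff`) and vanish at negative frequencies, and (III) bounds their weighted ℓ¹
norm by duality (`sum_bohr_coeff_le`). The uniqueness theorem for almost periodic functions
(`IsAP.eq_zero_of_hasMean_zero`) then identifies f, high up, with its exponential series.

For a test function φ, the transform of φ is the Poisson average, at height y, of the transform of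
φ(λ)e^{2πy|λ|}. Fubini replaces μ by 2 Re f on Im z = y, and integrating the series term by term
returns ∑ a(λ)φ(λ) (`KernelIdentity.hasSum_summation`). Applying the direct half to this pair
recovers f up to an imaginary constant. -/

theorem integrable_variation_iff {E : Type*} [NormedAddCommGroup E] (μ : RealLocFinMeasure)
    (g : ℝ → E) :
    Integrable g μ.variation ↔ Integrable g μ.pos ∧ Integrable g μ.neg :=
  integrable_add_measure

instance (μ : RealLocFinMeasure) : IsLocallyFiniteMeasure μ.pos := μ.pos_locFin
instance (μ : RealLocFinMeasure) : IsLocallyFiniteMeasure μ.neg := μ.neg_locFin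

theorem continuous_inv_one_add_sq : Continuous fun t : ℝ => (1 + t ^ 2)⁻¹ :=
  Continuous.inv₀ (by fun_prop) fun t => by positivity

theorem integrable_inv_one_add_sq_iff_lintegral (ν : Measure ℝ) :
    Integrable (fun t : ℝ => (1 + t ^ 2)⁻¹) ν ↔
      ∫⁻ t, ENNReal.ofReal ((1 + t ^ 2)⁻¹) ∂ν < ⊤ := by
  rw [Integrable, hasFiniteIntegral_iff_ofReal (ae_of_all _ fun t => by positivity)]
  exact and_iff_right continuous_inv_one_add_sq.aestronglyMeasurable

theorem degree_le_two_iff (μ : RealLocFinMeasure) :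
    μ.degree ≤ 2 ↔ Integrable (fun t : ℝ => (1 + t ^ 2)⁻¹) μ.variation := by
  rw [integrable_inv_one_add_sq_iff_lintegral]
  constructor
  · intro h
    -- Comparing with 3 extracts an actual integer n < 3 from the infimum, hence n ≤ 2; this also
    -- covers degree `⊥`.
    have h3 : μ.degree < ((3 : ℝ) : EReal) := lt_of_le_of_lt h (by
      have : ((2 : ℝ) : EReal) < ((3 : ℝ) : EReal) := EReal.coe_lt_coe_iff.2 (by norm_num)
      exact this)
    obtain ⟨_, ⟨n, hn, rfl⟩, hlt⟩ := sInf_lt_iff.1 h3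
    have hn3 : (n : ℝ) < 3 := EReal.coe_lt_coe_iff.1 hlt
    have hn2 : n ≤ 2 := by
      have : n < 3 := by exact_mod_cast hn3
      omega
    refine lt_of_le_of_lt (lintegral_mono fun t => ENNReal.ofReal_le_ofReal ?_) hn
    have h1 : (1 : ℝ) ≤ 1 + t ^ 2 := by nlinarith [sq_nonneg t]
    rw [← Real.rpow_neg_one]
    apply Real.rpow_le_rpow_of_exponent_le h1
    have : (n : ℝ) ≤ 2 := by exact_mod_cast hn2
    linarith
  · intro h
    refine sInf_le ⟨2, ?_, by norm_num; rfl⟩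
    refine lt_of_eq_of_lt ?_ h
    congr 1
    ext t
    rw [← Real.rpow_neg_one]
    norm_num

namespace RealLocFinMeasure

variable {μ : RealLocFinMeasure}

theorem integral_sub' {g h : ℝ → ℂ} (hg : Integrable g μ.variation)
    (hh : Integrable h μ.variation) :
    μ.integral (fun t => g t - h t) = μ.integral g - μ.integral h := by
  rw [integrable_variation_iff] at hg hh
  simp only [RealLocFinMeasure.integral]
  rw [MeasureTheory.integral_sub hg.1 hh.1, MeasureTheory.integral_sub hg.2 hh.2]
  ring

theorem integral_add' {g h : ℝ → ℂ} (hg : Integrable g μ.variation)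
    (hh : Integrable h μ.variation) :
    μ.integral (fun t => g t + h t) = μ.integral g + μ.integral h := by
  rw [integrable_variation_iff] at hg hh
  simp only [RealLocFinMeasure.integral]
  rw [MeasureTheory.integral_add hg.1 hh.1, MeasureTheory.integral_add hg.2 hh.2]
  ring

theorem integral_const_mul' (c : ℂ) (g : ℝ → ℂ) :
    μ.integral (fun t => c * g t) = c * μ.integral g := by
  simp only [RealLocFinMeasure.integral, integral_const_mul]
  ring

theorem integral_conj' (g : ℝ → ℂ) :
    μ.integral (fun t => conj (g t)) = conj (μ.integral g) := by
  simp only [RealLocFinMeasure.integral, integral_conj, map_sub]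

theorem norm_integral_le {g : ℝ → ℂ} {b : ℝ → ℝ} (hb : Integrable b μ.variation)
    (h : ∀ t, ‖g t‖ ≤ b t) : ‖μ.integral g‖ ≤ ∫ t, b t ∂μ.variation := by
  have hb' := (integrable_variation_iff μ b).1 hb
  rw [variation, integral_add_measure hb'.1 hb'.2]
  refine (norm_sub_le _ _).trans (add_le_add ?_ ?_)
  · exact norm_integral_le_of_norm_le hb'.1 (ae_of_all _ h)
  · exact norm_integral_le_of_norm_le hb'.2 (ae_of_all _ h)

theorem tendsto_integral_of_dominated {ι : Type*} {l : Filter ι} [l.IsCountablyGenerated]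
    {F : ι → ℝ → ℂ} {g : ℝ → ℂ} {b : ℝ → ℝ} (hb : Integrable b μ.variation)
    (hF : ∀ᶠ i in l, Continuous (F i)) (h : ∀ᶠ i in l, ∀ t, ‖F i t‖ ≤ b t)
    (hlim : ∀ t, Tendsto (fun i => F i t) l (𝓝 (g t))) :
    Tendsto (fun i => μ.integral (F i)) l (𝓝 (μ.integral g)) := by
  have hb' := (integrable_variation_iff μ b).1 hb
  refine Tendsto.sub ?_ ?_
  · exact tendsto_integral_filter_of_dominated_convergence b
      (hF.mono fun i hi => hi.aestronglyMeasurable)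
      (h.mono fun i hi => ae_of_all _ hi) hb'.1 (ae_of_all _ hlim)
  · exact tendsto_integral_filter_of_dominated_convergence b
      (hF.mono fun i hi => hi.aestronglyMeasurable)
      (h.mono fun i hi => ae_of_all _ hi) hb'.2 (ae_of_all _ hlim)

end RealLocFinMeasure

theorem integrable_of_le_inv_one_add_sq {E : Type*} [NormedAddCommGroup E] {ν : Measure ℝ}
    (hν : Integrable (fun t : ℝ => (1 + t ^ 2)⁻¹) ν) {g : ℝ → E}
    (hg : AEStronglyMeasurable g ν) {C : ℝ} (h : ∀ t, ‖g t‖ ≤ C * (1 + t ^ 2)⁻¹) :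
    Integrable g ν :=
  (hν.const_mul C).mono' hg (ae_of_all _ h)

theorem Continuous.integrable_of_le_inv_one_add_sq {E : Type*} [NormedAddCommGroup E]
    {ν : Measure ℝ} (hν : Integrable (fun t : ℝ => (1 + t ^ 2)⁻¹) ν) {g : ℝ → E}
    [SecondCountableTopologyEither ℝ E]
    (hg : Continuous g) {C : ℝ} (h : ∀ t, ‖g t‖ ≤ C * (1 + t ^ 2)⁻¹) :
    Integrable g ν :=
  _root_.integrable_of_le_inv_one_add_sq hν hg.aestronglyMeasurable h

theorem stronglyTempered_of_integrable {μ : RealLocFinMeasure}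
    (hμ : Integrable (fun t : ℝ => (1 + t ^ 2)⁻¹) μ.variation) : μ.StronglyTempered := by
  intro φ
  obtain ⟨C₀, _, h₀⟩ := φ.decay 0 0
  obtain ⟨C₂, _, h₂⟩ := φ.decay 2 0
  refine Continuous.integrable_of_le_inv_one_add_sq hμ φ.continuous (C := C₀ + C₂) fun t => ?_
  have h0 := h₀ t
  have h2 := h₂ t
  simp only [norm_iteratedFDeriv_zero, pow_zero, one_mul, Real.norm_eq_abs, sq_abs] at h0 h2
  rw [← div_eq_mul_inv, le_div_iff₀ (by positivity)]
  linarith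

/-! ### Jordan decomposition with weights -/

/-- The weight `1 + t²` as a density. -/
def quadDensity (t : ℝ) : ENNReal := ENNReal.ofReal (1 + t ^ 2)

theorem measurable_quadDensity : Measurable quadDensity := by
  unfold quadDensity; fun_prop

theorem quadDensity_ne_zero (t : ℝ) : quadDensity t ≠ 0 := by
  have : (0 : ℝ) < 1 + t ^ 2 := by positivity
  simpa [quadDensity] using this

theorem quadDensity_ne_top (t : ℝ) : quadDensity t ≠ ⊤ := ENNReal.ofReal_ne_top

theorem inv_quadDensity (t : ℝ) : (quadDensity t)⁻¹ = ENNReal.ofReal ((1 + t ^ 2)⁻¹) := by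
  rw [quadDensity, ENNReal.ofReal_inv_of_pos (by positivity)]

theorem withDensity_quad_inv (ν : Measure ℝ) :
    (ν.withDensity fun t => (quadDensity t)⁻¹).withDensity quadDensity = ν := by
  have h := withDensity_inv_same (μ := ν) (f := fun t => (quadDensity t)⁻¹)
    measurable_quadDensity.inv (ae_of_all _ fun t => by simpa using quadDensity_ne_top t)
    (ae_of_all _ fun t => by simpa using quadDensity_ne_zero t)
  simpa using h

theorem isFiniteMeasure_withDensity_inv_quad {ν : Measure ℝ}
    (hν : Integrable (fun t : ℝ => (1 + t ^ 2)⁻¹) ν) :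
    IsFiniteMeasure (ν.withDensity fun t => (quadDensity t)⁻¹) := by
  refine isFiniteMeasure_withDensity ?_
  simp_rw [inv_quadDensity]
  exact ((integrable_inv_one_add_sq_iff_lintegral ν).1 hν).ne

theorem integrable_withDensity_quad (m : Measure ℝ) [IsFiniteMeasure m] :
    Integrable (fun t : ℝ => (1 + t ^ 2)⁻¹) (m.withDensity quadDensity) := by
  rw [integrable_inv_one_add_sq_iff_lintegral,
    lintegral_withDensity_eq_lintegral_mul _ measurable_quadDensity (by fun_prop)]
  simp_rw [← inv_quadDensity]
  have : ∀ t, (quadDensity * fun t => (quadDensity t)⁻¹) t = 1 := fun t =>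
    ENNReal.mul_inv_cancel (quadDensity_ne_zero t) (quadDensity_ne_top t)
  simp only [this, lintegral_const, one_mul]
  exact measure_lt_top _ _

theorem isLocallyFiniteMeasure_of_integrable {ν : Measure ℝ}
    (hν : Integrable (fun t : ℝ => (1 + t ^ 2)⁻¹) ν) : IsLocallyFiniteMeasure ν := by
  refine ⟨fun x => ⟨Ioo (x - 1) (x + 1), Ioo_mem_nhds (by linarith) (by linarith), ?_⟩⟩
  have h := hν.measure_norm_ge_lt_top (ε := (1 + (|x| + 1) ^ 2)⁻¹) (by positivity)
  refine lt_of_le_of_lt (measure_mono fun t ht => ?_) h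
  change _ ≤ ‖_‖
  rw [Real.norm_eq_abs, abs_of_pos (by positivity : (0 : ℝ) < (1 + t ^ 2)⁻¹)]
  have : |t| ≤ |x| + 1 := by
    rw [abs_le]; constructor
    · linarith [ht.1, neg_abs_le x]
    · linarith [ht.2, le_abs_self x]
  apply inv_anti₀ (by positivity)
  rw [← sq_abs t]
  gcongr

/-- The Jordan decomposition is taken for the finite signed measure m₁ - m₂, and its parts are then
multiplied by 1 + t², which keeps them mutually singular. The crosswise sums avoid subtracting
measures of infinite mass. -/
theorem exists_realLocFinMeasure_sub (m₁ m₂ : Measure ℝ) [IsFiniteMeasure m₁]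
    [IsFiniteMeasure m₂] :
    ∃ μ : RealLocFinMeasure, Integrable (fun t : ℝ => (1 + t ^ 2)⁻¹) μ.variation ∧
      μ.pos + m₂.withDensity quadDensity = μ.neg + m₁.withDensity quadDensity := by
  set s : SignedMeasure ℝ := m₁.toSignedMeasure - m₂.toSignedMeasure with hs
  set j := s.toJordanDecomposition with hj
  have hps := j.posPart_finite
  have hns := j.negPart_finite
  have e : j.posPart + m₂ = j.negPart + m₁ := by
    apply Measure.toSignedMeasure_eq_toSignedMeasure_iff.1
    rw [Measure.toSignedMeasure_add, Measure.toSignedMeasure_add]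
    have := s.toSignedMeasure_toJordanDecomposition
    rw [JordanDecomposition.toSignedMeasure, ← hj, hs, sub_eq_sub_iff_add_eq_add] at this
    rw [this, add_comm]
  have hip := integrable_withDensity_quad j.posPart
  have hin := integrable_withDensity_quad j.negPart
  refine ⟨⟨j.posPart.withDensity quadDensity, j.negPart.withDensity quadDensity,
    isLocallyFiniteMeasure_of_integrable hip, isLocallyFiniteMeasure_of_integrable hin,
    ?_⟩, ?_, ?_⟩
  · exact (j.mutuallySingular.mono_ac (withDensity_absolutelyContinuous _ _)
      (withDensity_absolutelyContinuous _ _))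
  · rw [integrable_variation_iff]
    exact ⟨hip, hin⟩
  · simp only
    rw [← withDensity_add_measure, ← withDensity_add_measure, e]

/-- Dividing by 1 + t² makes all four measures finite. The hypothesis then says that two signed
measures agree, and the uniqueness of the Jordan decomposition applies. -/
theorem RealLocFinMeasure.eq_of_cross_add_eq {μ ν : RealLocFinMeasure}
    (hμ : Integrable (fun t : ℝ => (1 + t ^ 2)⁻¹) μ.variation)
    (hν : Integrable (fun t : ℝ => (1 + t ^ 2)⁻¹) ν.variation)
    (h : μ.pos + ν.neg = ν.pos + μ.neg) : μ = ν := by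
  rw [integrable_variation_iff] at hμ hν
  let J : ∀ ρ : RealLocFinMeasure, Integrable (fun t : ℝ => (1 + t ^ 2)⁻¹) ρ.pos ∧
      Integrable (fun t : ℝ => (1 + t ^ 2)⁻¹) ρ.neg → JordanDecomposition ℝ := fun ρ hρ =>
    { posPart := ρ.pos.withDensity fun t => (quadDensity t)⁻¹
      negPart := ρ.neg.withDensity fun t => (quadDensity t)⁻¹
      posPart_finite := isFiniteMeasure_withDensity_inv_quad hρ.1
      negPart_finite := isFiniteMeasure_withDensity_inv_quad hρ.2
      mutuallySingular := ρ.mutuallySingular.mono_ac (withDensity_absolutelyContinuous _ _)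
        (withDensity_absolutelyContinuous _ _) }
  have hJ : J μ hμ = J ν hν := by
    apply JordanDecomposition.toSignedMeasure_injective
    have := (J μ hμ).posPart_finite
    have := (J μ hμ).negPart_finite
    have := (J ν hν).posPart_finite
    have := (J ν hν).negPart_finite
    rw [JordanDecomposition.toSignedMeasure, JordanDecomposition.toSignedMeasure,
      sub_eq_sub_iff_add_eq_add, ← Measure.toSignedMeasure_add, ← Measure.toSignedMeasure_add]
    congr 1
    simp only [J]
    rw [← withDensity_add_measure, ← withDensity_add_measure, h]
  have h1 := congrArg (fun j => j.posPart.withDensity quadDensity) hJ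
  have h2 := congrArg (fun j => j.negPart.withDensity quadDensity) hJ
  simp only [J, withDensity_quad_inv] at h1 h2
  cases μ; cases ν
  simp only at h1 h2
  subst h1 h2
  rfl

/-! ### Cauchy kernels on the upper half-plane -/

/-- A constant comparing `|t + i|` with `|t - z|`. -/
def cauchyConst (z : ℂ) : ℝ := 1 + (‖z‖ + 1) / z.im

theorem cauchyConst_pos {z : ℂ} (hz : 0 < z.im) : 0 < cauchyConst z := by
  unfold cauchyConst; positivity

theorem cauchyConst_le {z : ℂ} {c : ℝ} (hc : 0 < c) (hz : c ≤ z.im) :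
    cauchyConst z ≤ 1 + (‖z‖ + 1) / c := by
  unfold cauchyConst; gcongr

theorem im_le_norm_sub (z : ℂ) (t : ℝ) : z.im ≤ ‖z - t‖ := by
  have := (le_abs_self _).trans (Complex.abs_im_le_norm (z - t))
  simpa using this

theorem sub_ofReal_ne_zero {z : ℂ} (hz : 0 < z.im) (t : ℝ) : z - t ≠ 0 :=
  norm_pos_iff.1 (hz.trans_le (im_le_norm_sub z t))

theorem norm_conj_sub (w : ℂ) (t : ℝ) : ‖conj w - t‖ = ‖w - t‖ := by
  rw [← Complex.norm_conj (w - t), map_sub, Complex.conj_ofReal]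

theorem conj_sub_ofReal_ne_zero {z : ℂ} (hz : 0 < z.im) (t : ℝ) : conj z - t ≠ 0 := by
  rw [← norm_pos_iff, norm_conj_sub, norm_pos_iff]
  exact sub_ofReal_ne_zero hz t

/-- The left side is |t + i|, and t + i = (z + i) - (z - t), where |z + i| is absorbed through Im z
≤ |z - t|. -/
theorem sqrt_one_add_sq_le {z : ℂ} (hz : 0 < z.im) (t : ℝ) :
    √(1 + t ^ 2) ≤ cauchyConst z * ‖z - t‖ := by
  have h1 : √(1 + t ^ 2) = ‖(t : ℂ) + Complex.I‖ := by
    rw [add_comm (t : ℂ), Complex.norm_def, Complex.normSq_apply]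
    congr 1
    simp; ring
  have h2 : (t : ℂ) + Complex.I = (z + Complex.I) - (z - t) := by ring
  rw [h1, h2]
  have h3 : ‖z + Complex.I‖ ≤ ‖z‖ + 1 := (norm_add_le _ _).trans (by simp)
  have h4 := im_le_norm_sub z t
  calc ‖(z + Complex.I) - (z - t)‖ ≤ ‖z + Complex.I‖ + ‖z - t‖ := norm_sub_le _ _
    _ ≤ (‖z‖ + 1) + ‖z - t‖ := by gcongr
    _ ≤ (‖z‖ + 1) / z.im * ‖z - t‖ + ‖z - t‖ := by
        gcongr
        rw [div_mul_eq_mul_div, le_div_iff₀ hz]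
        gcongr
    _ = cauchyConst z * ‖z - t‖ := by unfold cauchyConst; ring

theorem inv_norm_sub_le {z : ℂ} (hz : 0 < z.im) (t : ℝ) :
    ‖z - t‖⁻¹ ≤ cauchyConst z * (√(1 + t ^ 2))⁻¹ := by
  have h := sqrt_one_add_sq_le hz t
  have h1 : 0 < √(1 + t ^ 2) := by positivity
  have h2 : 0 < ‖z - t‖ := norm_pos_iff.2 (sub_ofReal_ne_zero hz t)
  rw [← div_eq_mul_inv, le_div_iff₀ h1, inv_mul_le_iff₀ h2]
  linarith

theorem inv_norm_mul_le {z w : ℂ} (hz : 0 < z.im) (hw : 0 < w.im) (t : ℝ) :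
    ‖z - t‖⁻¹ * ‖w - t‖⁻¹ ≤ cauchyConst z * cauchyConst w * (1 + t ^ 2)⁻¹ := by
  have h1 : (1 + t ^ 2)⁻¹ = (√(1 + t ^ 2))⁻¹ * (√(1 + t ^ 2))⁻¹ := by
    rw [← mul_inv, Real.mul_self_sqrt (by positivity)]
  calc ‖z - t‖⁻¹ * ‖w - t‖⁻¹
      ≤ (cauchyConst z * (√(1 + t ^ 2))⁻¹) * (cauchyConst w * (√(1 + t ^ 2))⁻¹) := by
        have := inv_norm_sub_le hz t
        have := inv_norm_sub_le hw t
        have := cauchyConst_pos hz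
        gcongr
    _ = _ := by rw [h1]; ring

/-- The kernel `1 / ((z - t)(w̄ - t))`. -/
def cauchyKer (z w : ℂ) (t : ℝ) : ℂ := 1 / ((z - t) * (conj w - t))

theorem norm_cauchyKer (z w : ℂ) (t : ℝ) : ‖cauchyKer z w t‖ = ‖z - t‖⁻¹ * ‖w - t‖⁻¹ := by
  rw [cauchyKer, norm_div, norm_mul, norm_conj_sub, norm_one, one_div, mul_inv]

theorem norm_cauchyKer_le {z w : ℂ} (hz : 0 < z.im) (hw : 0 < w.im) (t : ℝ) :
    ‖cauchyKer z w t‖ ≤ cauchyConst z * cauchyConst w * (1 + t ^ 2)⁻¹ := by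
  rw [norm_cauchyKer]; exact inv_norm_mul_le hz hw t

theorem continuous_cauchyKer {z w : ℂ} (hz : 0 < z.im) (hw : 0 < w.im) :
    Continuous (cauchyKer z w) := by
  unfold cauchyKer
  refine Continuous.div continuous_const (by fun_prop) fun t => ?_
  exact mul_ne_zero (sub_ofReal_ne_zero hz t) (conj_sub_ofReal_ne_zero hw t)

theorem integrable_cauchyKer {z w : ℂ} (hz : 0 < z.im) (hw : 0 < w.im) {ν : Measure ℝ}
    (hν : Integrable (fun t : ℝ => (1 + t ^ 2)⁻¹) ν) : Integrable (cauchyKer z w) ν :=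
  (continuous_cauchyKer hz hw).integrable_of_le_inv_one_add_sq hν (norm_cauchyKer_le hz hw)

/-- Partial fractions separate z from w. The two terms on the right need not be integrable against μ
on their own. -/
theorem cauchyKer_mul_sub {z w : ℂ} (hz : 0 < z.im) (hw : 0 < w.im) (t : ℝ) :
    (z - conj w) * cauchyKer z w t = 1 / (conj w - t) - 1 / (z - t) := by
  have h1 := sub_ofReal_ne_zero hz t
  have h2 := conj_sub_ofReal_ne_zero hw t
  rw [cauchyKer]
  field_simp
  ring

theorem sub_conj_ne_zero {z w : ℂ} (hz : 0 < z.im) (hw : 0 < w.im) : z - conj w ≠ 0 := by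
  intro h
  have := congrArg Complex.im h
  simp at this
  linarith

theorem kernelIdentity_iff (f : ℂ → ℂ) (μ : RealLocFinMeasure) :
    KernelIdentity f μ ↔ ∀ z ∈ upperHalf, ∀ w ∈ upperHalf,
      f z + conj (f w) =
        1 / (2 * Real.pi * Complex.I) * ((z - conj w) * μ.integral (cauchyKer z w)) := by
  unfold KernelIdentity
  refine forall₂_congr fun z hz => forall₂_congr fun w hw => ?_
  rw [div_eq_iff (sub_conj_ne_zero hz hw)]
  change _ = _ * μ.integral (cauchyKer z w) * _ ↔ _
  rw [mul_assoc, mul_comm (μ.integral _)]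

/-- The normalized Herglotz transform of a measure of degree at most two. -/
def herglotz (μ : RealLocFinMeasure) (z : ℂ) : ℂ :=
  1 / (2 * Real.pi * Complex.I) * ((z + Complex.I) * μ.integral (cauchyKer z Complex.I))
    - 1 / (2 * Real.pi) * μ.integral (cauchyKer Complex.I Complex.I)

theorem I_im_pos : (0 : ℝ) < Complex.I.im := by simp

theorem herglotz_kernelIdentity {μ : RealLocFinMeasure}
    (hμ : Integrable (fun t : ℝ => (1 + t ^ 2)⁻¹) μ.variation) :
    KernelIdentity (herglotz μ) μ := by
  rw [kernelIdentity_iff]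
  intro z hz w hw
  have hI := I_im_pos
  have i1 := integrable_cauchyKer hz hI hμ
  have i2 := integrable_cauchyKer hI hw hμ
  have i3 := integrable_cauchyKer hI hI hμ
  -- Each partial fraction is compared with the one at the base point i, so that every term is an
  -- integrable kernel; z and w are then separated.
  have key : (z - conj w) * μ.integral (cauchyKer z w) =
      (z + Complex.I) * μ.integral (cauchyKer z Complex.I)
      + (Complex.I - conj w) * μ.integral (cauchyKer Complex.I w)
      - 2 * Complex.I * μ.integral (cauchyKer Complex.I Complex.I) := by
    simp only [← RealLocFinMeasure.integral_const_mul']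
    have i12 : Integrable (fun t => (z + Complex.I) * cauchyKer z Complex.I t +
        (Complex.I - conj w) * cauchyKer Complex.I w t) μ.variation :=
      (i1.const_mul _).add (i2.const_mul _)
    rw [← RealLocFinMeasure.integral_add' (i1.const_mul _) (i2.const_mul _),
      ← RealLocFinMeasure.integral_sub' i12 (i3.const_mul _)]
    congr 1
    ext t
    have e1 := cauchyKer_mul_sub hz hI t
    have e2 := cauchyKer_mul_sub hI hI t
    rw [Complex.conj_I, sub_neg_eq_add] at e1 e2
    rw [cauchyKer_mul_sub hz hw, cauchyKer_mul_sub hI hw, e1,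
      show 2 * Complex.I = Complex.I + Complex.I by ring, e2]
    ring
  have c1 : ∀ z w : ℂ, conj (μ.integral (cauchyKer z w)) = μ.integral (cauchyKer w z) := by
    intro z w
    rw [← RealLocFinMeasure.integral_conj']
    congr 1
    ext t
    simp [cauchyKer, mul_comm]
  rw [key]
  simp only [herglotz, map_sub, map_mul, map_add, map_div₀, map_one, Complex.conj_I,
    Complex.conj_ofReal, c1, map_ofNat]
  have : (Real.pi : ℂ) ≠ 0 := by exact_mod_cast Real.pi_ne_zero
  field_simp
  ring

/-- The difference D of two solutions satisfies D(z) = -conj D(w) for all z and w, so it is constant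
and purely imaginary. -/
theorem KernelIdentity.exists_eq_herglotz_add {f : ℂ → ℂ} {μ : RealLocFinMeasure}
    (hμ : Integrable (fun t : ℝ => (1 + t ^ 2)⁻¹) μ.variation) (h : KernelIdentity f μ) :
    ∃ κ : ℝ, ∀ z ∈ upperHalf, f z = herglotz μ z + κ * Complex.I := by
  have hg := herglotz_kernelIdentity hμ
  rw [kernelIdentity_iff] at h hg
  have hI : Complex.I ∈ upperHalf := I_im_pos
  have e : ∀ z ∈ upperHalf, ∀ w ∈ upperHalf,
      f z - herglotz μ z = - conj (f w - herglotz μ w) := by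
    intro z hz w hw
    have := (h z hz w hw).trans (hg z hz w hw).symm
    rw [map_sub]
    linear_combination this
  have hre : (f Complex.I - herglotz μ Complex.I).re = 0 := by
    have := congrArg Complex.re (e _ hI _ hI)
    simp only [Complex.neg_re, Complex.conj_re] at this
    linarith
  refine ⟨(f Complex.I - herglotz μ Complex.I).im, fun z hz => ?_⟩
  have h1 := e z hz _ hI
  have : -conj (f Complex.I - herglotz μ Complex.I) =
      ((f Complex.I - herglotz μ Complex.I).im : ℂ) * Complex.I := by
    apply Complex.ext
    · simp only [Complex.neg_re, Complex.conj_re, hre]; simp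
    · simp; ring
  rw [this] at h1
  linear_combination h1

/-- On the diagonal w = z the kernel becomes the Poisson kernel. -/
theorem two_mul_re_of_kernelIdentity {f : ℂ → ℂ} {μ : RealLocFinMeasure}
    (h : KernelIdentity f μ) {z : ℂ} (hz : z ∈ upperHalf) :
    ((2 * (f z).re : ℝ) : ℂ) =
      μ.integral fun t => (((z.im / Real.pi) * (‖z - t‖ ^ 2)⁻¹ : ℝ) : ℂ) := by
  rw [kernelIdentity_iff] at h
  have h1 := h z hz z hz
  rw [Complex.add_conj] at h1
  rw [h1, ← RealLocFinMeasure.integral_const_mul', ← RealLocFinMeasure.integral_const_mul']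
  congr 1
  ext t
  have : (Real.pi : ℂ) ≠ 0 := by exact_mod_cast Real.pi_ne_zero
  have h2 : (z - t) * (conj z - t) = ((‖z - t‖ ^ 2 : ℝ) : ℂ) := by
    rw [← Complex.normSq_eq_norm_sq, ← Complex.mul_conj, map_sub, Complex.conj_ofReal]
  rw [cauchyKer, h2, Complex.sub_conj]
  push_cast
  field_simp

theorem differentiableOn_integral_cauchyKer {ν : Measure ℝ}
    (hν : Integrable (fun t : ℝ => (1 + t ^ 2)⁻¹) ν) :
    DifferentiableOn ℂ (fun z => ∫ t, cauchyKer z Complex.I t ∂ν) upperHalf := by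
  intro z₀ hz₀
  apply DifferentiableAt.differentiableWithinAt
  have hz : 0 < z₀.im := hz₀
  set r := z₀.im / 2 with hr
  have him : ∀ z ∈ Metric.ball z₀ r, r ≤ z.im := by
    intro z hz'
    rw [Metric.mem_ball, dist_eq_norm] at hz'
    have := (Complex.abs_im_le_norm (z - z₀)).trans_lt hz'
    rw [Complex.sub_im, abs_lt] at this
    linarith [this.1]
  have hr0 : 0 < r := by positivity
  have hnorm : ∀ z ∈ Metric.ball z₀ r, ‖z‖ ≤ ‖z₀‖ + r := by
    intro z hz'
    rw [Metric.mem_ball, dist_eq_norm] at hz'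
    have := norm_add_le (z - z₀) z₀
    rw [sub_add_cancel] at this
    linarith
  have hcc : ∀ z ∈ Metric.ball z₀ r, cauchyConst z ≤ 1 + (‖z₀‖ + r + 1) / r := fun z hz' =>
    (cauchyConst_le hr0 (him z hz')).trans (by have := hnorm z hz'; gcongr)
  have hF := hasDerivAt_integral_of_dominated_loc_of_deriv_le (μ := ν) (𝕜 := ℂ)
    (F := fun z t => cauchyKer z Complex.I t)
    (F' := fun z t => - (1 / (z - t)) * cauchyKer z Complex.I t) (x₀ := z₀)
    (bound := fun t => r⁻¹ * ((1 + (‖z₀‖ + r + 1) / r) * cauchyConst Complex.I) * (1 + t ^ 2)⁻¹)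
    (s := Metric.ball z₀ r) (Metric.ball_mem_nhds _ hr0) ?_ ?_ ?_ ?_ ?_ ?_
  · exact hF.2.differentiableAt
  · filter_upwards [Metric.ball_mem_nhds z₀ hr0] with z hz'
    exact (continuous_cauchyKer (hr0.trans_le (him z hz')) I_im_pos).aestronglyMeasurable
  · exact integrable_cauchyKer hz I_im_pos hν
  · refine (Continuous.mul (Continuous.neg (Continuous.div continuous_const (by fun_prop)
      fun t => sub_ofReal_ne_zero hz t)) (continuous_cauchyKer hz I_im_pos)).aestronglyMeasurable
  · refine ae_of_all _ fun t z hz' => ?_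
    have hzim := hr0.trans_le (him z hz')
    rw [norm_mul, norm_neg, norm_div, norm_one, one_div, mul_assoc r⁻¹]
    refine mul_le_mul ?_ ?_ (norm_nonneg _) (by positivity)
    · exact inv_anti₀ hr0 ((him z hz').trans (im_le_norm_sub z t))
    · refine (norm_cauchyKer_le hzim I_im_pos t).trans ?_
      have := hcc z hz'
      have := cauchyConst_pos I_im_pos
      gcongr
  · exact hν.const_mul _
  · refine ae_of_all _ fun t z hz' => ?_
    have hzim := hr0.trans_le (him z hz')
    have h1 := sub_ofReal_ne_zero hzim t
    have h2 := conj_sub_ofReal_ne_zero I_im_pos t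
    have hd : HasDerivAt (fun z : ℂ => (z - t) * (conj Complex.I - t)) (conj Complex.I - t) z := by
      simpa using ((hasDerivAt_id z).sub_const (t : ℂ)).mul_const (conj Complex.I - t)
    have := (hasDerivAt_const z (1 : ℂ)).div hd (mul_ne_zero h1 h2)
    refine this.congr_deriv ?_
    rw [cauchyKer]
    field_simp
    ring

theorem differentiableOn_herglotz {μ : RealLocFinMeasure}
    (hμ : Integrable (fun t : ℝ => (1 + t ^ 2)⁻¹) μ.variation) :
    DifferentiableOn ℂ (herglotz μ) upperHalf := by
  rw [integrable_variation_iff] at hμ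
  unfold herglotz RealLocFinMeasure.integral
  have h1 := differentiableOn_integral_cauchyKer hμ.1
  have h2 := differentiableOn_integral_cauchyKer hμ.2
  exact (((differentiableOn_id.add_const _).mul (h1.sub h2)).const_mul _).sub_const _

/-- A nonnegative locally finite measure as a real-valued one. -/
def RealLocFinMeasure.ofMeasure (ν : Measure ℝ) [IsLocallyFiniteMeasure ν] : RealLocFinMeasure :=
  ⟨ν, 0, inferInstance, inferInstance, Measure.MutuallySingular.zero_right⟩

theorem herglotz_eq_sub (μ : RealLocFinMeasure) (z : ℂ) :
    herglotz μ z = herglotz (.ofMeasure μ.pos) z - herglotz (.ofMeasure μ.neg) z := by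
  simp only [herglotz, RealLocFinMeasure.integral, RealLocFinMeasure.ofMeasure,
    integral_zero_measure, sub_zero]
  ring

theorem integrable_variation_ofMeasure {ν : Measure ℝ} [IsLocallyFiniteMeasure ν]
    (hν : Integrable (fun t : ℝ => (1 + t ^ 2)⁻¹) ν) :
    Integrable (fun t : ℝ => (1 + t ^ 2)⁻¹) (RealLocFinMeasure.ofMeasure ν).variation := by
  rw [integrable_variation_iff]
  exact ⟨hν, integrable_zero_measure⟩

theorem re_herglotz_ofMeasure_nonneg {ν : Measure ℝ} [IsLocallyFiniteMeasure ν]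
    (hν : Integrable (fun t : ℝ => (1 + t ^ 2)⁻¹) ν) {z : ℂ} (hz : z ∈ upperHalf) :
    0 ≤ (herglotz (.ofMeasure ν) z).re := by
  have h := two_mul_re_of_kernelIdentity
    (herglotz_kernelIdentity (integrable_variation_ofMeasure hν)) hz
  simp only [RealLocFinMeasure.integral, RealLocFinMeasure.ofMeasure,
    integral_zero_measure, sub_zero] at h
  rw [integral_complex_ofReal, Complex.ofReal_inj] at h
  have hz' : 0 < z.im := hz
  have : 0 ≤ ∫ t : ℝ, z.im / Real.pi * (‖z - t‖ ^ 2)⁻¹ ∂ν := by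
    apply integral_nonneg
    intro t
    have := Real.pi_pos
    change 0 ≤ z.im / Real.pi * (‖z - t‖ ^ 2)⁻¹
    positivity
  simp only [RealLocFinMeasure.ofMeasure]
  linarith

/-- With H₊ and H₋ the transforms of the two parts of μ, f = H₊ - H₋ + iκ and both have nonnegative
real part. Hence e^f is the quotient of e^{iκ-H₋} by e^{-H₊}, both bounded by 1. -/
theorem KernelIdentity.isBoundedType_exp {f : ℂ → ℂ} {μ : RealLocFinMeasure}
    (hμ : Integrable (fun t : ℝ => (1 + t ^ 2)⁻¹) μ.variation) (h : KernelIdentity f μ) :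
    IsBoundedType fun z => Complex.exp (f z) := by
  obtain ⟨κ, hκ⟩ := h.exists_eq_herglotz_add hμ
  have hμ' := (integrable_variation_iff _ _).1 hμ
  have dp := differentiableOn_herglotz (integrable_variation_ofMeasure hμ'.1)
  have dn := differentiableOn_herglotz (integrable_variation_ofMeasure hμ'.2)
  refine ⟨fun z => Complex.exp (κ * Complex.I - herglotz (.ofMeasure μ.neg) z),
    fun z => Complex.exp (-herglotz (.ofMeasure μ.pos) z), ?_, ?_, ⟨1, fun z hz => ?_⟩,
    ⟨Complex.I, I_im_pos, Complex.exp_ne_zero _⟩, fun z hz => ?_⟩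
  · exact (dn.const_sub _).cexp
  · exact dp.neg.cexp
  · have h1 := re_herglotz_ofMeasure_nonneg hμ'.1 hz
    have h2 := re_herglotz_ofMeasure_nonneg hμ'.2 hz
    simp only [Complex.norm_exp, Real.exp_le_one_iff]
    constructor <;> simp <;> assumption
  · simp only
    rw [← Complex.exp_add, hκ z hz, herglotz_eq_sub]
    congr 1
    ring

/-- The quotient equals (2π)⁻¹ ∫ dμ(t)/(y² + t²), which tends to 0 by dominated convergence. The
full limit, not only the limsup, is what the converse uses to remove a linear term. -/
theorem KernelIdentity.tendsto_re_div {f : ℂ → ℂ} {μ : RealLocFinMeasure}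
    (hμ : Integrable (fun t : ℝ => (1 + t ^ 2)⁻¹) μ.variation) (h : KernelIdentity f μ) :
    Tendsto (fun y : ℝ => (f (y * Complex.I)).re / y) atTop (𝓝 0) := by
  have key : Tendsto (fun y : ℝ => μ.integral fun t =>
      (((1 / Real.pi) * (‖(y * Complex.I : ℂ) - t‖ ^ 2)⁻¹ : ℝ) : ℂ)) atTop
      (𝓝 (μ.integral fun _ => 0)) := by
    have hn : ∀ y t : ℝ, ‖(y * Complex.I : ℂ) - t‖ ^ 2 = y ^ 2 + t ^ 2 := by
      intro y t
      rw [← Complex.normSq_eq_norm_sq, Complex.normSq_apply]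
      simp; ring
    simp only [hn]
    refine RealLocFinMeasure.tendsto_integral_of_dominated (b := fun t => (1 / Real.pi) *
      (1 + t ^ 2)⁻¹) (hμ.const_mul _) ?_ ?_ ?_
    · filter_upwards [eventually_ge_atTop 1] with y hy
      refine Complex.continuous_ofReal.comp (continuous_const.mul (Continuous.inv₀ (by fun_prop)
        fun t => by positivity))
    · filter_upwards [eventually_ge_atTop 1] with y hy t
      rw [Complex.norm_real, Real.norm_eq_abs, abs_of_nonneg (by have := Real.pi_pos; positivity)]
      have := Real.pi_pos
      gcongr
      nlinarith
    · intro t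
      rw [← Complex.ofReal_zero]
      apply (Complex.continuous_ofReal.tendsto 0).comp
      rw [← mul_zero (1 / Real.pi)]
      apply Tendsto.const_mul
      apply tendsto_inv_atTop_zero.comp
      exact tendsto_atTop_add_const_right _ _ (tendsto_pow_atTop two_ne_zero)
  have h0 : μ.integral (fun _ => 0) = 0 := by simp [RealLocFinMeasure.integral]
  rw [h0] at key
  have key2 : Tendsto (fun y : ℝ => (((f (y * Complex.I)).re / y : ℝ) : ℂ)) atTop (𝓝 0) := by
    rw [← zero_div 2]
    refine (key.div_const 2).congr' ?_
    filter_upwards [eventually_gt_atTop 0] with y hy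
    have hz : (y * Complex.I : ℂ) ∈ upperHalf := by simpa [upperHalf] using hy
    have h1 := two_mul_re_of_kernelIdentity h hz
    have him : (y * Complex.I : ℂ).im = y := by simp
    rw [him] at h1
    have : (fun t : ℝ => ((1 / Real.pi * (‖(y * Complex.I : ℂ) - t‖ ^ 2)⁻¹ : ℝ) : ℂ)) =
        fun t : ℝ => ((y⁻¹ : ℝ) : ℂ) * ((y / Real.pi * (‖(y * Complex.I : ℂ) - t‖ ^ 2)⁻¹ : ℝ) : ℂ) := by
      ext t
      rw [← Complex.ofReal_mul]
      congr 1
      field_simp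
    rw [this, RealLocFinMeasure.integral_const_mul', ← h1]
    push_cast
    field_simp
  simpa [Function.comp_def] using (Complex.continuous_re.tendsto 0).comp key2

theorem KernelIdentity.conditionIV {f : ℂ → ℂ} {μ : RealLocFinMeasure}
    (hμ : Integrable (fun t : ℝ => (1 + t ^ 2)⁻¹) μ.variation) (h : KernelIdentity f μ) :
    ConditionIV f := by
  refine ⟨h.isBoundedType_exp hμ, Tendsto.limsup_eq ?_⟩
  exact (continuous_coe_real_ereal.tendsto 0).comp (h.tendsto_re_div hμ)

/-- This growth bound is what allows Gaussian factors to control contour shifts. -/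
theorem KernelIdentity.norm_le {f : ℂ → ℂ} {μ : RealLocFinMeasure}
    (hμ : Integrable (fun t : ℝ => (1 + t ^ 2)⁻¹) μ.variation) (h : KernelIdentity f μ)
    {c : ℝ} (hc : 0 < c) :
    ∃ C : ℝ, 0 ≤ C ∧ ∀ z : ℂ, c ≤ z.im → ‖f z‖ ≤ C * (1 + ‖z‖) ^ 2 := by
  rw [kernelIdentity_iff] at h
  set m := ∫ t, (1 + t ^ 2)⁻¹ ∂μ.variation with hm
  have hm0 : 0 ≤ m := integral_nonneg fun t => by positivity
  have hA := cauchyConst_pos I_im_pos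
  refine ⟨‖f Complex.I‖ + 1 / (2 * Real.pi) * ((1 + 1 / c) * cauchyConst Complex.I * m), ?_,
    fun z hz => ?_⟩
  · have := Real.pi_pos
    positivity
  have hz0 : 0 < z.im := hc.trans_le hz
  have h1 := h z hz0 _ I_im_pos
  have h2 : f z = 1 / (2 * Real.pi * Complex.I) * ((z - conj Complex.I) *
    μ.integral (cauchyKer z Complex.I)) - conj (f Complex.I) := by rw [← h1]; ring
  have h3 : ‖μ.integral (cauchyKer z Complex.I)‖ ≤ cauchyConst z * cauchyConst Complex.I * m := by
    refine (RealLocFinMeasure.norm_integral_le (hμ.const_mul _)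
      (norm_cauchyKer_le hz0 I_im_pos)).trans_eq ?_
    rw [integral_const_mul]
  have h4 : cauchyConst z ≤ (1 + 1 / c) * (1 + ‖z‖) := by
    refine (cauchyConst_le hc hz).trans ?_
    have : 0 ≤ ‖z‖ := norm_nonneg z
    field_simp
    nlinarith
  have h5 : ‖z - conj Complex.I‖ ≤ 1 + ‖z‖ := by
    refine (norm_sub_le _ _).trans ?_
    rw [Complex.norm_conj, Complex.norm_I, add_comm]
  have h6 : ‖(1 / (2 * Real.pi * Complex.I) : ℂ)‖ = 1 / (2 * Real.pi) := by
    simp [abs_of_pos Real.pi_pos]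
  rw [h2]
  refine (norm_sub_le _ _).trans ?_
  rw [Complex.norm_conj, norm_mul, norm_mul, h6]
  have hp := Real.pi_pos
  calc 1 / (2 * Real.pi) * (‖z - conj Complex.I‖ * ‖μ.integral (cauchyKer z Complex.I)‖) + ‖f Complex.I‖
      ≤ 1 / (2 * Real.pi) * ((1 + ‖z‖) * (((1 + 1 / c) * (1 + ‖z‖)) * cauchyConst Complex.I * m))
        + ‖f Complex.I‖ * (1 + ‖z‖) ^ 2 := by
        gcongr
        · exact h3.trans (by gcongr)
        · refine le_mul_of_one_le_right (norm_nonneg _) ?_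
          have : 0 ≤ ‖z‖ := norm_nonneg z
          nlinarith
    _ = _ := by ring

/-! ### The Poisson kernel -/

/-- The Poisson kernel of the half-plane. -/
def poisson (y u : ℝ) : ℝ := y / Real.pi * (u ^ 2 + y ^ 2)⁻¹

theorem poisson_nonneg {y : ℝ} (hy : 0 < y) (u : ℝ) : 0 ≤ poisson y u := by
  have := Real.pi_pos
  unfold poisson; positivity

theorem continuous_poisson {y : ℝ} (hy : 0 < y) : Continuous (poisson y) := by
  unfold poisson
  exact continuous_const.mul (Continuous.inv₀ (by fun_prop) fun t => by positivity)

theorem poisson_mul {y : ℝ} (hy : 0 < y) (s : ℝ) :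
    y * poisson y (y * s) = Real.pi⁻¹ * (1 + s ^ 2)⁻¹ := by
  have := Real.pi_pos
  unfold poisson
  field_simp
  ring

theorem integrable_poisson {y : ℝ} (hy : 0 < y) : Integrable (poisson y) := by
  have h : Integrable fun s => poisson y (y * s) := by
    have : (fun s => poisson y (y * s)) = fun s => y⁻¹ * (Real.pi⁻¹ * (1 + s ^ 2)⁻¹) := by
      ext s
      rw [← poisson_mul hy]
      field_simp
    rw [this]
    exact (integrable_inv_one_add_sq.const_mul _).const_mul _
  exact (integrable_comp_mul_left_iff (poisson y) hy.ne').1 h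

/-- The substitution x = t + ys removes y from the kernel, which makes continuity in t and the limit
y → 0 accessible to dominated convergence. -/
theorem integral_mul_poisson_eq {E : Type*} [NormedAddCommGroup E] [NormedSpace ℝ E]
    {y : ℝ} (hy : 0 < y) (t : ℝ) (ψ : ℝ → E) :
    ∫ x, poisson y (x - t) • ψ x = ∫ s, (Real.pi⁻¹ * (1 + s ^ 2)⁻¹) • ψ (t + y * s) := by
  have h1 := integral_add_left_eq_self (μ := volume) (fun x => poisson y (x - t) • ψ x) t
  rw [← h1]
  have h2 := Measure.integral_comp_mul_left (fun x => poisson y (t + x - t) • ψ (t + x)) y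
  rw [abs_of_pos (inv_pos.2 hy)] at h2
  have h3 : ∫ x, poisson y (t + x - t) • ψ (t + x) =
      y • ∫ s, poisson y (t + y * s - t) • ψ (t + y * s) := by
    rw [h2, smul_inv_smul₀ hy.ne']
  rw [h3, ← integral_smul]
  congr 1
  ext s
  rw [smul_smul, add_sub_cancel_left, poisson_mul hy]

theorem integral_poisson_sub {y : ℝ} (hy : 0 < y) (t : ℝ) : ∫ x, poisson y (x - t) = 1 := by
  have h := integral_mul_poisson_eq hy t (fun _ => (1 : ℝ))
  simp only [smul_eq_mul, mul_one] at h
  rw [h, integral_const_mul, integral_univ_inv_one_add_sq, inv_mul_cancel₀ Real.pi_ne_zero]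

/-- It comes from 1 + t² ≤ 2(1 + x²) + 2(x - t)². Integrated in x, it shows that Poisson smoothing
preserves O(1/(1+t²)) decay, with a constant that stays bounded as y → 0. -/
theorem inv_one_add_sq_mul_poisson_le {y : ℝ} (hy : 0 < y) (x t : ℝ) :
    (1 + x ^ 2)⁻¹ * poisson y (x - t) ≤
      (1 + t ^ 2)⁻¹ * (2 * poisson y (x - t) + 2 * y / Real.pi * (1 + x ^ 2)⁻¹) := by
  have hp := Real.pi_pos
  have h0 := poisson_nonneg hy (x - t)
  have h1 : (x - t) ^ 2 * poisson y (x - t) ≤ y / Real.pi := by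
    unfold poisson
    rw [mul_left_comm]
    refine mul_le_of_le_one_right (by positivity) ?_
    rw [← div_eq_mul_inv, div_le_one (by positivity)]
    nlinarith
  have h2 : 1 + t ^ 2 ≤ 2 * (1 + x ^ 2) + 2 * (x - t) ^ 2 := by nlinarith [sq_nonneg (2 * x - t)]
  rw [← div_eq_inv_mul (_ + _), le_div_iff₀ (by positivity)]
  calc (1 + x ^ 2)⁻¹ * poisson y (x - t) * (1 + t ^ 2)
      ≤ (1 + x ^ 2)⁻¹ * poisson y (x - t) * (2 * (1 + x ^ 2) + 2 * (x - t) ^ 2) := by gcongr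
    _ = 2 * poisson y (x - t) + 2 * (1 + x ^ 2)⁻¹ * ((x - t) ^ 2 * poisson y (x - t)) := by
        field_simp
    _ ≤ 2 * poisson y (x - t) + 2 * (1 + x ^ 2)⁻¹ * (y / Real.pi) := by gcongr
    _ = _ := by ring

theorem integrable_poisson_majorant {y : ℝ} (hy : 0 < y) (t : ℝ) : Integrable fun x : ℝ =>
    (1 + t ^ 2)⁻¹ * (2 * poisson y (x - t) + 2 * y / Real.pi * (1 + x ^ 2)⁻¹) :=
  ((((integrable_poisson hy).comp_sub_right t).const_mul 2).add
    (integrable_inv_one_add_sq.const_mul _)).const_mul _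

theorem norm_mul_poisson_le {ψ : ℝ → ℂ} {C : ℝ} (h : ∀ x, ‖ψ x‖ ≤ C * (1 + x ^ 2)⁻¹)
    {y : ℝ} (hy : 0 < y) (x t : ℝ) : ‖poisson y (x - t) • ψ x‖ ≤
      C * ((1 + t ^ 2)⁻¹ * (2 * poisson y (x - t) + 2 * y / Real.pi * (1 + x ^ 2)⁻¹)) := by
  have hC : 0 ≤ C := by simpa using (norm_nonneg _).trans (h 0)
  rw [norm_smul, Real.norm_eq_abs, abs_of_nonneg (poisson_nonneg hy _)]
  refine (mul_le_mul_of_nonneg_left (h x) (poisson_nonneg hy _)).trans ?_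
  rw [mul_left_comm, mul_comm (poisson y _)]
  exact mul_le_mul_of_nonneg_left (inv_one_add_sq_mul_poisson_le hy x t) hC

theorem integrable_poisson_smul {ψ : ℝ → ℂ} (hψ : Continuous ψ) {C : ℝ}
    (h : ∀ x, ‖ψ x‖ ≤ C * (1 + x ^ 2)⁻¹) {y : ℝ} (hy : 0 < y) (t : ℝ) :
    Integrable fun x => poisson y (x - t) • ψ x := by
  refine ((integrable_poisson_majorant hy t).const_mul C).mono' ?_
    (ae_of_all _ fun x => norm_mul_poisson_le h hy x t)
  exact (((continuous_poisson hy).comp (continuous_id.sub continuous_const)).smul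
    hψ).aestronglyMeasurable

theorem integral_norm_poisson_smul_le {ψ : ℝ → ℂ} (hψ : Continuous ψ) {C : ℝ}
    (h : ∀ x, ‖ψ x‖ ≤ C * (1 + x ^ 2)⁻¹) {y : ℝ} (hy : 0 < y) (t : ℝ) :
    ∫ x, ‖poisson y (x - t) • ψ x‖ ≤ C * (2 + 2 * y) * (1 + t ^ 2)⁻¹ := by
  refine (integral_mono (integrable_poisson_smul hψ h hy t).norm
    ((integrable_poisson_majorant hy t).const_mul C)
    fun x => norm_mul_poisson_le h hy x t).trans_eq ?_
  simp only [integral_const_mul]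
  rw [integral_add (((integrable_poisson hy).comp_sub_right t).const_mul 2)
    (integrable_inv_one_add_sq.const_mul _)]
  simp only [integral_const_mul, integral_poisson_sub hy, integral_univ_inv_one_add_sq]
  have := Real.pi_ne_zero
  field_simp

theorem norm_integral_poisson_smul_le {ψ : ℝ → ℂ} (hψ : Continuous ψ) {C : ℝ}
    (h : ∀ x, ‖ψ x‖ ≤ C * (1 + x ^ 2)⁻¹) {y : ℝ} (hy : 0 < y) (t : ℝ) :
    ‖∫ x, poisson y (x - t) • ψ x‖ ≤ C * (2 + 2 * y) * (1 + t ^ 2)⁻¹ :=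
  (norm_integral_le_integral_norm _).trans (integral_norm_poisson_smul_le hψ h hy t)

theorem continuous_integral_poisson_smul {ψ : ℝ → ℂ} (hψ : Continuous ψ) {C : ℝ}
    (h : ∀ x, ‖ψ x‖ ≤ C) {y : ℝ} (hy : 0 < y) :
    Continuous fun t => ∫ x, poisson y (x - t) • ψ x := by
  simp only [integral_mul_poisson_eq hy]
  refine continuous_of_dominated (bound := fun s => (Real.pi⁻¹ * (1 + s ^ 2)⁻¹) * C) ?_ ?_ ?_ ?_
  · intro t
    exact ((continuous_const.mul continuous_inv_one_add_sq).smul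
      (by fun_prop : Continuous fun s => ψ (t + y * s))).aestronglyMeasurable
  · refine fun t => ae_of_all _ fun s => ?_
    have := Real.pi_pos
    rw [norm_smul, Real.norm_eq_abs, abs_of_pos (by positivity)]
    gcongr
    exact h _
  · exact (integrable_inv_one_add_sq.const_mul _).mul_const _
  · refine ae_of_all _ fun s => ?_
    fun_prop

theorem tendsto_integral_poisson_smul {ψ : ℝ → ℂ} (hψ : Continuous ψ) {C : ℝ}
    (h : ∀ x, ‖ψ x‖ ≤ C) (t : ℝ) :
    Tendsto (fun y => ∫ x, poisson y (x - t) • ψ x) (𝓝[>] 0) (𝓝 (ψ t)) := by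
  have h1 : Tendsto (fun y => ∫ s, (Real.pi⁻¹ * (1 + s ^ 2)⁻¹) • ψ (t + y * s)) (𝓝[>] (0 : ℝ))
      (𝓝 (∫ s, (Real.pi⁻¹ * (1 + s ^ 2)⁻¹) • ψ (t + 0 * s))) := by
    refine tendsto_integral_filter_of_dominated_convergence
      (fun s => (Real.pi⁻¹ * (1 + s ^ 2)⁻¹) * C) ?_ ?_ ?_ ?_
    · refine Eventually.of_forall fun y => ?_
      exact ((continuous_const.mul continuous_inv_one_add_sq).smul
        (by fun_prop : Continuous fun s => ψ (t + y * s))).aestronglyMeasurable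
    · refine Eventually.of_forall fun y => ae_of_all _ fun s => ?_
      have := Real.pi_pos
      rw [norm_smul, Real.norm_eq_abs, abs_of_pos (by positivity)]
      gcongr
      exact h _
    · exact (integrable_inv_one_add_sq.const_mul _).mul_const _
    · refine ae_of_all _ fun s => Tendsto.mono_left ?_ nhdsWithin_le_nhds
      exact (by fun_prop : Continuous fun y : ℝ => (Real.pi⁻¹ * (1 + s ^ 2)⁻¹) • ψ (t + y * s)).tendsto 0
  have h2 : ∫ s : ℝ, (Real.pi⁻¹ * (1 + s ^ 2)⁻¹) • ψ (t + 0 * s) = ψ t := by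
    simp only [zero_mul, add_zero]
    rw [integral_smul_const, integral_const_mul, integral_univ_inv_one_add_sq,
      inv_mul_cancel₀ Real.pi_ne_zero, one_smul]
  rw [h2] at h1
  refine h1.congr' ?_
  filter_upwards [self_mem_nhdsWithin] with y hy
  exact (integral_mul_poisson_eq hy t ψ).symm

theorem integrable_prod_poisson_smul {ν : Measure ℝ} [SFinite ν]
    (hν : Integrable (fun t : ℝ => (1 + t ^ 2)⁻¹) ν) {ψ : ℝ → ℂ} (hψ : Continuous ψ) {C : ℝ}
    (h : ∀ x, ‖ψ x‖ ≤ C * (1 + x ^ 2)⁻¹) {y : ℝ} (hy : 0 < y) :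
    Integrable (fun p : ℝ × ℝ => poisson y (p.2 - p.1) • ψ p.2) (ν.prod volume) := by
  have hc : Continuous (fun p : ℝ × ℝ => poisson y (p.2 - p.1) • ψ p.2) :=
    ((continuous_poisson hy).comp (by fun_prop)).smul (hψ.comp continuous_snd)
  rw [integrable_prod_iff hc.aestronglyMeasurable]
  refine ⟨ae_of_all _ fun t => integrable_poisson_smul hψ h hy t, ?_⟩
  refine integrable_of_le_inv_one_add_sq hν (C := C * (2 + 2 * y)) ?_ fun t => ?_
  · exact hc.norm.aestronglyMeasurable.integral_prod_right'
  · rw [Real.norm_eq_abs, abs_of_nonneg (integral_nonneg fun x => norm_nonneg _)]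
    exact integral_norm_poisson_smul_le hψ h hy t

/-- Fubini moves the smoothing from the test function to μ, where it becomes the harmonic function 2
Re f on a horizontal line. -/
theorem RealLocFinMeasure.integral_poisson_swap {μ : RealLocFinMeasure}
    (hμ : Integrable (fun t : ℝ => (1 + t ^ 2)⁻¹) μ.variation) {ψ : ℝ → ℂ} (hψ : Continuous ψ)
    {C : ℝ} (h : ∀ x, ‖ψ x‖ ≤ C * (1 + x ^ 2)⁻¹) {y : ℝ} (hy : 0 < y) :
    μ.integral (fun t => ∫ x, poisson y (x - t) • ψ x) =
      ∫ x, μ.integral (fun t => (poisson y (x - t) : ℂ)) * ψ x := by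
  rw [integrable_variation_iff] at hμ
  have i1 := integrable_prod_poisson_smul hμ.1 hψ h hy
  have i2 := integrable_prod_poisson_smul hμ.2 hψ h hy
  have e : ∀ (ν : Measure ℝ) (x : ℝ), ∫ t, poisson y (x - t) • ψ x ∂ν =
      (∫ t, (poisson y (x - t) : ℂ) ∂ν) * ψ x := by
    intro ν x
    rw [← integral_mul_const]
    simp only [Complex.real_smul]
  simp only [RealLocFinMeasure.integral]
  rw [integral_integral_swap (f := fun t x => poisson y (x - t) • ψ x) i1,
    integral_integral_swap (f := fun t x => poisson y (x - t) • ψ x) i2, ← MeasureTheory.integral_sub i1.integral_prod_right i2.integral_prod_right]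
  simp only [e, sub_mul]

theorem KernelIdentity.two_mul_re_eq {f : ℂ → ℂ} {μ : RealLocFinMeasure}
    (h : KernelIdentity f μ) {y : ℝ} (hy : 0 < y) (x : ℝ) :
    ((2 * (f (x + y * Complex.I)).re : ℝ) : ℂ) =
      μ.integral fun t => (poisson y (x - t) : ℂ) := by
  have hz : (x + y * Complex.I : ℂ) ∈ upperHalf := by simpa [upperHalf] using hy
  rw [two_mul_re_of_kernelIdentity h hz]
  congr 1
  ext t
  have h1 : (x + y * Complex.I : ℂ).im = y := by simp
  have h2 : ‖(x + y * Complex.I : ℂ) - t‖ ^ 2 = (x - t) ^ 2 + y ^ 2 := by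
    rw [← Complex.normSq_eq_norm_sq, Complex.normSq_apply]
    simp; ring
  rw [h1, h2, poisson]

/-- The function f determines the Poisson integral of μ on each line Im z = y. Integrating this
against ψ and letting y → 0 recovers ∫ ψ dμ. -/
theorem KernelIdentity.measure_unique {f : ℂ → ℂ} {μ ν : RealLocFinMeasure}
    (hμ : Integrable (fun t : ℝ => (1 + t ^ 2)⁻¹) μ.variation)
    (hν : Integrable (fun t : ℝ => (1 + t ^ 2)⁻¹) ν.variation)
    (h₁ : KernelIdentity f μ) (h₂ : KernelIdentity f ν) : μ = ν := by
  have key : ∀ ψ : ℝ → ℂ, Continuous ψ → (∃ C, ∀ x, ‖ψ x‖ ≤ C * (1 + x ^ 2)⁻¹) →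
      μ.integral ψ = ν.integral ψ := by
    rintro ψ hψ ⟨C, hC⟩
    have hC0 : 0 ≤ C := by simpa using (norm_nonneg _).trans (hC 0)
    have hC' : ∀ x, ‖ψ x‖ ≤ C := fun x => (hC x).trans <| mul_le_of_le_one_right hC0 <|
      inv_le_one_of_one_le₀ (by nlinarith [sq_nonneg x])
    have lim : ∀ ρ : RealLocFinMeasure, Integrable (fun t : ℝ => (1 + t ^ 2)⁻¹) ρ.variation →
        Tendsto (fun y => ρ.integral (fun t => ∫ x, poisson y (x - t) • ψ x)) (𝓝[>] 0)
        (𝓝 (ρ.integral ψ)) := by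
      intro ρ hρ
      refine RealLocFinMeasure.tendsto_integral_of_dominated
        (b := fun t => C * (2 + 2 * 1) * (1 + t ^ 2)⁻¹) (hρ.const_mul _) ?_ ?_
        (tendsto_integral_poisson_smul hψ hC')
      · filter_upwards [self_mem_nhdsWithin] with y hy
        exact continuous_integral_poisson_smul hψ hC' hy
      · filter_upwards [Ioc_mem_nhdsGT (zero_lt_one' ℝ)] with y hy t
        refine (norm_integral_poisson_smul_le hψ hC hy.1 t).trans ?_
        have := hy.2
        gcongr
    refine tendsto_nhds_unique_of_eventuallyEq (lim μ hμ) (lim ν hν) ?_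
    filter_upwards [self_mem_nhdsWithin] with y hy
    rw [RealLocFinMeasure.integral_poisson_swap hμ hψ hC hy,
      RealLocFinMeasure.integral_poisson_swap hν hψ hC hy]
    simp only [← h₁.two_mul_re_eq hy, ← h₂.two_mul_re_eq hy]
  refine RealLocFinMeasure.eq_of_cross_add_eq hμ hν ?_
  have hμ' := (integrable_variation_iff _ _).1 hμ
  have hν' := (integrable_variation_iff _ _).1 hν
  have l1 := isLocallyFiniteMeasure_of_integrable (hμ'.1.add_measure hν'.2)
  have l2 := isLocallyFiniteMeasure_of_integrable (hν'.1.add_measure hμ'.2)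
  refine Measure.ext_of_integral_eq_on_compactlySupported fun φ => ?_
  have hi : ∀ ρ : Measure ℝ, IsLocallyFiniteMeasure ρ → Integrable φ ρ := fun ρ _ =>
    φ.continuous.integrable_of_hasCompactSupport φ.hasCompactSupport
  rw [integral_add_measure (hi _ inferInstance) (hi _ inferInstance),
    integral_add_measure (hi _ inferInstance) (hi _ inferInstance)]
  have h := key (fun x => (φ x : ℂ)) (by fun_prop) ?_
  · simp only [RealLocFinMeasure.integral, integral_complex_ofReal, ← Complex.ofReal_sub,
      Complex.ofReal_inj] at h
    linarith
  · have hc : Continuous fun x : ℝ => (1 + x ^ 2) * ‖φ x‖ := by fun_prop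
    have hs : HasCompactSupport fun x : ℝ => (1 + x ^ 2) * ‖φ x‖ :=
      φ.hasCompactSupport.norm.mul_left
    obtain ⟨C, hC⟩ := hc.bounded_above_of_compact_support hs
    refine ⟨C, fun x => ?_⟩
    rw [← div_eq_mul_inv, le_div_iff₀ (by positivity), Complex.norm_real, mul_comm]
    exact (le_abs_self _).trans (hC x)

/-! ### Almost periodic functions on the line -/

/-- Bochner almost periodicity: the translates of `g` are totally bounded in the uniform norm,
expressed through a finite colouring of the translations. -/
structure IsAP (g : ℝ → ℂ) : Prop where
  continuous : Continuous g
  exists_coloring : ∀ ε : ℝ, 0 < ε → ∃ (ι : Type) (_ : Finite ι) (c : ℝ → ι),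
    ∀ a b, c a = c b → ∀ x, ‖g (x + a) - g (x + b)‖ ≤ ε

namespace IsAP

variable {g h : ℝ → ℂ}

theorem exists_net (hg : IsAP g) {ε : ℝ} (hε : 0 < ε) :
    ∃ s : Finset ℝ, ∀ a, ∃ r ∈ s, ∀ x, ‖g (x + a) - g (x + r)‖ ≤ ε := by
  classical
  obtain ⟨ι, _, c, hc⟩ := hg.exists_coloring ε hε
  have : Fintype ι := Fintype.ofFinite ι
  -- One representative is chosen per colour; a colour that never occurs receives the dummy value 0.
  have hch : ∀ i : ι, ∃ r : ℝ, (∃ a, c a = i) → c r = i := by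
    intro i
    by_cases h : ∃ a, c a = i
    · obtain ⟨a, ha⟩ := h
      exact ⟨a, fun _ => ha⟩
    · exact ⟨0, fun h' => absurd h' h⟩
  choose r hr using hch
  refine ⟨Finset.univ.image r, fun a => ⟨r (c a), by simp, fun x => hc _ _ ?_ x⟩⟩
  exact (hr (c a) ⟨a, rfl⟩).symm

theorem exists_bound (hg : IsAP g) : ∃ C : ℝ, 0 < C ∧ ∀ x, ‖g x‖ ≤ C := by
  obtain ⟨s, hs⟩ := hg.exists_net one_pos
  refine ⟨1 + ∑ r ∈ s, ‖g r‖, by positivity, fun x => ?_⟩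
  obtain ⟨r, hr, h⟩ := hs x
  have h1 := h 0
  rw [zero_add, zero_add] at h1
  have h2 : ‖g r‖ ≤ ∑ r ∈ s, ‖g r‖ :=
    Finset.single_le_sum (f := fun r => ‖g r‖) (fun _ _ => norm_nonneg _) hr
  have h3 := norm_sub_norm_le (g x) (g r)
  linarith

/-- Up to the error of a finite net every translate is one of finitely many, so continuity at
finitely many points suffices. -/
theorem exists_uniform_continuity (hg : IsAP g) {ε : ℝ} (hε : 0 < ε) :
    ∃ δ : ℝ, 0 < δ ∧ ∀ u, |u| < δ → ∀ x, ‖g (x + u) - g x‖ ≤ ε := by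
  obtain ⟨s, hs⟩ := hg.exists_net (ε := ε / 3) (by positivity)
  have h1 : ∀ᶠ u : ℝ in 𝓝 0, ∀ r ∈ s, ‖g (u + r) - g r‖ < ε / 3 := by
    rw [Filter.eventually_all_finset]
    intro r _
    have hc : Continuous fun u : ℝ => ‖g (u + r) - g r‖ := by
      have := hg.continuous
      fun_prop
    have := hc.tendsto 0
    rw [zero_add, sub_self, norm_zero] at this
    exact this.eventually_lt_const (by positivity)
  obtain ⟨δ, hδ, hδ'⟩ := Metric.eventually_nhds_iff.1 h1
  refine ⟨δ, hδ, fun u hu x => ?_⟩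
  obtain ⟨r, hr, h⟩ := hs x
  have e1 := h u
  have e2 := h 0
  have e3 := (hδ' (y := u) (by simpa using hu) r hr).le
  rw [zero_add, zero_add] at e2
  rw [add_comm u x] at e1
  calc ‖g (x + u) - g x‖
      = ‖(g (x + u) - g (u + r)) + (g (u + r) - g r) - (g x - g r)‖ := by congr 1; ring
    _ ≤ ‖g (x + u) - g (u + r)‖ + ‖g (u + r) - g r‖ + ‖g x - g r‖ :=
        (norm_sub_le _ _).trans (by gcongr; exact norm_add_le _ _)
    _ ≤ ε := by linarith

theorem mul (hg : IsAP g) (hh : IsAP h) : IsAP fun x => g x * h x := by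
  refine ⟨hg.continuous.mul hh.continuous, fun ε hε => ?_⟩
  obtain ⟨C, hC, hgC⟩ := hg.exists_bound
  obtain ⟨D, hD, hhD⟩ := hh.exists_bound
  obtain ⟨ι, _, c, hc⟩ := hg.exists_coloring (ε / (2 * D)) (by positivity)
  obtain ⟨κ, _, d, hd⟩ := hh.exists_coloring (ε / (2 * C)) (by positivity)
  refine ⟨ι × κ, inferInstance, fun a => (c a, d a), fun a b hab x => ?_⟩
  have h1 := hc a b (congrArg Prod.fst hab) x
  have h2 := hd a b (congrArg Prod.snd hab) x
  calc ‖g (x + a) * h (x + a) - g (x + b) * h (x + b)‖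
      = ‖(g (x + a) - g (x + b)) * h (x + a) + g (x + b) * (h (x + a) - h (x + b))‖ := by
        congr 1; ring
    _ ≤ ‖g (x + a) - g (x + b)‖ * ‖h (x + a)‖ + ‖g (x + b)‖ * ‖h (x + a) - h (x + b)‖ := by
        rw [← norm_mul, ← norm_mul]; exact norm_add_le _ _
    _ ≤ (ε / (2 * D)) * D + C * (ε / (2 * C)) := by
        gcongr
        · exact hhD _
        · exact hgC _
    _ = ε := by field_simp; ring

theorem sub (hg : IsAP g) (hh : IsAP h) : IsAP fun x => g x - h x := by
  refine ⟨hg.continuous.sub hh.continuous, fun ε hε => ?_⟩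
  obtain ⟨ι, _, c, hc⟩ := hg.exists_coloring (ε / 2) (by positivity)
  obtain ⟨κ, _, d, hd⟩ := hh.exists_coloring (ε / 2) (by positivity)
  refine ⟨ι × κ, inferInstance, fun a => (c a, d a), fun a b hab x => ?_⟩
  have h1 := hc a b (congrArg Prod.fst hab) x
  have h2 := hd a b (congrArg Prod.snd hab) x
  calc ‖(g (x + a) - h (x + a)) - (g (x + b) - h (x + b))‖
      = ‖(g (x + a) - g (x + b)) - (h (x + a) - h (x + b))‖ := by congr 1; ring
    _ ≤ ‖g (x + a) - g (x + b)‖ + ‖h (x + a) - h (x + b)‖ := norm_sub_le _ _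
    _ ≤ ε := by linarith

theorem const (k : ℂ) : IsAP fun _ => k :=
  ⟨continuous_const, fun ε hε => ⟨Unit, inferInstance, fun _ => (), fun _ _ _ _ => by
    simpa using hε.le⟩⟩

theorem add (hg : IsAP g) (hh : IsAP h) : IsAP fun x => g x + h x := by
  simpa using hg.sub ((const 0).sub hh)

theorem conjugate (hg : IsAP g) : IsAP fun x => conj (g x) := by
  refine ⟨Complex.continuous_conj.comp hg.continuous, fun ε hε => ?_⟩
  obtain ⟨ι, hι, c, hc⟩ := hg.exists_coloring ε hε
  refine ⟨ι, hι, c, fun a b hab x => ?_⟩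
  rw [← map_sub, Complex.norm_conj]
  exact hc a b hab x

theorem comp_add (hg : IsAP g) (u : ℝ) : IsAP fun x => g (u + x) := by
  refine ⟨hg.continuous.comp (by fun_prop), fun ε hε => ?_⟩
  obtain ⟨ι, hι, c, hc⟩ := hg.exists_coloring ε hε
  refine ⟨ι, hι, c, fun a b hab x => ?_⟩
  simpa only [add_assoc] using hc a b hab (u + x)

theorem of_uniform_approx (h : ∀ ε : ℝ, 0 < ε → ∃ k : ℝ → ℂ, IsAP k ∧ ∀ x, ‖g x - k x‖ ≤ ε)
    (hg : Continuous g) : IsAP g := by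
  refine ⟨hg, fun ε hε => ?_⟩
  obtain ⟨k, hk, hgk⟩ := h (ε / 3) (by positivity)
  obtain ⟨ι, hι, c, hc⟩ := hk.exists_coloring (ε / 3) (by positivity)
  refine ⟨ι, hι, c, fun a b hab x => ?_⟩
  have h1 := hc a b hab x
  calc ‖g (x + a) - g (x + b)‖ = ‖(g (x + a) - k (x + a)) + (k (x + a) - k (x + b))
        - (g (x + b) - k (x + b))‖ := by congr 1; ring
    _ ≤ ‖g (x + a) - k (x + a)‖ + ‖k (x + a) - k (x + b)‖ + ‖g (x + b) - k (x + b)‖ :=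
        (norm_sub_le _ _).trans (by gcongr; exact norm_add_le _ _)
    _ ≤ ε := by linarith [hgk (x + a), hgk (x + b)]

/-- Bohr's definition of almost periodicity on the line implies Bochner's. -/
theorem of_bohr (hg : Continuous g) (h : ∀ ε : ℝ, 0 < ε → ∃ τ : Set ℝ, RelativelyDense τ ∧
    ∀ t ∈ τ, ∀ x, ‖g x - g (x + t)‖ ≤ ε) : IsAP g := by
  -- Uniform continuity comes first: an almost period carries x into (0, l) and a nearby point into
  -- (-1, l + 1), inside a fixed compact interval.
  have huc : ∀ ε : ℝ, 0 < ε → ∃ δ : ℝ, 0 < δ ∧ ∀ x u, |x - u| < δ → ‖g x - g u‖ ≤ ε := by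
    intro ε hε
    obtain ⟨τ, ⟨l, hl, hτ⟩, ht⟩ := h (ε / 3) (by positivity)
    have hk := (isCompact_Icc (a := -1) (b := l + 1)).uniformContinuousOn_of_continuous
      hg.continuousOn
    obtain ⟨δ, hδ, hδ'⟩ := Metric.uniformContinuousOn_iff.1 hk (ε / 3) (by positivity)
    refine ⟨min δ 1, by positivity, fun x u hxu => ?_⟩
    obtain ⟨t, ⟨ht1, ht2⟩, htτ⟩ := hτ (-x)
    have hxu1 : |x - u| < 1 := hxu.trans_le (min_le_right _ _)
    rw [abs_lt] at hxu1
    have e1 := ht t htτ x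
    have e2 := ht t htτ u
    have e3 := hδ' (x + t) ⟨by linarith, by linarith⟩ (u + t) ⟨by linarith, by linarith⟩
      (by rw [Real.dist_eq, add_sub_add_right_eq_sub]; exact hxu.trans_le (min_le_left _ _))
    rw [dist_eq_norm] at e3
    calc ‖g x - g u‖ = ‖(g x - g (x + t)) + (g (x + t) - g (u + t)) - (g u - g (u + t))‖ := by
          congr 1; ring
      _ ≤ ‖g x - g (x + t)‖ + ‖g (x + t) - g (u + t)‖ + ‖g u - g (u + t)‖ :=
        (norm_sub_le _ _).trans (by gcongr; exact norm_add_le _ _)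
      _ ≤ ε := by linarith
  refine ⟨hg, fun ε hε => ?_⟩
  obtain ⟨τ, ⟨l, hl, hτ⟩, ht⟩ := h (ε / 3) (by positivity)
  obtain ⟨δ, hδ, hδ'⟩ := huc (ε / 3) (by positivity)
  -- Modulo an almost period every translation may be replaced by one in [0, l); the colour of a is
  -- the cell of length δ that contains the replacement.
  have hu : ∀ a : ℝ, ∃ u : ℝ, u ∈ Ico 0 l ∧ ∀ x, ‖g (x + u) - g (x + a)‖ ≤ ε / 3 := by
    intro a
    obtain ⟨t, ⟨ht1, ht2⟩, htτ⟩ := hτ (a - l)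
    refine ⟨a - t, ⟨by linarith, by linarith⟩, fun x => ?_⟩
    have := ht t htτ (x + (a - t))
    rwa [show x + (a - t) + t = x + a by ring] at this
  choose u hu hu' using hu
  have hfl : ∀ a, ⌊u a / δ⌋₊ < ⌊l / δ⌋₊ + 1 := fun a =>
    Nat.lt_succ_of_le (Nat.floor_le_floor (by have := (hu a).2.le; gcongr))
  refine ⟨Fin (⌊l / δ⌋₊ + 1), inferInstance, fun a => ⟨⌊u a / δ⌋₊, hfl a⟩, fun a b hab x => ?_⟩
  have hab' : ⌊u a / δ⌋₊ = ⌊u b / δ⌋₊ := congrArg Fin.val hab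
  have hclose : |(x + u a) - (x + u b)| < δ := by
    have a1 := Nat.floor_le (div_nonneg (hu a).1 hδ.le)
    have a2 := Nat.lt_floor_add_one (u a / δ)
    have b1 := Nat.floor_le (div_nonneg (hu b).1 hδ.le)
    have b2 := Nat.lt_floor_add_one (u b / δ)
    rw [hab'] at a1 a2
    rw [le_div_iff₀ hδ] at a1 b1
    rw [div_lt_iff₀ hδ] at a2 b2
    rw [abs_lt]
    constructor <;> nlinarith
  have e1 := hu' a x
  have e2 := hu' b x
  have e3 := hδ' _ _ hclose
  calc ‖g (x + a) - g (x + b)‖ = ‖(g (x + u a) - g (x + u b)) - (g (x + u a) - g (x + a))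
        + (g (x + u b) - g (x + b))‖ := by congr 1; ring
    _ ≤ ‖g (x + u a) - g (x + u b)‖ + ‖g (x + u a) - g (x + a)‖ + ‖g (x + u b) - g (x + b)‖ :=
        (norm_add_le _ _).trans (by gcongr; exact norm_sub_le _ _)
    _ ≤ ε := by linarith

end IsAP

/-! ### Characters -/

/-- The character `x ↦ e^{2πilx}`. -/
def expi (l x : ℝ) : ℂ := Complex.exp (2 * Real.pi * Complex.I * l * x)

theorem expi_eq (l x : ℝ) : expi l x = Complex.exp ((2 * Real.pi * (l * x) : ℝ) * Complex.I) := by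
  unfold expi; congr 1; push_cast; ring

@[simp] theorem norm_expi (l x : ℝ) : ‖expi l x‖ = 1 := by
  rw [expi_eq, Complex.norm_exp_ofReal_mul_I]

theorem expi_add (l x y : ℝ) : expi l (x + y) = expi l x * expi l y := by
  unfold expi; rw [← Complex.exp_add]; congr 1; push_cast; ring

theorem expi_mul_expi (l m x : ℝ) : expi l x * expi m x = expi (l + m) x := by
  unfold expi; rw [← Complex.exp_add]; congr 1; push_cast; ring

theorem conj_expi (l x : ℝ) : conj (expi l x) = expi (-l) x := by
  rw [expi_eq, expi_eq, ← Complex.exp_conj]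
  congr 1
  rw [map_mul, Complex.conj_ofReal, Complex.conj_I]
  push_cast
  ring

@[simp] theorem expi_zero_left (x : ℝ) : expi 0 x = 1 := by simp [expi]

@[simp] theorem expi_zero_right (l : ℝ) : expi l 0 = 1 := by simp [expi]

@[fun_prop] theorem continuous_expi (l : ℝ) : Continuous (expi l) := by
  unfold expi; fun_prop

theorem norm_expi_sub_le (l m x y : ℝ) : ‖expi l x - expi m y‖ ≤ 2 * Real.pi * |l * x - m * y| := by
  have h1 : expi l x - expi m y =
      expi m y * (Complex.exp (Complex.I * (2 * Real.pi * (l * x - m * y) : ℝ)) - 1) := by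
    rw [mul_sub, mul_one]
    congr 1
    unfold expi
    rw [← Complex.exp_add]
    congr 1
    push_cast
    ring
  rw [h1, norm_mul, norm_expi, one_mul]
  refine (Real.norm_exp_I_mul_ofReal_sub_one_le).trans_eq ?_
  rw [Real.norm_eq_abs, abs_mul, abs_of_pos (by positivity)]

theorem expi_fract (l x : ℝ) : expi 1 (Int.fract (l * x)) = expi l x := by
  unfold expi
  have : (2 * Real.pi * Complex.I * l * x : ℂ) =
      2 * Real.pi * Complex.I * ((1 : ℝ) : ℂ) * (Int.fract (l * x) : ℝ) +
        (⌊l * x⌋ : ℤ) * (2 * Real.pi * Complex.I) := by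
    have := Int.fract_add_floor (l * x)
    have h2 : ((Int.fract (l * x) : ℝ) : ℂ) + ((⌊l * x⌋ : ℤ) : ℂ) = l * x := by exact_mod_cast this
    push_cast
    linear_combination (-(2 * Real.pi * Complex.I : ℂ)) * h2
  rw [this, Complex.exp_add, Complex.exp_int_mul_two_pi_mul_I, mul_one]

/-- Finitely many characters have common almost periods, in coloured form. -/
theorem exists_coloring_expi (F : Finset ℝ) {ε : ℝ} (hε : 0 < ε) :
    ∃ (ι : Type) (_ : Finite ι) (c : ℝ → ι), ∀ a b, c a = c b → ∀ l ∈ F,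
      ‖expi l a - expi l b‖ ≤ ε := by
  -- Translations are coloured by the cell of length 1/N that contains the fractional part of l·a,
  -- one coordinate per frequency; N > 2π/ε is what the Lipschitz bound 2π requires.
  obtain ⟨N, hN⟩ := exists_nat_gt (2 * Real.pi / ε)
  have hN0 : (0 : ℝ) < N := lt_trans (by have := Real.pi_pos; positivity) hN
  have hlt : ∀ u : ℝ, ⌊N * Int.fract u⌋₊ < N := fun u => by
    rw [Nat.floor_lt (mul_nonneg hN0.le (Int.fract_nonneg _))]
    exact mul_lt_of_lt_one_right hN0 (Int.fract_lt_one _)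
  refine ⟨F → Fin N, inferInstance, fun a l => ⟨⌊N * Int.fract (l * a)⌋₊, hlt _⟩, ?_⟩
  intro a b hab l hl
  have h1 : ⌊N * Int.fract (l * a)⌋₊ = ⌊N * Int.fract (l * b)⌋₊ :=
    congrArg Fin.val (congrFun hab ⟨l, hl⟩)
  rw [← expi_fract l a, ← expi_fract l b]
  refine (norm_expi_sub_le _ _ _ _).trans ?_
  rw [one_mul, one_mul]
  have a1 := Nat.floor_le (mul_nonneg hN0.le (Int.fract_nonneg (l * a)))
  have a2 := Nat.lt_floor_add_one (N * Int.fract (l * a))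
  have b1 := Nat.floor_le (mul_nonneg hN0.le (Int.fract_nonneg (l * b)))
  have b2 := Nat.lt_floor_add_one (N * Int.fract (l * b))
  rw [h1] at a1 a2
  have h2 : |Int.fract (l * a) - Int.fract (l * b)| ≤ 1 / N := by
    rw [abs_le]
    constructor
    · rw [neg_le, div_eq_inv_mul, ← div_eq_inv_mul, le_div_iff₀ hN0]; nlinarith
    · rw [le_div_iff₀ hN0]; nlinarith
  calc 2 * Real.pi * |Int.fract (l * a) - Int.fract (l * b)| ≤ 2 * Real.pi * (1 / N) := by gcongr
    _ ≤ ε := by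
      rw [div_lt_iff₀ hε] at hN
      rw [mul_one_div, div_le_iff₀ hN0]
      linarith

theorem isAP_expi (l : ℝ) : IsAP (expi l) := by
  refine ⟨continuous_expi l, fun ε hε => ?_⟩
  obtain ⟨ι, hι, c, hc⟩ := exists_coloring_expi {l} hε
  refine ⟨ι, hι, c, fun a b hab x => ?_⟩
  rw [expi_add, expi_add, ← mul_sub, norm_mul, norm_expi, one_mul]
  exact hc a b hab l (by simp)

/-- Finitely many characters have a relatively dense set of common almost periods. -/
theorem exists_relativelyDense_expi (F : Finset ℝ) {ε : ℝ} (hε : 0 < ε) :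
    ∃ τ : Set ℝ, RelativelyDense τ ∧ ∀ t ∈ τ, ∀ l ∈ F, ‖expi l t - 1‖ ≤ ε := by
  classical
  obtain ⟨ι, _, c, hc⟩ := exists_coloring_expi F hε
  have : Fintype ι := Fintype.ofFinite ι
  have hch : ∀ i : ι, ∃ r : ℝ, (∃ a, c a = i) → c r = i := by
    intro i
    by_cases h : ∃ a, c a = i
    · obtain ⟨a, ha⟩ := h
      exact ⟨a, fun _ => ha⟩
    · exact ⟨0, fun h' => absurd h' h⟩
  choose r hr using hch
  refine ⟨{t | ∀ l ∈ F, ‖expi l t - 1‖ ≤ ε}, ?_, fun t ht => ht⟩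
  set R := 1 + ∑ i, |r i| with hR
  have hRi : ∀ i, |r i| < R := fun i => by
    have := Finset.single_le_sum (f := fun i => |r i|) (fun _ _ => abs_nonneg _) (Finset.mem_univ i)
    linarith
  refine ⟨2 * R, by positivity, fun x => ?_⟩
  -- The difference of two translations of the same colour is an almost period. Since |r| < R, this
  -- one lies in (x, x + 2R).
  refine ⟨(x + R) - r (c (x + R)), ?_, ?_⟩
  · have := abs_lt.1 (hRi (c (x + R)))
    constructor <;> linarith [this.1, this.2]
  · intro l hl
    have h1 := hc (x + R) (r (c (x + R))) (hr _ ⟨_, rfl⟩).symm l hl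
    have h2 : expi l (x + R) = expi l (x + R - r (c (x + R))) * expi l (r (c (x + R))) := by
      rw [← expi_add, sub_add_cancel]
    rw [h2, ← sub_one_mul, norm_mul, norm_expi, mul_one] at h1
    exact h1

/-! ### Mean values -/

/-- The average of `g` over `[a, a + T]`. -/
def ivlAvg (g : ℝ → ℂ) (T a : ℝ) : ℂ := (T : ℂ)⁻¹ * ∫ x in a..a + T, g x

/-- `g` has mean value `M`, uniformly over the position of the interval. -/
def HasMean (g : ℝ → ℂ) (M : ℂ) : Prop :=
  ∀ ε : ℝ, 0 < ε → ∃ T₀ : ℝ, 0 < T₀ ∧ ∀ T, T₀ ≤ T → ∀ a, ‖ivlAvg g T a - M‖ ≤ ε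

theorem ivlAvg_eq (g : ℝ → ℂ) (T a : ℝ) :
    ivlAvg g T a = (T : ℂ)⁻¹ * ∫ x in (0 : ℝ)..T, g (a + x) := by
  rw [ivlAvg, intervalIntegral.integral_comp_add_left (fun x => g x), add_zero]

theorem ivlAvg_sub {g h : ℝ → ℂ} (hg : Continuous g) (hh : Continuous h) (T a : ℝ) :
    ivlAvg (fun x => g x - h x) T a = ivlAvg g T a - ivlAvg h T a := by
  simp only [ivlAvg]
  rw [intervalIntegral.integral_sub (hg.intervalIntegrable _ _) (hh.intervalIntegrable _ _)]
  ring

theorem ivlAvg_const (k : ℂ) {T : ℝ} (hT : 0 < T) (a : ℝ) : ivlAvg (fun _ => k) T a = k := by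
  have : (T : ℂ) ≠ 0 := by exact_mod_cast hT.ne'
  simp [ivlAvg, this]

theorem norm_ivlAvg_le {g : ℝ → ℂ} {C : ℝ} (h : ∀ x, ‖g x‖ ≤ C) {T : ℝ} (hT : 0 < T) (a : ℝ) :
    ‖ivlAvg g T a‖ ≤ C := by
  have h1 := intervalIntegral.norm_integral_le_of_norm_le_const (a := a) (b := a + T)
    (f := g) (C := C) fun x _ => h x
  rw [ivlAvg, norm_mul, norm_inv, Complex.norm_real, Real.norm_eq_abs, abs_of_pos hT,
    inv_mul_le_iff₀ hT]
  rwa [add_sub_cancel_left, abs_of_pos hT, mul_comm] at h1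

theorem norm_ivlAvg_sub_le {g h : ℝ → ℂ} (hg : Continuous g) (hh : Continuous h) {C : ℝ}
    (hgh : ∀ x, ‖g x - h x‖ ≤ C) {T : ℝ} (hT : 0 < T) (a : ℝ) :
    ‖ivlAvg g T a - ivlAvg h T a‖ ≤ C := by
  rw [← ivlAvg_sub hg hh]
  exact norm_ivlAvg_le hgh hT a

theorem norm_ivlAvg_add_sub_le {g : ℝ → ℂ} (hg : Continuous g) {C : ℝ} (h : ∀ x, ‖g x‖ ≤ C)
    {T : ℝ} (hT : 0 < T) (a u : ℝ) :
    ‖ivlAvg g T (a + u) - ivlAvg g T a‖ ≤ 2 * |u| * C / T := by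
  have i := fun a b : ℝ => hg.intervalIntegrable (μ := volume) a b
  have e : (∫ x in a + u..a + u + T, g x) - ∫ x in a..a + T, g x =
      (∫ x in a + T..a + T + u, g x) - ∫ x in a..a + u, g x := by
    have h1 := intervalIntegral.integral_add_adjacent_intervals (i a (a + u)) (i (a + u) (a + u + T))
    have h2 := intervalIntegral.integral_add_adjacent_intervals (i a (a + T)) (i (a + T) (a + T + u))
    rw [show a + T + u = a + u + T by ring] at h2 ⊢
    linear_combination h1 - h2
  have b : ∀ c : ℝ, ‖∫ x in c..c + u, g x‖ ≤ C * |u| := fun c => by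
    have := intervalIntegral.norm_integral_le_of_norm_le_const (a := c) (b := c + u)
      (f := g) (C := C) fun x _ => h x
    rwa [add_sub_cancel_left] at this
  rw [ivlAvg, ivlAvg, ← mul_sub, e, norm_mul, norm_inv, Complex.norm_real, Real.norm_eq_abs,
    abs_of_pos hT, le_div_iff₀ hT, mul_comm, ← mul_assoc, mul_inv_cancel₀ hT.ne', one_mul]
  refine (norm_sub_le _ _).trans ?_
  linarith [b (a + T), b a]

/-- Averaging in either order gives the same number; this is how averages over intervals of
different lengths are compared. -/
theorem ivlAvg_swap {g : ℝ → ℂ} (hg : Continuous g) (S T a : ℝ) :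
    ivlAvg (fun x => ivlAvg g T x) S a = ivlAvg (fun x => ivlAvg g S x) T a := by
  simp only [ivlAvg_eq]
  rw [intervalIntegral.integral_const_mul, intervalIntegral.integral_const_mul]
  have : ∫ x in (0:ℝ)..S, ∫ y in (0:ℝ)..T, g (a + x + y) =
      ∫ y in (0:ℝ)..T, ∫ x in (0:ℝ)..S, g (a + y + x) := by
    rw [intervalIntegral_intervalIntegral_swap]
    · simp only [add_right_comm]
    · have hc : Continuous (Function.uncurry fun x y => g (a + x + y)) := by
        have : Continuous fun p : ℝ × ℝ => g (a + p.1 + p.2) := by fun_prop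
        exact this
      refine IntegrableOn.mono_set (t := uIcc 0 S ×ˢ uIcc 0 T) ?_
        (prod_mono uIoc_subset_uIcc uIoc_subset_uIcc)
      exact hc.continuousOn.integrableOn_compact (isCompact_uIcc.prod isCompact_uIcc)
  rw [this]
  ring

theorem continuous_ivlAvg {g : ℝ → ℂ} (hg : Continuous g) (T : ℝ) :
    Continuous fun a => ivlAvg g T a := by
  simp only [ivlAvg_eq]
  refine continuous_const.mul ?_
  exact intervalIntegral.continuous_parametric_intervalIntegral_of_continuous'
    (by fun_prop : Continuous (Function.uncurry fun a x => g (a + x))) 0 T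

theorem norm_ivlAvg_ivlAvg_sub_le {g : ℝ → ℂ} (hg : Continuous g) {S T : ℝ} (hT : 0 < T) {ε : ℝ}
    {a : ℝ} (M : ℂ) (h : ∀ x, ‖ivlAvg g S x - M‖ ≤ ε) :
    ‖ivlAvg (fun x => ivlAvg g S x) T a - M‖ ≤ ε := by
  have := norm_ivlAvg_sub_le (continuous_ivlAvg hg S) (continuous_const (y := M)) h hT a
  rwa [ivlAvg_const M hT] at this

/-- A finite net of translates makes averages over long intervals of equal length nearly independent
of their position. The double average then makes them nearly independent of the length as well,
which gives a Cauchy family. -/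
theorem IsAP.exists_hasMean {g : ℝ → ℂ} (hg : IsAP g) : ∃ M, HasMean g M := by
  obtain ⟨C, hC, hgC⟩ := hg.exists_bound
  have hc := hg.continuous
  have step : ∀ ε : ℝ, 0 < ε → ∃ T₀ : ℝ, 0 < T₀ ∧ ∀ T, T₀ ≤ T → ∀ a b,
      ‖ivlAvg g T a - ivlAvg g T b‖ ≤ ε := by
    intro ε hε
    obtain ⟨s, hs⟩ := hg.exists_net (ε := ε / 2) (by positivity)
    set R := 1 + ∑ r ∈ s, |r| with hR
    have hR0 : 0 < R := by positivity
    have hRi : ∀ r ∈ s, |r| ≤ R := fun r hr => by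
      have := Finset.single_le_sum (f := fun r => |r|) (fun _ _ => abs_nonneg _) hr
      linarith
    refine ⟨4 * R * C / ε, by positivity, fun T hT a b => ?_⟩
    -- The translation from b to a is replaced by one of the finitely many r, and a shift by a
    -- bounded r costs only O(1/T).
    have hT0 : 0 < T := lt_of_lt_of_le (by positivity) hT
    obtain ⟨r, hr, h⟩ := hs (a - b)
    have e1 : ‖ivlAvg g T a - ivlAvg g T (b + r)‖ ≤ ε / 2 := by
      have h1 := norm_ivlAvg_sub_le (g := fun x => g (x + (a - b))) (h := fun x => g (x + r))
        (hc.comp (by fun_prop)) (hc.comp (by fun_prop)) h hT0 b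
      simp only [ivlAvg_eq] at h1 ⊢
      convert h1 using 6 <;> congr 1 <;> ring
    have e2 := norm_ivlAvg_add_sub_le hc hgC hT0 b r
    have e3 : 2 * |r| * C / T ≤ ε / 2 := by
      rw [div_le_iff₀ hT0]
      rw [div_le_iff₀ hε] at hT
      have := hRi r hr
      nlinarith
    calc ‖ivlAvg g T a - ivlAvg g T b‖
        = ‖(ivlAvg g T a - ivlAvg g T (b + r)) + (ivlAvg g T (b + r) - ivlAvg g T b)‖ := by
          congr 1; ring
      _ ≤ _ := norm_add_le _ _
      _ ≤ ε := by linarith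
  have hcauchy : ∀ ε : ℝ, 0 < ε → ∃ T₀ : ℝ, 0 < T₀ ∧ ∀ S, T₀ ≤ S → ∀ T, T₀ ≤ T → ∀ a b,
      ‖ivlAvg g S a - ivlAvg g T b‖ ≤ ε := by
    intro ε hε
    obtain ⟨T₀, hT₀, h⟩ := step (ε / 2) (by positivity)
    refine ⟨T₀, hT₀, fun S hS T hT a b => ?_⟩
    -- The double average over lengths S and T is close to the S-average and, after swapping, also
    -- to the T-average.
    have h1 := norm_ivlAvg_ivlAvg_sub_le (a := a) hc (hT₀.trans_le hT) (ivlAvg g S a)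
      (fun x => h S hS x a)
    have h2 := norm_ivlAvg_ivlAvg_sub_le (a := a) hc (hT₀.trans_le hS) (ivlAvg g T b)
      (fun x => h T hT x b)
    rw [ivlAvg_swap hc] at h2
    calc ‖ivlAvg g S a - ivlAvg g T b‖
        = ‖(ivlAvg (fun x => ivlAvg g S x) T a - ivlAvg g T b) -
          (ivlAvg (fun x => ivlAvg g S x) T a - ivlAvg g S a)‖ := by congr 1; ring
      _ ≤ _ := norm_sub_le _ _
      _ ≤ ε := by linarith
  have hcau : CauchySeq fun T : ℝ => ivlAvg g T 0 := by
    rw [Metric.cauchySeq_iff']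
    intro ε hε
    obtain ⟨T₀, hT₀, h⟩ := hcauchy (ε / 2) (by positivity)
    refine ⟨T₀, fun T hT => ?_⟩
    rw [dist_eq_norm]
    linarith [h T hT T₀ le_rfl 0 0]
  obtain ⟨M, hM⟩ := cauchySeq_tendsto_of_complete hcau
  refine ⟨M, fun ε hε => ?_⟩
  obtain ⟨T₀, hT₀, h⟩ := hcauchy ε hε
  refine ⟨T₀, hT₀, fun T hT a => ?_⟩
  have := (tendsto_const_nhds (x := ivlAvg g T a)).sub hM |>.norm
  refine le_of_tendsto this ?_
  filter_upwards [eventually_ge_atTop T₀] with S hS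
  exact h T hT S hS a 0

theorem HasMean.tendsto {g : ℝ → ℂ} {M : ℂ} (h : HasMean g M) (a : ℝ → ℝ) :
    Tendsto (fun T => ivlAvg g T (a T)) atTop (𝓝 M) := by
  rw [Metric.tendsto_nhds]
  intro ε hε
  obtain ⟨T₀, hT₀, h'⟩ := h (ε / 2) (by positivity)
  filter_upwards [eventually_ge_atTop T₀] with T hT
  rw [dist_eq_norm]
  linarith [h' T hT (a T)]

theorem HasMean.unique {g : ℝ → ℂ} {M N : ℂ} (h : HasMean g M) (h' : HasMean g N) : M = N :=
  tendsto_nhds_unique (h.tendsto fun _ => 0) (h'.tendsto fun _ => 0)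

theorem HasMean.norm_sub_le {g h : ℝ → ℂ} {M N : ℂ} (hg : HasMean g M) (hh : HasMean h N)
    (hgc : Continuous g) (hhc : Continuous h) {C : ℝ} (hgh : ∀ x, ‖g x - h x‖ ≤ C) :
    ‖M - N‖ ≤ C := by
  refine le_of_tendsto ((hg.tendsto fun _ => 0).sub (hh.tendsto fun _ => 0)).norm ?_
  filter_upwards [eventually_gt_atTop 0] with T hT
  exact norm_ivlAvg_sub_le hgc hhc hgh hT 0

theorem HasMean.sub {g h : ℝ → ℂ} {M N : ℂ} (hg : HasMean g M) (hh : HasMean h N)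
    (hgc : Continuous g) (hhc : Continuous h) : HasMean (fun x => g x - h x) (M - N) := by
  intro ε hε
  obtain ⟨S, hS, h1⟩ := hg (ε / 2) (by positivity)
  obtain ⟨T, hT, h2⟩ := hh (ε / 2) (by positivity)
  refine ⟨max S T, by positivity, fun U hU a => ?_⟩
  rw [ivlAvg_sub hgc hhc]
  have e1 := h1 U ((le_max_left _ _).trans hU) a
  have e2 := h2 U ((le_max_right _ _).trans hU) a
  calc _ = ‖(ivlAvg g U a - M) - (ivlAvg h U a - N)‖ := by congr 1; ring
    _ ≤ _ := _root_.norm_sub_le _ _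
    _ ≤ ε := by linarith

theorem HasMean.const_mul {g : ℝ → ℂ} {M : ℂ} (hg : HasMean g M) (k : ℂ) :
    HasMean (fun x => k * g x) (k * M) := by
  intro ε hε
  obtain ⟨S, hS, h1⟩ := hg (ε / (‖k‖ + 1)) (by positivity)
  refine ⟨S, hS, fun U hU a => ?_⟩
  have e1 := h1 U hU a
  have : ivlAvg (fun x => k * g x) U a = k * ivlAvg g U a := by
    simp only [ivlAvg, intervalIntegral.integral_const_mul]; ring
  rw [this, ← mul_sub, norm_mul]
  calc ‖k‖ * ‖ivlAvg g U a - M‖ ≤ (‖k‖ + 1) * (ε / (‖k‖ + 1)) := by gcongr; linarith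
    _ = ε := by field_simp

theorem hasMean_const (k : ℂ) : HasMean (fun _ => k) k := fun ε hε =>
  ⟨1, one_pos, fun T hT a => by
    rw [ivlAvg_const k (by linarith), sub_self, norm_zero]; exact hε.le⟩

/-- A shift by half a period changes the sign of the character but not its mean. -/
theorem hasMean_expi {l : ℝ} (hl : l ≠ 0) : HasMean (expi l) 0 := by
  obtain ⟨M, hM⟩ := (isAP_expi l).exists_hasMean
  have h1 : HasMean (fun x => expi l (1 / (2 * l) + x)) M := by
    intro ε hε
    obtain ⟨S, hS, h⟩ := hM ε hε
    refine ⟨S, hS, fun T hT a => ?_⟩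
    have := h T hT (1 / (2 * l) + a)
    simpa only [ivlAvg_eq, add_assoc] using this
  have e : expi l (1 / (2 * l)) = -1 := by
    rw [expi_eq, show 2 * Real.pi * (l * (1 / (2 * l))) = Real.pi by field_simp,
      Complex.exp_pi_mul_I]
  simp only [expi_add, e] at h1
  have h2 := h1.unique (hM.const_mul (-1))
  have h3 : HasMean (expi l) (-M) := by
    have := h1.const_mul (-1)
    simpa using this
  have h4 := h3.unique hM
  have : M = 0 := by linear_combination (-1 / 2 : ℂ) * h4
  rwa [this] at hM

/-! ### The uniqueness theorem for almost periodic functions -/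

theorem norm_ivlAvg_le_on {g : ℝ → ℂ} {C T a : ℝ} (hT : 0 < T)
    (h : ∀ x ∈ Icc a (a + T), ‖g x‖ ≤ C) : ‖ivlAvg g T a‖ ≤ C := by
  have h1 := intervalIntegral.norm_integral_le_of_norm_le_const (a := a) (b := a + T)
    (f := g) (C := C) fun x hx => h x (by
      rw [uIoc_of_le (by linarith)] at hx; exact Ioc_subset_Icc_self hx)
  rw [ivlAvg, norm_mul, norm_inv, Complex.norm_real, Real.norm_eq_abs, abs_of_pos hT,
    inv_mul_le_iff₀ hT]
  rwa [add_sub_cancel_left, abs_of_pos hT, mul_comm] at h1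

/-- Up to a boundary error 2TC/S, an average over a long interval is an average of averages over
intervals of length T. -/
theorem norm_ivlAvg_le_of_forall {k : ℝ → ℂ} (hk : Continuous k) {C : ℝ} (hC : ∀ x, ‖k x‖ ≤ C)
    {S T ε : ℝ} (hS : 0 < S) (hT : 0 < T) (h : ∀ x, ‖ivlAvg k T x‖ ≤ ε) :
    ‖ivlAvg k S 0‖ ≤ ε + 2 * T * C / S := by
  have hC0 : 0 ≤ C := (norm_nonneg _).trans (hC 0)
  have h1 := norm_ivlAvg_le h hS 0
  rw [ivlAvg_swap hk] at h1
  have h2 : ‖ivlAvg (fun x => ivlAvg k S x - ivlAvg k S 0) T 0‖ ≤ 2 * T * C / S := by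
    refine norm_ivlAvg_le_on hT fun x hx => ?_
    have := norm_ivlAvg_add_sub_le hk hC hS 0 x
    rw [zero_add] at this hx
    refine this.trans ?_
    rw [abs_of_nonneg hx.1]
    have := hx.2
    gcongr
  rw [ivlAvg_sub (continuous_ivlAvg hk S) continuous_const, ivlAvg_const _ hT] at h2
  have h3 := norm_sub_le (ivlAvg (fun x => ivlAvg k S x) T 0)
    (ivlAvg (fun x => ivlAvg k S x) T 0 - ivlAvg k S 0)
  rw [sub_sub_cancel] at h3
  linarith

/-- The point is uniformity in the frequency. High frequencies cancel by uniform continuity of g,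
and bounded frequencies are handled by compactness. -/
theorem IsAP.uniformly_small {g : ℝ → ℂ} (hg : IsAP g)
    (h : ∀ l, HasMean (fun x => g x * expi l x) 0) {ε : ℝ} (hε : 0 < ε) :
    ∃ T₀ : ℝ, 0 < T₀ ∧ ∀ T, T₀ ≤ T → ∀ l, ‖ivlAvg (fun x => g x * expi l x) T 0‖ ≤ ε := by
  obtain ⟨C, hC, hgC⟩ := hg.exists_bound
  have hc := hg.continuous
  have hkc : ∀ l, Continuous fun x => g x * expi l x := fun l => hc.mul (continuous_expi l)
  have hkC : ∀ l x, ‖g x * expi l x‖ ≤ C := fun l x => by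
    rw [norm_mul, norm_expi, mul_one]; exact hgC x
  obtain ⟨δ, hδ, hδ'⟩ := hg.exists_uniform_continuity hε
  set Λ := 1 / δ with hΛ
  have hΛ0 : 0 < Λ := by positivity
  -- For |l| > 1/δ the half period 1/(2l) is shorter than δ. Shifting by it flips the sign of the
  -- character and hardly changes g, so the average is nearly its own negative.
  have large : ∀ T, 2 * δ * C / ε ≤ T → ∀ l, Λ < |l| →
      ‖ivlAvg (fun x => g x * expi l x) T 0‖ ≤ ε := by
    intro T hT l hl
    have hT0 : 0 < T := lt_of_lt_of_le (by positivity) hT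
    have hl0 : l ≠ 0 := by
      rintro rfl
      rw [abs_zero] at hl
      linarith
    set u := 1 / (2 * l) with hu
    have hul : |u| < δ := by
      rw [hu, abs_div, abs_one, abs_mul, abs_two, div_lt_iff₀ (by positivity)]
      rw [hΛ, div_lt_iff₀ hδ] at hl
      nlinarith
    have e : expi l u = -1 := by
      rw [expi_eq, hu, show 2 * Real.pi * (l * (1 / (2 * l))) = Real.pi by field_simp,
        Complex.exp_pi_mul_I]
    have h1 := norm_ivlAvg_sub_le (g := fun x => g x * expi l x)
      (h := fun x => -(g (u + x) * expi l (u + x))) (C := ε) (hkc l)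
      ((hkc l).comp (continuous_const.add continuous_id)).neg (fun x => by
        rw [expi_add, e, show g x * expi l x - -(g (u + x) * (-1 * expi l x)) =
          (g x - g (x + u)) * expi l x by rw [add_comm u x]; ring, norm_mul, norm_expi, mul_one,
          norm_sub_rev]
        exact hδ' u hul x) hT0 0
    have h2 := norm_ivlAvg_add_sub_le (hkc l) (hkC l) hT0 0 u
    have h3 : ivlAvg (fun x => -(g (u + x) * expi l (u + x))) T 0 =
        -ivlAvg (fun x => g x * expi l x) T (0 + u) := by
      simp only [ivlAvg_eq, zero_add, intervalIntegral.integral_neg]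
      ring
    rw [h3, sub_neg_eq_add] at h1
    have h4 : 2 * |u| * C / T ≤ ε := by
      rw [div_le_iff₀ hT0]
      rw [div_le_iff₀ hε] at hT
      nlinarith
    set A := ivlAvg (fun x => g x * expi l x) T 0
    set B := ivlAvg (fun x => g x * expi l x) T (0 + u)
    have h5 : ‖(2 : ℂ) * A‖ ≤ ε + ε := by
      rw [show (2 : ℂ) * A = (A + B) - (B - A) by ring]
      exact (norm_sub_le _ _).trans (add_le_add h1 (h2.trans h4))
    rw [norm_mul, Complex.norm_ofNat] at h5
    linarith
  -- A length T that works for l₀ at all positions also works for l near l₀: once the phase at the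
  -- left end point is pulled out, the two characters differ by at most 2π|l - l₀|T on an interval
  -- of length T.
  have local_small : ∀ l₀ : ℝ, ∃ η : ℝ, 0 < η ∧ ∃ S₀ : ℝ, 0 < S₀ ∧ ∀ S, S₀ ≤ S → ∀ l,
      |l - l₀| < η → ‖ivlAvg (fun x => g x * expi l x) S 0‖ ≤ ε := by
    intro l₀
    obtain ⟨T, hT, hT'⟩ := h l₀ (ε / 3) (by positivity)
    have hp := Real.pi_pos
    refine ⟨ε / (3 * (C * (2 * Real.pi * T))), by positivity, 6 * T * C / ε, by positivity,
      fun S hS l hl => ?_⟩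
    have hS0 : 0 < S := lt_of_lt_of_le (by positivity) hS
    have key : ∀ a, ‖ivlAvg (fun x => g x * expi l x) T a‖ ≤ ε / 3 + ε / 3 := by
      intro a
      have e : ∀ m, ‖ivlAvg (fun x => g x * expi m x) T a‖ =
          ‖ivlAvg (fun x => g (a + x) * expi m x) T 0‖ := by
        intro m
        have : ivlAvg (fun x => g x * expi m x) T a =
            expi m a * ivlAvg (fun x => g (a + x) * expi m x) T 0 := by
          simp only [ivlAvg_eq, zero_add, expi_add]
          rw [mul_left_comm, ← intervalIntegral.integral_const_mul (expi m a)]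
          congr 1
          refine intervalIntegral.integral_congr fun x _ => ?_
          ring
        rw [this, norm_mul, norm_expi, one_mul]
      have h0 := hT' T le_rfl a
      rw [sub_zero, e] at h0
      rw [e]
      have hga : Continuous fun x => g (a + x) := by fun_prop
      have h1 : ‖ivlAvg (fun x => g (a + x) * expi l x - g (a + x) * expi l₀ x) T 0‖ ≤ ε / 3 := by
        refine norm_ivlAvg_le_on hT fun x hx => ?_
        rw [zero_add] at hx
        rw [← mul_sub, norm_mul]
        have h2 := norm_expi_sub_le l l₀ x x
        rw [← sub_mul, abs_mul, abs_of_nonneg hx.1] at h2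
        have h3 : |l - l₀| * x ≤ ε / (3 * (C * (2 * Real.pi * T))) * T :=
          mul_le_mul hl.le hx.2 hx.1 (by positivity)
        calc ‖g (a + x)‖ * ‖expi l x - expi l₀ x‖
            ≤ C * (2 * Real.pi * (ε / (3 * (C * (2 * Real.pi * T))) * T)) := by
              gcongr
              · exact hgC _
              · exact h2.trans (by gcongr)
          _ = ε / 3 := by field_simp
      rw [ivlAvg_sub (g := fun x => g (a + x) * expi l x) (h := fun x => g (a + x) * expi l₀ x)
        (hga.mul (continuous_expi l)) (hga.mul (continuous_expi l₀))] at h1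
      have h4 := norm_le_norm_add_norm_sub' (ivlAvg (fun x => g (a + x) * expi l x) T 0)
        (ivlAvg (fun x => g (a + x) * expi l₀ x) T 0)
      linarith
    refine (norm_ivlAvg_le_of_forall (hkc l) (hkC l) hS0 hT key).trans ?_
    have : 2 * T * C / S ≤ ε / 3 := by
      rw [div_le_iff₀ hS0]
      rw [div_le_iff₀ hε] at hS
      nlinarith
    linarith
  have compact_small : ∃ S₀ : ℝ, 0 < S₀ ∧ ∀ S, S₀ ≤ S → ∀ l ∈ Icc (-Λ) Λ,
      ‖ivlAvg (fun x => g x * expi l x) S 0‖ ≤ ε := by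
    refine (isCompact_Icc (a := -Λ) (b := Λ)).induction_on (p := fun s => ∃ S₀ : ℝ, 0 < S₀ ∧
      ∀ S, S₀ ≤ S → ∀ l ∈ s, ‖ivlAvg (fun x => g x * expi l x) S 0‖ ≤ ε) ?_ ?_ ?_ ?_
    · exact ⟨1, one_pos, fun _ _ l hl => absurd hl (notMem_empty l)⟩
    · rintro s t hst ⟨S, hS, h'⟩
      exact ⟨S, hS, fun U hU l hl => h' U hU l (hst hl)⟩
    · rintro s t ⟨S, hS, h1⟩ ⟨T, hT, h2⟩
      refine ⟨max S T, by positivity, fun U hU l hl => ?_⟩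
      rcases hl with hl | hl
      · exact h1 U ((le_max_left _ _).trans hU) l hl
      · exact h2 U ((le_max_right _ _).trans hU) l hl
    · intro l₀ _
      obtain ⟨η, hη, S, hS, h'⟩ := local_small l₀
      refine ⟨Metric.ball l₀ η, mem_nhdsWithin_of_mem_nhds (Metric.ball_mem_nhds _ hη), S, hS,
        fun U hU l hl => h' U hU l ?_⟩
      simpa [Real.dist_eq] using hl
  obtain ⟨S, hS, h'⟩ := compact_small
  refine ⟨max S (2 * δ * C / ε), by positivity, fun T hT l => ?_⟩
  rcases le_or_gt |l| Λ with hl | hl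
  · exact h' T ((le_max_left _ _).trans hT) l (abs_le.1 hl)
  · exact large T ((le_max_right _ _).trans hT) l hl

/-! ### Autocorrelation and Parseval's identity on a circle -/

section Circle

open AddCircle

theorem measurable_circleAutocorr_integrand {L : ℝ} {F : AddCircle L → ℂ} (hF : Measurable F) :
    Measurable fun p : AddCircle L × AddCircle L => F (p.1 + p.2) * conj (F p.2) :=
  (hF.comp (measurable_fst.add measurable_snd)).mul
    (Complex.continuous_conj.measurable.comp (hF.comp measurable_snd))

variable {L : ℝ} [hL : Fact (0 < L)]

theorem hasSum_sq_fourierCoeff_of_memLp {F : AddCircle L → ℂ} (hF : MemLp F 2 haarAddCircle) :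
    HasSum (fun i => ‖fourierCoeff F i‖ ^ 2) (∫ t, ‖F t‖ ^ 2 ∂haarAddCircle) := by
  have h := hasSum_sq_fourierCoeff hF.toLp
  simp only [fourierCoeff_congr_ae hF.coeFn_toLp] at h
  convert h using 1
  refine integral_congr_ae ?_
  filter_upwards [hF.coeFn_toLp] with x hx
  rw [hx]

/-- The autocorrelation of a function on the circle. -/
def circleAutocorr (F : AddCircle L → ℂ) (z : AddCircle L) : ℂ :=
  ∫ t, F (z + t) * conj (F t) ∂haarAddCircle

theorem measurable_circleAutocorr {F : AddCircle L → ℂ} (hF : Measurable F) :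
    Measurable (circleAutocorr F) :=
  (measurable_circleAutocorr_integrand hF).stronglyMeasurable.integral_prod_right'.measurable

theorem norm_circleAutocorr_le {F : AddCircle L → ℂ} {C : ℝ} (hC : ∀ z, ‖F z‖ ≤ C)
    (z : AddCircle L) : ‖circleAutocorr F z‖ ≤ C * C := by
  have hC0 : 0 ≤ C := (norm_nonneg _).trans (hC 0)
  have h := norm_integral_le_of_norm_le_const (μ := haarAddCircle (T := L))
    (f := fun t => F (z + t) * conj (F t)) (C := C * C) (ae_of_all _ fun t => by
      rw [norm_mul, Complex.norm_conj]
      exact mul_le_mul (hC _) (hC _) (norm_nonneg _) hC0)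
  simpa [circleAutocorr] using h

/-- The autocorrelation is the convolution of F with its conjugate reflection, so its coefficients
are |c_n|². -/
theorem fourierCoeff_circleAutocorr {F : AddCircle L → ℂ} (hF : Measurable F) {C : ℝ}
    (hC : ∀ z, ‖F z‖ ≤ C) (n : ℤ) :
    fourierCoeff (circleAutocorr F) n = ((‖fourierCoeff F n‖ ^ 2 : ℝ) : ℂ) := by
  have hC0 : 0 ≤ C := (norm_nonneg _).trans (hC 0)
  have hfn : ∀ (m : ℤ) (z : AddCircle L), ‖fourier m z‖ = 1 := fun m z => Circle.norm_coe _
  have hi : Integrable (Function.uncurry fun z t : AddCircle L =>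
      fourier (-n) z * (F (z + t) * conj (F t))) (haarAddCircle.prod haarAddCircle) := by
    refine Integrable.of_bound (C := C * C) ?_ (ae_of_all _ fun p => ?_)
    · exact (((fourier (-n)).continuous.measurable.comp measurable_fst).mul
        (measurable_circleAutocorr_integrand hF)).aestronglyMeasurable
    · simp only [Function.uncurry, norm_mul, hfn, one_mul, Complex.norm_conj]
      exact mul_le_mul (hC _) (hC _) (norm_nonneg _) hC0
  have h1 : fourierCoeff (circleAutocorr F) n =
      ∫ z, ∫ t, fourier (-n) z * (F (z + t) * conj (F t)) ∂haarAddCircle ∂haarAddCircle := by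
    simp only [fourierCoeff, circleAutocorr, smul_eq_mul, integral_const_mul]
  rw [h1, integral_integral_swap hi]
  have h2 : ∀ t : AddCircle L, ∫ z, fourier (-n) z * (F (z + t) * conj (F t)) ∂haarAddCircle =
      fourierCoeff F n * conj (fourier (-n) t * F t) := by
    intro t
    have h3 := integral_add_right_eq_self (μ := haarAddCircle (T := L))
      (fun z => fourier (-n) z • F z) t
    rw [fourierCoeff, ← h3, ← integral_mul_const]
    congr 1
    ext z
    have h4 : fourier (-n) (z + t) = fourier (-n) z * fourier (-n) t := by
      rw [fourier_apply, fourier_apply, fourier_apply, smul_add, toCircle_add, Circle.coe_mul]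
    have h5 : fourier (-n) t * conj (fourier (-n) t) = 1 := by
      rw [Complex.mul_conj, Complex.normSq_eq_norm_sq, hfn]; simp
    rw [h4, smul_eq_mul, map_mul]
    linear_combination (-(fourier (-n) z * F (z + t) * conj (F t))) * h5
  simp only [h2]
  rw [integral_const_mul, integral_conj]
  change fourierCoeff F n * conj (fourierCoeff F n) = _
  rw [Complex.mul_conj, Complex.normSq_eq_norm_sq]

/-- Parseval is used twice: ∑ |c_n|⁴ ≤ ε² ∑ |c_n|² ≤ ε²C². The autocorrelation is thus small in mean
square although F itself need not be. -/
theorem integral_norm_sq_circleAutocorr_le {F : AddCircle L → ℂ} (hF : Measurable F) {C ε : ℝ}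
    (hC : ∀ z, ‖F z‖ ≤ C) (hε : ∀ n, ‖fourierCoeff F n‖ ≤ ε) :
    ∫ z, ‖circleAutocorr F z‖ ^ 2 ∂haarAddCircle ≤ ε ^ 2 * C ^ 2 := by
  have m1 : MemLp F 2 (haarAddCircle (T := L)) :=
    MemLp.of_bound hF.aestronglyMeasurable C (ae_of_all _ hC)
  have m2 : MemLp (circleAutocorr F) 2 (haarAddCircle (T := L)) :=
    MemLp.of_bound (measurable_circleAutocorr hF).aestronglyMeasurable (C * C)
      (ae_of_all _ (norm_circleAutocorr_le hC))
  have s1 := hasSum_sq_fourierCoeff_of_memLp m1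
  have s2 := hasSum_sq_fourierCoeff_of_memLp m2
  simp only [fourierCoeff_circleAutocorr hF hC, Complex.norm_real, norm_pow, norm_norm] at s2
  have h1 : ∫ z, ‖circleAutocorr F z‖ ^ 2 ∂haarAddCircle ≤
      ε ^ 2 * ∫ z, ‖F z‖ ^ 2 ∂haarAddCircle := by
    refine hasSum_le (fun n => ?_) s2 (s1.mul_left (ε ^ 2))
    rw [sq (‖fourierCoeff F n‖ ^ 2)]
    have := hε n
    gcongr
  refine h1.trans ?_
  gcongr
  have h2 : ∫ z, ‖F z‖ ^ 2 ∂(haarAddCircle (T := L)) ≤ ∫ _, C ^ 2 ∂(haarAddCircle (T := L)) := by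
    refine integral_mono_of_nonneg (ae_of_all _ fun z => by positivity) (integrable_const _)
      (ae_of_all _ fun z => ?_)
    have := hC z
    simp only
    gcongr
  simpa using h2

end Circle

/-- If g(x₀) ≠ 0, then for every a one of finitely many shifted values g(x₀ - r + a) has modulus at
least |g(x₀)|/2, so the mean square is bounded below. -/
theorem IsAP.eq_zero_of_mean_sq {g : ℝ → ℂ} (hg : IsAP g)
    (h : ∀ ε : ℝ, 0 < ε → ∀ T₀ : ℝ, ∃ T, T₀ ≤ T ∧ ∫ x in (0 : ℝ)..T, ‖g x‖ ^ 2 ≤ ε * T)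
    (x₀ : ℝ) : g x₀ = 0 := by
  by_contra hne
  obtain ⟨C, hC, hgC⟩ := hg.exists_bound
  have hc := hg.continuous
  set η := ‖g x₀‖ / 2 with hη
  have hη0 : 0 < η := by have := norm_pos_iff.2 hne; positivity
  obtain ⟨s, hs⟩ := hg.exists_net hη0
  have hlow : ∀ a, η ^ 2 ≤ ∑ r ∈ s, ‖g ((x₀ - r) + a)‖ ^ 2 := by
    intro a
    obtain ⟨r, hr, h'⟩ := hs a
    have h1 := h' (x₀ - r)
    rw [sub_add_cancel, norm_sub_rev] at h1
    have h2 := norm_sub_norm_le (g x₀) (g (x₀ - r + a))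
    have h3 : η ≤ ‖g (x₀ - r + a)‖ := by linarith
    calc η ^ 2 ≤ ‖g (x₀ - r + a)‖ ^ 2 := by gcongr
      _ ≤ _ := Finset.single_le_sum (f := fun r => ‖g (x₀ - r + a)‖ ^ 2)
        (fun _ _ => by positivity) hr
  have hshift : ∀ u T : ℝ, ∫ x in (0 : ℝ)..T, ‖g (u + x)‖ ^ 2 ≤
      (∫ x in (0 : ℝ)..T, ‖g x‖ ^ 2) + 2 * |u| * C ^ 2 := by
    intro u T
    have hk : Continuous fun x => ‖g x‖ ^ 2 := by fun_prop
    have i := fun a b : ℝ => hk.intervalIntegrable (μ := volume) a b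
    rw [intervalIntegral.integral_comp_add_left (fun x => ‖g x‖ ^ 2), add_zero]
    have h1 := intervalIntegral.integral_add_adjacent_intervals (i 0 u) (i u (u + T))
    have h2 := intervalIntegral.integral_add_adjacent_intervals (i 0 T) (i T (u + T))
    have b : ∀ c d : ℝ, |d - c| = |u| → |∫ x in c..d, ‖g x‖ ^ 2| ≤ C ^ 2 * |u| := fun c d hcd => by
      have := intervalIntegral.norm_integral_le_of_norm_le_const (a := c) (b := d)
        (f := fun x => ‖g x‖ ^ 2) (C := C ^ 2) fun x _ => by
          rw [norm_pow, norm_norm]; have := hgC x; gcongr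
      rwa [hcd] at this
    have b1 := b 0 u (by simp)
    have b2 := b T (u + T) (by simp)
    rw [abs_le] at b1 b2
    linarith [b1.1, b2.2]
  set N : ℝ := (s.card : ℝ) with hN
  set K := ∑ r ∈ s, 2 * |x₀ - r| * C ^ 2 with hK
  have hK0 : 0 ≤ K := Finset.sum_nonneg fun r _ => by positivity
  obtain ⟨T, hT, hT'⟩ := h (η ^ 2 / (2 * (N + 1))) (by positivity) (2 * (K + 1) / η ^ 2)
  have hT0 : 0 < T := lt_of_lt_of_le (by positivity) hT
  have e1 : η ^ 2 * T ≤ N * (∫ x in (0 : ℝ)..T, ‖g x‖ ^ 2) + K := by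
    have h1 : ∫ a in (0 : ℝ)..T, η ^ 2 ≤ ∫ a in (0 : ℝ)..T, ∑ r ∈ s, ‖g ((x₀ - r) + a)‖ ^ 2 := by
      refine intervalIntegral.integral_mono_on hT0.le (by simp) ?_ fun a _ => hlow a
      apply Continuous.intervalIntegrable
      fun_prop
    rw [intervalIntegral.integral_const, smul_eq_mul, sub_zero, mul_comm,
      intervalIntegral.integral_finsetSum] at h1
    · refine h1.trans ?_
      rw [hK, hN, ← nsmul_eq_mul, ← Finset.sum_const, ← Finset.sum_add_distrib]
      exact Finset.sum_le_sum fun r _ => hshift _ _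
    · intro r _
      apply Continuous.intervalIntegrable
      fun_prop
  have e2 : N * (∫ x in (0 : ℝ)..T, ‖g x‖ ^ 2) ≤ η ^ 2 / 2 * T := by
    have hN0 : 0 ≤ N := by positivity
    calc N * (∫ x in (0 : ℝ)..T, ‖g x‖ ^ 2) ≤ (N + 1) * (η ^ 2 / (2 * (N + 1)) * T) := by
          refine mul_le_mul (by linarith) hT' ?_ (by positivity)
          exact intervalIntegral.integral_nonneg hT0.le fun x _ => by positivity
      _ = η ^ 2 / 2 * T := by field_simp
  rw [div_le_iff₀ (by positivity)] at hT
  nlinarith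

/-- The function h(x) is the mean of t ↦ g(x+t) conj g(t). It inherits almost periodicity from g,
and convergence is uniform in x because a finite net reduces it to finitely many x. -/
theorem IsAP.exists_autocorr {g : ℝ → ℂ} (hg : IsAP g) : ∃ h : ℝ → ℂ, IsAP h ∧
    ∀ ε : ℝ, 0 < ε → ∃ T₀ : ℝ, 0 < T₀ ∧ ∀ T, T₀ ≤ T → ∀ x,
      ‖ivlAvg (fun t => g (x + t) * conj (g t)) T 0 - h x‖ ≤ ε := by
  obtain ⟨C, hC, hgC⟩ := hg.exists_bound
  have hc := hg.continuous
  have hk : ∀ x, IsAP fun t => g (x + t) * conj (g t) := fun x =>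
    (hg.comp_add x).mul hg.conjugate
  choose h hh using fun x => (hk x).exists_hasMean
  have hdiff : ∀ x y t, ‖g (x + t) * conj (g t) - g (y + t) * conj (g t)‖ ≤
      ‖g (x + t) - g (y + t)‖ * C := by
    intro x y t
    rw [← sub_mul, norm_mul, Complex.norm_conj]
    gcongr
    exact hgC t
  have hle : ∀ x y D, (∀ t, ‖g (x + t) - g (y + t)‖ ≤ D) → ‖h x - h y‖ ≤ D * C := by
    intro x y D hD
    refine (hh x).norm_sub_le (hh y) (hk x).continuous (hk y).continuous fun t => ?_
    refine (hdiff x y t).trans ?_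
    gcongr
    exact hD t
  have hAP : IsAP h := by
    refine ⟨?_, fun ε hε => ?_⟩
    · rw [Metric.continuous_iff]
      intro b ε hε
      obtain ⟨δ, hδ, hδ'⟩ := hg.exists_uniform_continuity (ε := ε / (2 * C)) (by positivity)
      refine ⟨δ, hδ, fun a hab => ?_⟩
      rw [dist_eq_norm]
      rw [Real.dist_eq] at hab
      refine (hle a b (ε / (2 * C)) fun t => ?_).trans_lt ?_
      · have := hδ' (a - b) hab (b + t)
        rwa [show b + t + (a - b) = a + t by ring] at this
      · field_simp
        linarith
    · obtain ⟨ι, hι, c, hcol⟩ := hg.exists_coloring (ε / C) (by positivity)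
      refine ⟨ι, hι, c, fun a b hab x => ?_⟩
      refine (hle (x + a) (x + b) (ε / C) fun t => ?_).trans_eq (by field_simp)
      have := hcol a b hab (x + t)
      rwa [add_right_comm, add_right_comm x t b] at this
  refine ⟨h, hAP, fun ε hε => ?_⟩
  obtain ⟨s, hs⟩ := hg.exists_net (ε := ε / (3 * C)) (by positivity)
  choose T₀ hT₀ hT₀' using fun x => hh x (ε / 3) (by positivity)
  refine ⟨1 + ∑ r ∈ s, T₀ r, ?_, fun T hT x => ?_⟩
  · have : 0 ≤ ∑ r ∈ s, T₀ r := Finset.sum_nonneg fun r _ => (hT₀ r).le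
    linarith
  have h0 : 0 ≤ ∑ r ∈ s, T₀ r := Finset.sum_nonneg fun r _ => (hT₀ r).le
  have hTp : 0 < T := by linarith
  obtain ⟨r, hr, hrx⟩ := hs x
  have hTr : T₀ r ≤ T := by
    have := Finset.single_le_sum (f := T₀) (fun r _ => (hT₀ r).le) hr
    linarith
  have hxr : ∀ t, ‖g (x + t) - g (r + t)‖ ≤ ε / (3 * C) := fun t => by
    have := hrx t
    rwa [add_comm t, add_comm t] at this
  have e1 := hT₀' r T hTr 0
  have e2 := hle x r _ hxr
  have e3 := norm_ivlAvg_sub_le (hk x).continuous (hk r).continuous (C := ε / (3 * C) * C)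
    (fun t => (hdiff x r t).trans (by gcongr; exact hxr t)) hTp 0
  have e4 : ε / (3 * C) * C = ε / 3 := by field_simp
  rw [e4] at e2 e3
  set A := ivlAvg (fun t => g (x + t) * conj (g t)) T 0
  set B := ivlAvg (fun t => g (r + t) * conj (g t)) T 0
  calc ‖A - h x‖ = ‖((A - B) + (B - h r)) - (h x - h r)‖ := by congr 1; ring
    _ ≤ ‖A - B‖ + ‖B - h r‖ + ‖h x - h r‖ :=
      (norm_sub_le _ _).trans (by gcongr; exact norm_add_le _ _)
    _ ≤ ε := by linarith

open AddCircle in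
-- Truncate g to (0, T] and place it on a circle. Its Fourier coefficients are small by `h₁`, so its
-- circle autocorrelation is small in mean square, and on [0, T/2] the latter controls h.
theorem IsAP.integral_sq_le_of_small {g h : ℝ → ℂ} (hg : IsAP g) (hh : IsAP h) {C : ℝ}
    (hgC : ∀ x, ‖g x‖ ≤ C) {ε T : ℝ} (hε : 0 < ε) (hT : 0 < T)
    (h₁ : ∀ l, ‖ivlAvg (fun x => g x * expi l x) T 0‖ ≤ ε)
    (h₂ : ∀ S, T / 2 ≤ S → ∀ x, ‖ivlAvg (fun t => g (x + t) * conj (g t)) S 0 - h x‖ ≤ ε) :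
    ∫ x in (0 : ℝ)..(T / 2), ‖h x‖ ^ 2 ≤ (2 * ε ^ 2 + 128 * (ε ^ 2 * C ^ 2)) * (T / 2) := by
  have hC : 0 ≤ C := (norm_nonneg _).trans (hgC 0)
  -- The circle has length 2T: the zero padding keeps the autocorrelation free of wrap-around for
  -- shifts up to T/2.
  have hL : Fact (0 < 2 * T) := ⟨by positivity⟩
  have hTc : (T : ℂ) ≠ 0 := by exact_mod_cast hT.ne'
  set G : ℝ → ℂ := (Ioc 0 T).indicator g with hG
  have hGm : Measurable G := hg.continuous.measurable.indicator measurableSet_Ioc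
  have hGC : ∀ x, ‖G x‖ ≤ C := fun x => (norm_indicator_le_norm_self _ _).trans (hgC x)
  set F : AddCircle (2 * T) → ℂ := fun z => G (measurableEquivIoc (2 * T) 0 z) with hF
  have hFm : Measurable F :=
    hGm.comp (measurable_subtype_coe.comp (measurableEquivIoc (2 * T) 0).measurable)
  have hFC : ∀ z, ‖F z‖ ≤ C := fun z => hGC _
  have hFlift : F = AddCircle.liftIoc (2 * T) 0 G := rfl
  have hFx : ∀ x ∈ Ioc (0 : ℝ) (2 * T), F x = G x := fun x hx => by
    rw [hFlift]
    exact AddCircle.liftIoc_coe_apply (by rwa [zero_add])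
  have hcoeff : ∀ n, ‖fourierCoeff F n‖ ≤ ε := by
    intro n
    rw [fourierCoeff_eq_intervalIntegral F n 0, zero_add]
    have e1 : ∫ x in (0 : ℝ)..(2 * T), fourier (-n) (x : AddCircle (2 * T)) • F x =
        ∫ x in (0 : ℝ)..T, g x * expi (-n / (2 * T)) x := by
      rw [intervalIntegral.integral_of_le (by positivity), intervalIntegral.integral_of_le hT.le]
      have : ∀ x ∈ Ioc (0 : ℝ) (2 * T), fourier (-n) (x : AddCircle (2 * T)) • F x =
          (Ioc 0 T).indicator (fun x => g x * expi (-n / (2 * T)) x) x := by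
        intro x hx
        rw [hFx x hx, fourier_coe_apply, hG]
        by_cases hxT : x ∈ Ioc 0 T
        · rw [indicator_of_mem hxT, indicator_of_mem hxT, smul_eq_mul, mul_comm]
          congr 1
          unfold expi
          congr 1
          push_cast
          field_simp
        · rw [indicator_of_notMem hxT, indicator_of_notMem hxT, smul_zero]
      rw [setIntegral_congr_fun measurableSet_Ioc this, setIntegral_indicator measurableSet_Ioc,
        inter_eq_self_of_subset_right (Ioc_subset_Ioc_right (by linarith))]
    rw [e1]
    have e2 := h₁ (-n / (2 * T))
    rw [ivlAvg, norm_mul, norm_inv, Complex.norm_real, Real.norm_eq_abs, abs_of_pos hT,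
      inv_mul_le_iff₀ hT, zero_add] at e2
    rw [norm_smul, Real.norm_eq_abs, abs_of_pos (by positivity), div_mul_eq_mul_div, one_mul,
      div_le_iff₀ (by positivity)]
    nlinarith
  have hbound := integral_norm_sq_circleAutocorr_le hFm hFC hcoeff
  have hr : ∀ x ∈ Icc (0 : ℝ) (T / 2), circleAutocorr F x =
      ((2 * T : ℝ) : ℂ)⁻¹ * ((T - x : ℝ) * ivlAvg (fun t => g (x + t) * conj (g t)) (T - x) 0) := by
    intro x hx
    have hx2 : 0 < T - x := by linarith [hx.2]
    have hxc : ((T - x : ℝ) : ℂ) ≠ 0 := by exact_mod_cast hx2.ne'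
    rw [circleAutocorr, integral_haarAddCircle, ← AddCircle.intervalIntegral_preimage (2 * T) 0,
      ivlAvg, mul_inv_cancel_left₀ hxc, zero_add, zero_add,
      intervalIntegral.integral_of_le (by positivity), intervalIntegral.integral_of_le hx2.le,
      Complex.real_smul, Complex.ofReal_inv]
    congr 1
    have : ∀ t ∈ Ioc (0 : ℝ) (2 * T), F ((x : AddCircle (2 * T)) + (t : AddCircle (2 * T))) *
        conj (F t) = (Ioc 0 (T - x)).indicator (fun t => g (x + t) * conj (g t)) t := by
      intro t ht
      rw [hFx t ht, hG]
      by_cases htT : t ≤ T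
      · have hxt : x + t ∈ Ioc (0 : ℝ) (2 * T) := ⟨by linarith [hx.1, ht.1], by linarith [hx.2]⟩
        rw [← QuotientAddGroup.mk_add, hFx _ hxt, hG, indicator_of_mem (show t ∈ Ioc 0 T from
          ⟨ht.1, htT⟩)]
        by_cases htx : t ≤ T - x
        · rw [indicator_of_mem (show t ∈ Ioc 0 (T - x) from ⟨ht.1, htx⟩),
            indicator_of_mem (show x + t ∈ Ioc 0 T from ⟨hxt.1, by linarith⟩)]
        · rw [indicator_of_notMem (fun h => htx h.2 : t ∉ Ioc 0 (T - x)), indicator_of_notMem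
            (fun h => htx (by linarith [h.2]) : x + t ∉ Ioc 0 T), zero_mul]
      · rw [indicator_of_notMem (fun h => htT h.2 : t ∉ Ioc 0 T), indicator_of_notMem
          (fun h => htT (by linarith [h.2, hx.1]) : t ∉ Ioc 0 (T - x)), map_zero, mul_zero]
    rw [setIntegral_congr_fun measurableSet_Ioc this, setIntegral_indicator measurableSet_Ioc,
      inter_eq_self_of_subset_right (Ioc_subset_Ioc_right (by linarith [hx.1]))]
  have hpt : ∀ x ∈ Icc (0 : ℝ) (T / 2), ‖h x‖ ^ 2 ≤
      2 * ε ^ 2 + 32 * ‖circleAutocorr F x‖ ^ 2 := by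
    intro x hx
    have hx2 : T / 2 ≤ T - x := by linarith [hx.2]
    have e1 := h₂ (T - x) hx2 x
    -- The factor 4 bounds 2T/(T - x) for x ≤ T/2.
    have e2 : ‖ivlAvg (fun t => g (x + t) * conj (g t)) (T - x) 0‖ ≤
        4 * ‖circleAutocorr F x‖ := by
      rw [hr x hx, norm_mul, norm_mul, norm_inv, Complex.norm_real, Complex.norm_real,
        Real.norm_eq_abs, Real.norm_eq_abs, abs_of_pos (by positivity : (0:ℝ) < 2 * T),
        abs_of_pos (by linarith : 0 < T - x)]
      set A := ‖ivlAvg (fun t => g (x + t) * conj (g t)) (T - x) 0‖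
      have hA : 0 ≤ A := norm_nonneg _
      rw [← mul_assoc 4, ← div_eq_mul_inv, div_mul_eq_mul_div, le_div_iff₀ (by positivity)]
      nlinarith
    have e3 : ‖h x‖ ≤ ε + 4 * ‖circleAutocorr F x‖ := by
      have := norm_le_norm_add_norm_sub' (h x) (ivlAvg (fun t => g (x + t) * conj (g t)) (T - x) 0)
      rw [norm_sub_rev] at this
      linarith
    calc ‖h x‖ ^ 2 ≤ (ε + 4 * ‖circleAutocorr F x‖) ^ 2 := by gcongr
      _ ≤ _ := by nlinarith [sq_nonneg (ε - 4 * ‖circleAutocorr F x‖)]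
  have hrm : Measurable fun x : ℝ => ‖circleAutocorr F x‖ ^ 2 :=
    ((measurable_circleAutocorr hFm).comp AddCircle.measurable_mk').norm.pow_const 2
  have hri : ∀ a b : ℝ, IntervalIntegrable (fun x : ℝ => ‖circleAutocorr F x‖ ^ 2) volume a b := by
    intro a b
    refine (intervalIntegrable_const (c := (C * C) ^ 2)).mono_fun hrm.aestronglyMeasurable
      (ae_of_all _ fun x => ?_)
    simp only [norm_pow, norm_mul, Real.norm_eq_abs, abs_of_nonneg hC, abs_norm]
    have := norm_circleAutocorr_le hFC (x : AddCircle (2 * T))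
    gcongr
  have hc := hh.continuous
  calc ∫ x in (0 : ℝ)..(T / 2), ‖h x‖ ^ 2
      ≤ ∫ x in (0 : ℝ)..(T / 2), (2 * ε ^ 2 + 32 * ‖circleAutocorr F x‖ ^ 2) := by
        refine intervalIntegral.integral_mono_on (by positivity)
          (by apply Continuous.intervalIntegrable; fun_prop)
          (intervalIntegrable_const.add ((hri _ _).const_mul _)) hpt
    _ = 2 * ε ^ 2 * (T / 2) + 32 * ∫ x in (0 : ℝ)..(T / 2), ‖circleAutocorr F x‖ ^ 2 := by
        rw [intervalIntegral.integral_add intervalIntegrable_const ((hri _ _).const_mul _),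
          intervalIntegral.integral_const, intervalIntegral.integral_const_mul, smul_eq_mul]
        ring
    _ ≤ 2 * ε ^ 2 * (T / 2) + 32 * ∫ x in (0 : ℝ)..(2 * T), ‖circleAutocorr F x‖ ^ 2 := by
        gcongr
        refine intervalIntegral.integral_mono_interval le_rfl (by positivity) (by linarith)
          (ae_of_all _ fun x => by positivity) (hri _ _)
    _ = 2 * ε ^ 2 * (T / 2) + 32 * ((2 * T) * ∫ z, ‖circleAutocorr F z‖ ^ 2 ∂haarAddCircle) := by
        have := AddCircle.intervalIntegral_preimage (2 * T) 0
          (fun z => ‖circleAutocorr F z‖ ^ 2)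
        rw [zero_add] at this
        rw [this, integral_haarAddCircle, smul_eq_mul, mul_inv_cancel_left₀ (by positivity)]
    _ ≤ 2 * ε ^ 2 * (T / 2) + 32 * ((2 * T) * (ε ^ 2 * C ^ 2)) := by gcongr
    _ = _ := by ring

/-- An almost periodic function all of whose Bohr coefficients vanish is zero. -/
theorem IsAP.eq_zero_of_hasMean_zero {g : ℝ → ℂ} (hg : IsAP g)
    (h : ∀ l, HasMean (fun x => g x * expi l x) 0) (x : ℝ) : g x = 0 := by
  obtain ⟨C, hC, hgC⟩ := hg.exists_bound
  obtain ⟨k, hk, hk'⟩ := hg.exists_autocorr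
  -- The value of the autocorrelation at 0 is the mean of |g|², so its vanishing is all that is
  -- needed.
  have hk0 : k 0 = 0 := by
    refine hk.eq_zero_of_mean_sq (fun ε hε T₀ => ?_) 0
    obtain ⟨δ, hδ, hδε⟩ : ∃ δ : ℝ, 0 < δ ∧ 2 * δ ^ 2 + 128 * (δ ^ 2 * C ^ 2) ≤ ε := by
      refine ⟨√(ε / (2 + 128 * C ^ 2)), by positivity, ?_⟩
      rw [Real.sq_sqrt (by positivity)]
      field_simp
      exact le_rfl
    obtain ⟨T₁, hT₁, h1⟩ := hg.uniformly_small h hδ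
    obtain ⟨T₂, hT₂, h2⟩ := hk' δ hδ
    set T := max (2 * T₀) (max T₁ (2 * T₂)) with hTdef
    have hTT₁ : T₁ ≤ T := (le_max_left _ _).trans (le_max_right _ _)
    have hTT₂ : 2 * T₂ ≤ T := (le_max_right _ _).trans (le_max_right _ _)
    have hT : 0 < T := hT₁.trans_le hTT₁
    refine ⟨T / 2, by linarith [le_max_left (2 * T₀) (max T₁ (2 * T₂))], ?_⟩
    refine (hg.integral_sq_le_of_small hk hgC hδ hT (h1 T hTT₁)
      (fun S hS x => h2 S (by linarith) x)).trans ?_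
    gcongr
  refine hg.eq_zero_of_mean_sq (fun ε hε T₀ => ?_) x
  obtain ⟨T₁, hT₁, h1⟩ := hk' ε hε
  have hT : 0 < max T₀ T₁ := by positivity
  refine ⟨max T₀ T₁, le_max_left _ _, ?_⟩
  have h2 := h1 (max T₀ T₁) (le_max_right _ _) 0
  have e : (∫ t in (0 : ℝ)..max T₀ T₁, g (0 + t) * conj (g t)) =
      ((∫ t in (0 : ℝ)..max T₀ T₁, ‖g t‖ ^ 2 : ℝ) : ℂ) := by
    rw [← intervalIntegral.integral_ofReal]
    congr 1
    ext t
    rw [zero_add, Complex.mul_conj, Complex.normSq_eq_norm_sq]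
  rw [hk0, sub_zero, ivlAvg, zero_add, e, norm_mul, norm_inv, Complex.norm_real, Complex.norm_real,
    Real.norm_eq_abs, Real.norm_eq_abs, abs_of_pos hT, inv_mul_le_iff₀ hT] at h2
  linarith [le_abs_self (∫ t in (0 : ℝ)..max T₀ T₁, ‖g t‖ ^ 2)]

/-! ### Weak limits of positive functionals -/

/-- Positivity gives |Λ g| ≤ ‖g‖ Λ 1. Along an ultrafilter all these bounded values converge at
once, and Riesz–Markov represents the limit functional. -/
theorem exists_measure_tendsto_of_positive {X ι : Type*} [TopologicalSpace X] [CompactSpace X]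
    [T2Space X] [MeasurableSpace X] [BorelSpace X] (U : Ultrafilter ι)
    (Λ : ι → C(X, ℝ) →ₗ[ℝ] ℝ) (hpos : ∀ i g, 0 ≤ g → 0 ≤ Λ i g) {C : ℝ} (hC : ∀ i, Λ i 1 ≤ C) :
    ∃ ν : Measure X, IsFiniteMeasure ν ∧
      ∀ g : C(X, ℝ), Tendsto (fun i => Λ i g) U (𝓝 (∫ x, g x ∂ν)) := by
  have hbd : ∀ i g, |Λ i g| ≤ ‖g‖ * C := by
    intro i g
    have h1 : 0 ≤ Λ i (‖g‖ • 1 - g) := hpos i _ fun x => by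
      simpa using (le_abs_self _).trans (g.norm_coe_le_norm x)
    have h2 : 0 ≤ Λ i (‖g‖ • 1 + g) := hpos i _ fun x => by
      have := (neg_abs_le (g x)).trans' (neg_le_neg (g.norm_coe_le_norm x))
      change (0 : ℝ) ≤ ‖g‖ * 1 + g x
      linarith
    rw [map_sub, map_smul, smul_eq_mul] at h1
    rw [map_add, map_smul, smul_eq_mul] at h2
    have h3 : ‖g‖ * Λ i 1 ≤ ‖g‖ * C := mul_le_mul_of_nonneg_left (hC i) (norm_nonneg _)
    rw [abs_le]
    constructor <;> linarith
  have hlim : ∀ g : C(X, ℝ), ∃ l, Tendsto (fun i => Λ i g) U (𝓝 l) := by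
    intro g
    obtain ⟨l, -, hl⟩ := (isCompact_Icc (a := -(‖g‖ * C)) (b := ‖g‖ * C)).ultrafilter_le_nhds
      (U.map fun i => Λ i g) (by
        rw [Filter.le_principal_iff]
        exact Filter.mem_map.2 (Filter.univ_mem' fun i => abs_le.1 (hbd i g)))
    exact ⟨l, hl⟩
  choose l hl using hlim
  let L : CompactlySupportedContinuousMap X ℝ →ₗ[ℝ] ℝ :=
    { toFun := fun g => l g.toContinuousMap
      map_add' := fun g h => by
        refine tendsto_nhds_unique (hl _) ?_
        refine ((hl g.toContinuousMap).add (hl h.toContinuousMap)).congr fun i => ?_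
        rw [← map_add]; rfl
      map_smul' := fun c g => by
        refine tendsto_nhds_unique (hl _) ?_
        refine ((hl g.toContinuousMap).const_smul c).congr fun i => ?_
        rw [← map_smul]; rfl }
  let Lp := PositiveLinearMap.mk₀ L fun g hg => by
    refine ge_of_tendsto (hl g.toContinuousMap) (Eventually.of_forall fun i => hpos i _ ?_)
    exact fun x => hg x
  refine ⟨RealRMK.rieszMeasure Lp, inferInstance, fun g => ?_⟩
  have := RealRMK.integral_rieszMeasure Lp (CompactlySupportedContinuousMap.continuousMapEquiv g)
  have h2 : ∫ x, g x ∂(RealRMK.rieszMeasure Lp) = l g := this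
  rw [h2]
  exact hl g

instance : MeasurableSpace Circle := borel Circle

instance : BorelSpace Circle := ⟨rfl⟩

theorem exists_measure_tendsto_circle {k : ℕ → ℝ → ℝ} (hk : ∀ n, Continuous (k n))
    (hk0 : ∀ n θ, 0 ≤ k n θ) {C : ℝ}
    (hC : ∀ n, (2 * Real.pi)⁻¹ * ∫ θ in (0 : ℝ)..2 * Real.pi, k n θ ≤ C) :
    ∃ ν : Measure Circle, IsFiniteMeasure ν ∧ ∀ g : C(Circle, ℝ),
      Tendsto (fun n => (2 * Real.pi)⁻¹ * ∫ θ in (0 : ℝ)..2 * Real.pi, g (Circle.exp θ) * k n θ)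
        (hyperfilter ℕ) (𝓝 (∫ ζ, g ζ ∂ν)) := by
  have hc : ∀ (g : C(Circle, ℝ)) n, Continuous fun θ => g (Circle.exp θ) * k n θ := fun g n =>
    (g.continuous.comp Circle.exp.continuous).mul (hk n)
  let Λ : ℕ → C(Circle, ℝ) →ₗ[ℝ] ℝ := fun n =>
    { toFun := fun g => (2 * Real.pi)⁻¹ * ∫ θ in (0 : ℝ)..2 * Real.pi, g (Circle.exp θ) * k n θ
      map_add' := fun g h => by
        rw [← mul_add, ← intervalIntegral.integral_add ((hc g n).intervalIntegrable _ _)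
          ((hc h n).intervalIntegrable _ _)]
        simp only [ContinuousMap.add_apply, add_mul]
      map_smul' := fun c g => by
        simp only [ContinuousMap.smul_apply, smul_eq_mul, mul_assoc, RingHom.id_apply,
          intervalIntegral.integral_const_mul]
        ring }
  refine exists_measure_tendsto_of_positive (hyperfilter ℕ) Λ (fun n g hg => ?_) (C := C) fun n => ?_
  · refine mul_nonneg (by have := Real.pi_pos; positivity) ?_
    refine intervalIntegral.integral_nonneg (by have := Real.pi_pos; positivity) fun θ _ => ?_
    exact mul_nonneg (hg _) (hk0 n θ)
  · simpa [Λ] using hC n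

/-! ### The Poisson representation in the disc -/

/-- In Jensen's formula the zeros of Q inside the disc contribute nonnegative terms. -/
theorem log_norm_le_circleAverage {Q : ℂ → ℂ} {r : ℝ} (hr : 0 < r)
    (hQ : AnalyticOnNhd ℂ Q (Metric.closedBall 0 r)) (hQ0 : Q 0 ≠ 0) :
    Real.log ‖Q 0‖ ≤ Real.circleAverage (fun w => Real.log ‖Q w‖) 0 r := by
  have hr' : |r| = r := abs_of_pos hr
  have h := AnalyticOnNhd.circleAverage_log_norm (c := 0) hr.ne' (by rwa [hr']) hQ0
  rw [h]
  refine le_add_of_nonneg_left (finsum_nonneg fun u => ?_)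
  rw [hr']
  by_cases hu : u ∈ Metric.closedBall (0 : ℂ) r
  · refine mul_nonneg (mod_cast MeromorphicOn.AnalyticOnNhd.divisor_nonneg hQ u) ?_
    rcases eq_or_ne u 0 with rfl | hu0
    · simp
    · apply Real.log_nonneg
      rw [zero_sub, norm_neg, ← div_eq_mul_inv, le_div_iff₀ (norm_pos_iff.2 hu0), one_mul]
      simpa using hu
  · rw [Function.locallyFinsuppWithin.apply_eq_zero_of_notMem _ hu]
    simp

/-- Both 0 and Re F are at most log M - log|Q|, and Jensen's inequality bounds the average of the
right side by its value at the centre, uniformly in r. -/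
theorem circleAverage_posPart_le {F Q : ℂ → ℂ} {M r : ℝ} (hr : 0 < r)
    (hF : AnalyticOnNhd ℂ F (Metric.closedBall 0 r))
    (hQ : AnalyticOnNhd ℂ Q (Metric.closedBall 0 r)) (hQ0 : Q 0 ≠ 0)
    (hb : ∀ w ∈ Metric.closedBall (0 : ℂ) r, ‖Q w‖ ≤ M ∧ ‖Complex.exp (F w) * Q w‖ ≤ M) :
    Real.circleAverage (fun w => max (F w).re 0) 0 r ≤ Real.log M - Real.log ‖Q 0‖ := by
  have hr' : |r| = r := abs_of_pos hr
  have hsub : Metric.sphere (0 : ℂ) |r| ⊆ Metric.closedBall 0 r := by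
    rw [hr']; exact Metric.sphere_subset_closedBall
  have hFc : ContinuousOn (fun w => max (F w).re 0) (Metric.sphere (0 : ℂ) |r|) := by
    have := hF.continuousOn.mono hsub
    exact (Complex.continuous_re.comp_continuousOn this).sup continuousOn_const
  have i1 : CircleIntegrable (fun w => max (F w).re 0) 0 r := hFc.circleIntegrable'
  have i2 : CircleIntegrable (fun w => Real.log ‖Q w‖) 0 r :=
    MeromorphicOn.circleIntegrable_log_norm fun z hz => (hQ z (hsub hz)).meromorphicAt
  have hco : ∀ᶠ w in codiscreteWithin (Metric.sphere (0 : ℂ) |r|), Q w ≠ 0 := by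
    have := hQ.preimage_zero_mem_codiscreteWithin hQ0 (Metric.mem_closedBall_self hr.le)
      ((convex_closedBall (0 : ℂ) r).isConnected ⟨0, Metric.mem_closedBall_self hr.le⟩)
    exact codiscreteWithin_mono hsub this
  -- At zeros of Q the convention log 0 = 0 can break the pointwise bound. Taking the minimum
  -- restores it everywhere and changes the function only off a codiscrete set.
  set v : ℂ → ℝ := fun w => min (max (F w).re 0) (Real.log M - Real.log ‖Q w‖) with hv
  have hveq : (fun w => max (F w).re 0) =ᶠ[codiscreteWithin (Metric.sphere (0 : ℂ) |r|)] v := by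
    filter_upwards [hco, self_mem_codiscreteWithin _] with w hw hws
    have hwb := hb w (hsub hws)
    have hQw := norm_pos_iff.2 hw
    rw [hv]
    symm
    apply min_eq_left
    apply max_le
    · have h1 := Real.log_le_log (by rw [norm_mul, Complex.norm_exp]; exact mul_pos (Real.exp_pos _) hQw)
        hwb.2
      rw [norm_mul, Complex.norm_exp, Real.log_mul (Real.exp_ne_zero _) hQw.ne', Real.log_exp] at h1
      linarith
    · have := Real.log_le_log hQw hwb.1
      linarith
  have i3 : CircleIntegrable v 0 r := i1.congr_codiscreteWithin hveq
  have i4 : CircleIntegrable (fun _ : ℂ => Real.log M) 0 r :=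
    continuousOn_const.circleIntegrable'
  rw [Real.circleAverage_congr_codiscreteWithin hveq hr.ne']
  calc Real.circleAverage v 0 r
      ≤ Real.circleAverage (fun w => Real.log M - Real.log ‖Q w‖) 0 r :=
        Real.circleAverage_mono i3 (i4.sub i2) fun w _ => min_le_right _ _
    _ = Real.log M - Real.circleAverage (fun w => Real.log ‖Q w‖) 0 r := by
        rw [Real.circleAverage_fun_sub i4 i2, Real.circleAverage_const]
    _ ≤ _ := by linarith [log_norm_le_circleAverage hr hQ hQ0]

theorem circleMap_zero_one (θ : ℝ) : circleMap 0 1 θ = Circle.exp θ := by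
  simp [circleMap, Circle.coe_exp]

theorem continuous_poissonKernel_circle {w : ℂ} (hw : w ∈ Metric.ball (0 : ℂ) 1) :
    Continuous fun ζ : Circle => poissonKernel 0 w ζ := by
  simp only [poissonKernel_def, sub_zero]
  refine Continuous.div (by fun_prop) (by fun_prop) fun ζ => ?_
  have : (ζ : ℂ) - w ≠ 0 := by
    intro h
    rw [sub_eq_zero] at h
    have h1 := ζ.norm_coe
    rw [h] at h1
    rw [mem_ball_zero_iff] at hw
    linarith
  positivity

/-- On circles of radius r < 1 the positive and negative parts of Re F have bounded mass; weak
limits as r → 1 give m₁ and m₂, and the Poisson formula passes to the limit. -/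
theorem exists_measure_disc_poisson {F Q : ℂ → ℂ} (hF : DifferentiableOn ℂ F (Metric.ball 0 1))
    (hQ : DifferentiableOn ℂ Q (Metric.ball 0 1)) (hQ0 : Q 0 ≠ 0) {M : ℝ}
    (hb : ∀ w ∈ Metric.ball (0 : ℂ) 1, ‖Q w‖ ≤ M ∧ ‖Complex.exp (F w) * Q w‖ ≤ M) :
    ∃ m₁ m₂ : Measure Circle, IsFiniteMeasure m₁ ∧ IsFiniteMeasure m₂ ∧
      ∀ w ∈ Metric.ball (0 : ℂ) 1, (F w).re =
        (∫ ζ : Circle, poissonKernel 0 w ζ ∂m₁) - ∫ ζ : Circle, poissonKernel 0 w ζ ∂m₂ := by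
  have hM : 0 < M := (norm_pos_iff.2 hQ0).trans_le (hb 0 (by simp)).1
  have hFa := hF.analyticOnNhd Metric.isOpen_ball
  have hQa := hQ.analyticOnNhd Metric.isOpen_ball
  set r : ℕ → ℝ := fun n => 1 - 1 / ((n : ℝ) + 2) with hr
  have hr0 : ∀ n, 0 < r n := fun n => by
    have : 1 / ((n : ℝ) + 2) < 1 := by rw [div_lt_one (by positivity)]; linarith [n.cast_nonneg (α := ℝ)]
    simp only [hr]; linarith
  have hr1 : ∀ n, r n < 1 := fun n => by
    have : 0 < 1 / ((n : ℝ) + 2) := by positivity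
    simp only [hr]; linarith
  have hrlim : Tendsto r (hyperfilter ℕ) (𝓝 1) := by
    have h1 : Tendsto r atTop (𝓝 (1 - 0)) := by
      refine tendsto_const_nhds.sub ?_
      have := tendsto_const_nhds (x := (1 : ℝ)) |>.div_atTop
        (tendsto_atTop_add_const_right atTop (2 : ℝ) (tendsto_natCast_atTop_atTop (R := ℝ)))
      exact this
    rw [sub_zero] at h1
    exact h1.mono_left Nat.hyperfilter_le_atTop
  have hcb : ∀ n, Metric.closedBall (0 : ℂ) (r n) ⊆ Metric.ball 0 1 := fun n =>
    Metric.closedBall_subset_ball (hr1 n)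
  have hmem : ∀ n θ, circleMap 0 (r n) θ ∈ Metric.ball (0 : ℂ) 1 := fun n θ =>
    hcb n (Metric.sphere_subset_closedBall (circleMap_mem_sphere 0 (hr0 n).le θ))
  have huc : ∀ n, Continuous fun θ : ℝ => (F (circleMap 0 (r n) θ)).re := fun n =>
    Complex.continuous_re.comp (hF.continuousOn.comp_continuous (continuous_circleMap 0 (r n))
      (hmem n))
  set B := Real.log M - Real.log ‖Q 0‖ with hB
  have hpos : ∀ n, (2 * Real.pi)⁻¹ * ∫ θ in (0 : ℝ)..2 * Real.pi,
      max (F (circleMap 0 (r n) θ)).re 0 ≤ B := fun n => by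
    have := circleAverage_posPart_le (hr0 n) (hFa.mono (hcb n)) (hQa.mono (hcb n)) hQ0
      (fun w hw => hb w (hcb n hw))
    rwa [Real.circleAverage_def, smul_eq_mul] at this
  have hharm : ∀ n, InnerProductSpace.HarmonicOnNhd (fun w => (F ((r n : ℂ) * w)).re)
      (Metric.closedBall 0 1) := by
    intro n w hw
    have hw' : (r n : ℂ) * w ∈ Metric.ball (0 : ℂ) 1 := by
      rw [mem_closedBall_zero_iff] at hw
      rw [mem_ball_zero_iff, norm_mul, Complex.norm_real, Real.norm_eq_abs, abs_of_pos (hr0 n)]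
      nlinarith [hr0 n, hr1 n]
    have : AnalyticAt ℂ (fun w => F ((r n : ℂ) * w)) w :=
      AnalyticAt.fun_comp (hFa _ hw') (by fun_prop)
    exact this.harmonicAt_re
  have hcm : ∀ n θ, (r n : ℂ) * circleMap 0 1 θ = circleMap 0 (r n) θ := fun n θ => by
    simp [circleMap]
  have hrep : ∀ n, ∀ w ∈ Metric.ball (0 : ℂ) 1, (F ((r n : ℂ) * w)).re =
      (2 * Real.pi)⁻¹ * ∫ θ in (0 : ℝ)..2 * Real.pi, poissonKernel 0 w (Circle.exp θ) *
        (F (circleMap 0 (r n) θ)).re := by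
    intro n w hw
    have := (hharm n).circleAverage_poissonKernel_smul hw
    rw [← this, Real.circleAverage_def, smul_eq_mul]
    have hcm' : ∀ θ : ℝ, (r n : ℂ) * (Circle.exp θ : ℂ) = circleMap 0 (r n) θ := fun θ => by
      rw [← circleMap_zero_one, hcm]
    simp only [Pi.smul_apply', smul_eq_mul, circleMap_zero_one, hcm']
  -- By the mean value property the negative part has the average of the positive part minus Re
  -- F(0).
  have hneg : ∀ n, (2 * Real.pi)⁻¹ * ∫ θ in (0 : ℝ)..2 * Real.pi,
      max (-(F (circleMap 0 (r n) θ)).re) 0 ≤ B - (F 0).re := fun n => by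
    have h0 := hrep n 0 (by simp)
    have hk : ∀ θ : ℝ, poissonKernel 0 0 (Circle.exp θ) = 1 := fun θ => by
      simp [poissonKernel_def]
    simp only [hk, one_mul, mul_zero] at h0
    have e : ∀ θ : ℝ, max (-(F (circleMap 0 (r n) θ)).re) 0 =
        max (F (circleMap 0 (r n) θ)).re 0 - (F (circleMap 0 (r n) θ)).re := fun θ => by
      rcases le_total (F (circleMap 0 (r n) θ)).re 0 with h | h
      · rw [max_eq_left (by linarith), max_eq_right h]; ring
      · rw [max_eq_right (by linarith), max_eq_left h]; ring
    simp only [e]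
    rw [intervalIntegral.integral_sub (((huc n).max continuous_const).intervalIntegrable _ _)
      ((huc n).intervalIntegrable _ _), mul_sub, ← h0]
    linarith [hpos n]
  obtain ⟨m₁, hm₁, h₁⟩ := exists_measure_tendsto_circle
    (fun n => (huc n).max continuous_const) (fun n θ => le_max_right _ _) hpos
  obtain ⟨m₂, hm₂, h₂⟩ := exists_measure_tendsto_circle
    (fun n => (huc n).neg.max continuous_const) (fun n θ => le_max_right _ _) hneg
  refine ⟨m₁, m₂, hm₁, hm₂, fun w hw => ?_⟩
  have hlim := (h₁ ⟨_, continuous_poissonKernel_circle hw⟩).sub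
    (h₂ ⟨_, continuous_poissonKernel_circle hw⟩)
  simp only [ContinuousMap.coe_mk] at hlim
  refine tendsto_nhds_unique (f := fun n => (F ((r n : ℂ) * w)).re) ?_ (hlim.congr fun n => ?_)
  · have h1 : Tendsto (fun n => (r n : ℂ) * w) (hyperfilter ℕ) (𝓝 w) := by
      have := ((Complex.continuous_ofReal.tendsto 1).comp hrlim).mul_const w
      simpa using this
    have h2 : ContinuousAt F w :=
      hF.continuousOn.continuousAt (Metric.isOpen_ball.mem_nhds hw)
    exact (Complex.continuous_re.tendsto _).comp (h2.tendsto.comp h1)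
  · have hkc : Continuous fun θ : ℝ => poissonKernel 0 w (Circle.exp θ) :=
      (continuous_poissonKernel_circle hw).comp Circle.exp.continuous
    have e := intervalIntegral.integral_sub (μ := volume)
      ((hkc.mul ((huc n).max (continuous_const (y := (0 : ℝ))))).intervalIntegrable 0 (2 * Real.pi))
      ((hkc.mul ((huc n).neg.max (continuous_const (y := (0 : ℝ))))).intervalIntegrable 0
        (2 * Real.pi))
    rw [hrep n w hw, ← mul_sub]
    congr 1
    refine e.symm.trans (intervalIntegral.integral_congr fun θ _ => ?_)
    simp only [Pi.mul_apply, Pi.neg_apply]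
    rw [← mul_sub]
    congr 1
    rcases le_total (F (circleMap 0 (r n) θ)).re 0 with h | h
    · rw [max_eq_right h, max_eq_left (by linarith)]; ring
    · rw [max_eq_left h, max_eq_right (by linarith)]; ring

/-! ### Transfer to the half-plane -/

/-- The disc goes to the half-plane with 0 ↦ z₀ and 1 ↦ ∞. The base point is left free because the
denominator of the quotient must not vanish at the centre. -/
def cayley (z₀ w : ℂ) : ℂ := (z₀ - conj z₀ * w) / (1 - w)

def cayleyInv (z₀ z : ℂ) : ℂ := (z - z₀) / (z - conj z₀)

theorem cayley_im (z₀ : ℂ) {w : ℂ} (hw : w ≠ 1) :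
    (cayley z₀ w).im = z₀.im * (1 - ‖w‖ ^ 2) / ‖1 - w‖ ^ 2 := by
  rw [cayley, Complex.div_im, ← Complex.normSq_eq_norm_sq, ← Complex.normSq_eq_norm_sq]
  have : Complex.normSq (1 - w) ≠ 0 := 
    (Complex.normSq_pos.2 (sub_ne_zero.2 hw.symm)).ne'
  field_simp
  simp [Complex.normSq_apply]
  ring

theorem cayley_mem_upperHalf {z₀ w : ℂ} (hz : 0 < z₀.im) (hw : w ∈ Metric.ball (0 : ℂ) 1) :
    cayley z₀ w ∈ upperHalf := by
  rw [mem_ball_zero_iff] at hw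
  have hw1 : w ≠ 1 := by rintro rfl; simp at hw
  change 0 < (cayley z₀ w).im
  rw [cayley_im z₀ hw1]
  have : 0 < ‖1 - w‖ := norm_pos_iff.2 (sub_ne_zero.2 hw1.symm)
  have : 0 < 1 - ‖w‖ ^ 2 := by nlinarith [norm_nonneg w]
  positivity

theorem differentiableOn_cayley (z₀ : ℂ) : DifferentiableOn ℂ (cayley z₀) (Metric.ball 0 1) := by
  intro w hw
  have hw1 : (1 : ℂ) - w ≠ 0 := by
    rw [mem_ball_zero_iff] at hw
    rw [sub_ne_zero]; rintro rfl; simp at hw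
  unfold cayley
  exact (DifferentiableAt.div (by fun_prop) (by fun_prop) hw1).differentiableWithinAt

theorem one_sub_cayleyInv {z₀ z : ℂ} (h₀ : 0 < z₀.im) (hz : 0 < z.im) :
    1 - cayleyInv z₀ z = (z₀ - conj z₀) / (z - conj z₀) := by
  have h := sub_conj_ne_zero hz h₀
  rw [cayleyInv]
  field_simp
  ring

theorem cayley_cayleyInv {z₀ z : ℂ} (h₀ : 0 < z₀.im) (hz : 0 < z.im) :
    cayley z₀ (cayleyInv z₀ z) = z := by
  have h := sub_conj_ne_zero hz h₀
  have h' := sub_conj_ne_zero h₀ h₀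
  rw [cayley, one_sub_cayleyInv h₀ hz, cayleyInv]
  field_simp
  ring

theorem norm_sq_sub_conj_sub (z₀ z : ℂ) :
    ‖z - conj z₀‖ ^ 2 - ‖z - z₀‖ ^ 2 = 4 * z.im * z₀.im := by
  rw [← Complex.normSq_eq_norm_sq, ← Complex.normSq_eq_norm_sq]
  simp [Complex.normSq_apply]
  ring

theorem norm_sub_conj_self {z₀ : ℂ} (h₀ : 0 < z₀.im) : ‖z₀ - conj z₀‖ = 2 * z₀.im := by
  rw [Complex.sub_conj, norm_mul, Complex.norm_I, mul_one, Complex.norm_real, Real.norm_eq_abs,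
    abs_of_pos (by positivity)]

theorem cayleyInv_mem_ball {z₀ z : ℂ} (h₀ : 0 < z₀.im) (hz : 0 < z.im) :
    cayleyInv z₀ z ∈ Metric.ball (0 : ℂ) 1 := by
  have h := norm_pos_iff.2 (sub_conj_ne_zero hz h₀)
  rw [mem_ball_zero_iff, cayleyInv, norm_div, div_lt_one h]
  have := norm_sq_sub_conj_sub z₀ z
  have h4 : 0 < 4 * z.im * z₀.im := by positivity
  exact lt_of_pow_lt_pow_left₀ 2 h.le (by linarith)

theorem one_sub_norm_cayleyInv_sq {z₀ z : ℂ} (h₀ : 0 < z₀.im) (hz : 0 < z.im) :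
    1 - ‖cayleyInv z₀ z‖ ^ 2 = 4 * z.im * z₀.im / ‖z - conj z₀‖ ^ 2 := by
  have h := (norm_pos_iff.2 (sub_conj_ne_zero hz h₀)).ne'
  rw [← norm_sq_sub_conj_sub, cayleyInv, norm_div]
  field_simp

/-- The boundary point 1 corresponds to infinity, so an atom there produces the term linear in Im z.
-/
theorem poissonKernel_cayleyInv_one {z₀ z : ℂ} (h₀ : 0 < z₀.im) (hz : 0 < z.im) :
    poissonKernel 0 (cayleyInv z₀ z) 1 = z.im / z₀.im := by
  have h := (norm_pos_iff.2 (sub_conj_ne_zero hz h₀)).ne'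
  rw [poissonKernel_def, sub_zero, sub_zero, norm_one, one_pow, one_sub_norm_cayleyInv_sq h₀ hz,
    one_sub_cayleyInv h₀ hz, norm_div, norm_sub_conj_self h₀]
  field_simp
  ring

theorem poissonKernel_cayleyInv_ofReal {z₀ z : ℂ} (h₀ : 0 < z₀.im) (hz : 0 < z.im) (t : ℝ) :
    poissonKernel 0 (cayleyInv z₀ z) (cayleyInv z₀ t) =
      z.im / z₀.im * ‖(t : ℂ) - z₀‖ ^ 2 * (‖z - t‖ ^ 2)⁻¹ := by
  have h1 := sub_conj_ne_zero hz h₀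
  have h2 := conj_sub_ofReal_ne_zero h₀ t
  have h2' : (t : ℂ) - conj z₀ ≠ 0 := by rw [← neg_sub]; exact neg_ne_zero.2 h2
  have h3 := sub_ofReal_ne_zero hz t
  have h4 := sub_ofReal_ne_zero h₀ t
  have e : cayleyInv z₀ t - cayleyInv z₀ z =
      (t - z) * (z₀ - conj z₀) / ((t - conj z₀) * (z - conj z₀)) := by
    rw [cayleyInv, cayleyInv]
    field_simp
    ring
  have n1 : ‖(t : ℂ) - conj z₀‖ = ‖(t : ℂ) - z₀‖ := by
    rw [norm_sub_rev, norm_conj_sub, norm_sub_rev]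
  have n2 : ‖cayleyInv z₀ t‖ = 1 := by
    rw [cayleyInv, norm_div, n1, div_self]
    rw [norm_sub_rev]; exact norm_ne_zero_iff.2 h4
  have p1 := norm_ne_zero_iff.2 h1
  have p3 := norm_ne_zero_iff.2 h3
  have p4 := norm_ne_zero_iff.2 h4
  rw [norm_sub_rev] at p4
  rw [poissonKernel_def, sub_zero, sub_zero, n2, one_pow, one_sub_norm_cayleyInv_sq h₀ hz, e,
    norm_div, norm_mul, norm_mul, norm_sub_conj_self h₀, n1, norm_sub_rev (t : ℂ) z]
  field_simp
  ring

theorem cayleyInv_cayley_re {z₀ : ℂ} (h₀ : 0 < z₀.im) {ζ : ℂ} (hζ : ‖ζ‖ = 1) (hζ1 : ζ ≠ 1) :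
    cayleyInv z₀ (cayley z₀ ζ).re = ζ := by
  have him : (cayley z₀ ζ).im = 0 := by rw [cayley_im z₀ hζ1, hζ]; simp
  have hre : ((cayley z₀ ζ).re : ℂ) = cayley z₀ ζ := by
    apply Complex.ext <;> simp [him]
  have h := sub_conj_ne_zero h₀ h₀
  have h1 : 1 - ζ ≠ 0 := sub_ne_zero.2 hζ1.symm
  have e1 : cayley z₀ ζ - z₀ = ζ * (z₀ - conj z₀) / (1 - ζ) := by
    rw [cayley]; field_simp; ring
  have e2 : cayley z₀ ζ - conj z₀ = (z₀ - conj z₀) / (1 - ζ) := by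
    rw [cayley]; field_simp; ring
  rw [hre, cayleyInv, e1, e2]
  field_simp

theorem exists_measure_real_of_circle (m : Measure Circle) [IsFiniteMeasure m] {z₀ : ℂ}
    (h₀ : 0 < z₀.im) : ∃ n : Measure ℝ, IsFiniteMeasure n ∧ ∀ z : ℂ, 0 < z.im →
      ∫ ζ : Circle, poissonKernel 0 (cayleyInv z₀ z) ζ ∂m = m.real {1} * (z.im / z₀.im) +
        ((∫ t : ℝ, z.im / Real.pi * (‖z - t‖ ^ 2)⁻¹ ∂n.withDensity quadDensity) / 2) := by
  have hTm : Measurable fun ζ : Circle => (cayley z₀ ζ).re := by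
    have hcoe : Continuous fun ζ : Circle => (ζ : ℂ) := by fun_prop
    have := hcoe.measurable
    unfold cayley
    fun_prop
  set T : Circle → ℝ := fun ζ => (cayley z₀ ζ).re with hT
  -- D(t)(1+t²) is the factor that turns the disc kernel into twice the half-plane Poisson kernel,
  -- the 2 matching 2 Re f. Since D is bounded, the measure stays finite before the weight 1 + t² is
  -- applied.
  set D : ℝ → ℝ := fun t => 2 * Real.pi / z₀.im * ‖(t : ℂ) - z₀‖ ^ 2 * (1 + t ^ 2)⁻¹ with hD
  have hD0 : ∀ t, 0 ≤ D t := fun t => by have := Real.pi_pos; positivity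
  have hDc : Continuous D := by
    have : ∀ t : ℝ, 1 + t ^ 2 ≠ 0 := fun t => by positivity
    fun_prop (disch := assumption)
  have hDb : ∀ t, ‖D t‖ ≤ 2 * Real.pi / z₀.im * (2 * (1 + ‖z₀‖ ^ 2)) := fun t => by
    have h1 : ‖(t : ℂ) - z₀‖ ≤ |t| + ‖z₀‖ := by
      simpa using norm_sub_le (t : ℂ) z₀
    have h2 : ‖(t : ℂ) - z₀‖ ^ 2 ≤ 2 * (1 + ‖z₀‖ ^ 2) * (1 + t ^ 2) := by
      have := pow_le_pow_left₀ (norm_nonneg _) h1 2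
      have h3 := sq_abs t
      nlinarith [sq_nonneg (|t| - ‖z₀‖), mul_nonneg (sq_nonneg t) (sq_nonneg ‖z₀‖)]
    rw [Real.norm_of_nonneg (hD0 t), hD]
    simp only
    rw [mul_assoc]
    have := Real.pi_pos
    refine mul_le_mul_of_nonneg_left ?_ (by positivity)
    rw [← div_eq_mul_inv, div_le_iff₀ (by positivity)]
    exact h2
  set n₀ := (m.restrict {1}ᶜ).map T with hn₀
  have hDi : Integrable D n₀ :=
    Integrable.of_bound hDc.aestronglyMeasurable _ (Eventually.of_forall hDb)
  refine ⟨n₀.withDensity fun t => ENNReal.ofReal (D t),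
    isFiniteMeasure_withDensity_ofReal hDi.2, fun z hz => ?_⟩
  have hc : Continuous fun t : ℝ => z.im / z₀.im * ‖(t : ℂ) - z₀‖ ^ 2 * (‖z - t‖ ^ 2)⁻¹ := by
    have : ∀ t : ℝ, ‖z - t‖ ^ 2 ≠ 0 := fun t =>
      pow_ne_zero 2 (norm_ne_zero_iff.2 (sub_ofReal_ne_zero hz t))
    fun_prop (disch := assumption)
  have hpc := continuous_poissonKernel_circle (cayleyInv_mem_ball h₀ hz)
  have hpi : Integrable (fun ζ : Circle => poissonKernel 0 (cayleyInv z₀ z) ζ) m :=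
    hpc.integrable_of_hasCompactSupport (HasCompactSupport.of_compactSpace _)
  have e1 : ∫ ζ in ({1}ᶜ : Set Circle), poissonKernel 0 (cayleyInv z₀ z) ζ ∂m =
      ∫ t : ℝ, z.im / z₀.im * ‖(t : ℂ) - z₀‖ ^ 2 * (‖z - t‖ ^ 2)⁻¹ ∂n₀ := by
    rw [hn₀, integral_map hTm.aemeasurable hc.aestronglyMeasurable]
    refine setIntegral_congr_fun (measurableSet_singleton _).compl fun ζ hζ => ?_
    have hζ1 : (ζ : ℂ) ≠ 1 := fun h => hζ (Circle.ext (by simpa using h))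
    have := cayleyInv_cayley_re h₀ ζ.norm_coe hζ1
    simp only [hT]
    rw [← poissonKernel_cayleyInv_ofReal h₀ hz, this]
  have e2 : ∫ t : ℝ, z.im / Real.pi * (‖z - t‖ ^ 2)⁻¹
      ∂(n₀.withDensity fun t => ENNReal.ofReal (D t)).withDensity quadDensity =
      ∫ t : ℝ, 2 * (z.im / z₀.im * ‖(t : ℂ) - z₀‖ ^ 2 * (‖z - t‖ ^ 2)⁻¹) ∂n₀ := by
    rw [integral_withDensity_eq_integral_toReal_smul measurable_quadDensity
        (Eventually.of_forall fun t => (quadDensity_ne_top t).lt_top),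
      integral_withDensity_eq_integral_toReal_smul (by fun_prop)
        (Eventually.of_forall fun t => ENNReal.ofReal_lt_top)]
    refine integral_congr_ae (Eventually.of_forall fun t => ?_)
    have ht : (0 : ℝ) < 1 + t ^ 2 := by positivity
    simp only [quadDensity, ENNReal.toReal_ofReal (hD0 t), ENNReal.toReal_ofReal ht.le,
      smul_eq_mul]
    simp only [hD]
    have := Real.pi_pos.ne'
    field_simp
  rw [← integral_add_compl (measurableSet_singleton (1 : Circle)) hpi, integral_singleton, e1, e2,
    integral_const_mul]
  have : poissonKernel 0 (cayleyInv z₀ z) ((1 : Circle) : ℂ) = z.im / z₀.im := by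
    rw [Circle.coe_one]; exact poissonKernel_cayleyInv_one h₀ hz
  rw [this, smul_eq_mul]
  ring

theorem isOpen_upperHalf : IsOpen upperHalf := isOpen_lt continuous_const Complex.continuous_im

theorem isConnected_upperHalf : IsConnected upperHalf :=
  (convex_halfSpace_im_gt 0).isConnected ⟨Complex.I, I_im_pos⟩

/-- A holomorphic function satisfying condition (IV) is, up to an imaginary constant, the Herglotz
integral of a measure. -/
theorem ConditionIV.exists_measure {f : ℂ → ℂ} (hf : DifferentiableOn ℂ f upperHalf)
    (h : ConditionIV f) : ∃ μ : RealLocFinMeasure,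
      Integrable (fun t : ℝ => (1 + t ^ 2)⁻¹) μ.variation ∧ KernelIdentity f μ := by
  obtain ⟨⟨P, Q, hP, hQ, ⟨M, hM⟩, ⟨z₀, h₀, hQ0⟩, hPQ⟩, hlim⟩ := h
  have h₀' : 0 < z₀.im := h₀
  have hmaps : MapsTo (cayley z₀) (Metric.ball 0 1) upperHalf := fun w hw =>
    cayley_mem_upperHalf h₀ hw
  obtain ⟨m₁, m₂, hm₁, hm₂, hrep⟩ := exists_measure_disc_poisson (F := f ∘ cayley z₀)
    (Q := Q ∘ cayley z₀) (M := M) (hf.comp (differentiableOn_cayley z₀) hmaps)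
    (hQ.comp (differentiableOn_cayley z₀) hmaps) (by simpa [cayley] using hQ0)
    (fun w hw => ⟨(hM _ (hmaps hw)).2, by
      have := hPQ _ (hmaps hw)
      simp only [Function.comp_apply]
      rw [this]
      exact (hM _ (hmaps hw)).1⟩)
  obtain ⟨n₁, hn₁, e₁⟩ := exists_measure_real_of_circle m₁ h₀
  obtain ⟨n₂, hn₂, e₂⟩ := exists_measure_real_of_circle m₂ h₀
  obtain ⟨μ, hμ, hsum⟩ := exists_realLocFinMeasure_sub n₁ n₂
  have hμ' := hμ
  rw [integrable_variation_iff] at hμ'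
  -- The atoms at the point of the circle that corresponds to infinity leave the term k · Im z.
  set k : ℝ := (m₁.real {1} - m₂.real {1}) / z₀.im with hk
  have hre : ∀ z, 0 < z.im → (f z).re = (herglotz μ z).re + k * z.im := by
    intro z hz
    have h1 := hrep _ (cayleyInv_mem_ball h₀ hz)
    rw [Function.comp_apply, cayley_cayleyInv h₀ hz, e₁ z hz, e₂ z hz] at h1
    set g : ℝ → ℝ := fun t => z.im / Real.pi * (‖z - t‖ ^ 2)⁻¹ with hg
    have hgi : ∀ {ν : Measure ℝ}, Integrable (fun t : ℝ => (1 + t ^ 2)⁻¹) ν → Integrable g ν := by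
      intro ν hν
      have := (integrable_cauchyKer hz hz hν).norm.const_mul (z.im / Real.pi)
      refine this.congr (Eventually.of_forall fun t => ?_)
      simp only [hg, norm_cauchyKer]
      rw [sq, mul_inv]
    have h2 := two_mul_re_of_kernelIdentity (herglotz_kernelIdentity hμ) hz
    have h3 : ∫ t, g t ∂μ.pos + ∫ t, g t ∂(n₂.withDensity quadDensity) =
        ∫ t, g t ∂μ.neg + ∫ t, g t ∂(n₁.withDensity quadDensity) := by
      rw [← integral_add_measure (hgi hμ'.1) (hgi (integrable_withDensity_quad n₂)),
        ← integral_add_measure (hgi hμ'.2) (hgi (integrable_withDensity_quad n₁)), hsum]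
    rw [RealLocFinMeasure.integral, integral_complex_ofReal, integral_complex_ofReal, ← Complex.ofReal_sub,
      Complex.ofReal_inj] at h2
    rw [hk, h1]
    change 2 * (herglotz μ z).re = ∫ t, g t ∂μ.pos - ∫ t, g t ∂μ.neg at h2
    have h4 : (herglotz μ z).re = ((∫ t, g t ∂(n₁.withDensity quadDensity)) -
      ∫ t, g t ∂(n₂.withDensity quadDensity)) / 2 := by linarith
    rw [h4]
    ring
  -- The Herglotz part is o(y) along iy, so Re f(iy)/y tends to k and the mean type condition reads
  -- k = 0.
  have hk0 : k = 0 := by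
    have h1 := (herglotz_kernelIdentity hμ).tendsto_re_div hμ
    have h2 : Tendsto (fun y : ℝ => (f (y * Complex.I)).re / y) atTop (𝓝 (0 + k)) := by
      refine (h1.add_const k).congr' ?_
      filter_upwards [eventually_gt_atTop 0] with y hy
      rw [hre _ (by simpa using hy)]
      have : ((y : ℂ) * Complex.I).im = y := by simp
      rw [this, add_div, mul_div_cancel_right₀ _ hy.ne']
    rw [zero_add] at h2
    have h3 := ((continuous_coe_real_ereal.tendsto k).comp h2).limsup_eq
    have h4 : limsup (fun y : ℝ => (((f (y * Complex.I)).re / y : ℝ) : EReal)) atTop = (k : EReal) :=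
      h3
    rw [hlim] at h4
    exact_mod_cast h4.symm
  -- The difference is holomorphic with vanishing real part, hence an imaginary constant, which
  -- cancels in f(z) + conj f(w).
  have hd : DifferentiableOn ℂ (fun z => f z - herglotz μ z) upperHalf :=
    hf.sub (differentiableOn_herglotz hμ)
  obtain ⟨κ, hκ⟩ := (hd.analyticOnNhd isOpen_upperHalf).eq_re_add_const_mul_I_of_re_eq_const
    (c₀ := 0) (fun z hz => by rw [Complex.sub_re, hre z hz, hk0]; ring) isOpen_upperHalf
    isConnected_upperHalf
  refine ⟨μ, hμ, fun z hz w hw => ?_⟩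
  rw [← herglotz_kernelIdentity hμ z hz w hw]
  congr 1
  have a1 := hκ z hz
  have a2 := hκ w hw
  rw [sub_eq_iff_eq_add] at a1 a2
  rw [a1, a2]
  simp
  ring

/-! ### Fourier transforms on the line -/

theorem fourier_eq_integral_expi (f : ℝ → ℂ) (t : ℝ) : 𝓕 f t = ∫ v, expi (-t) v * f v := by
  rw [Real.fourier_real_eq_integral_exp_smul]
  refine integral_congr_ae (Eventually.of_forall fun v => ?_)
  simp only [smul_eq_mul, expi]
  congr 2
  push_cast
  ring

theorem continuous_fourier_of_integrable {f : ℝ → ℂ} (hf : Integrable f) : Continuous (𝓕 f) :=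
  VectorFourier.fourierIntegral_continuous Real.continuous_fourierChar
    (by simp only [innerₗ_apply_apply]; fun_prop) hf

theorem norm_fourier_le_integral_norm (f : ℝ → ℂ) (t : ℝ) : ‖𝓕 f t‖ ≤ ∫ v, ‖f v‖ := by
  rw [fourier_eq_integral_expi]
  refine (norm_integral_le_integral_norm _).trans_eq ?_
  simp only [norm_mul, norm_expi, one_mul]

theorem hasDerivAt_expi (l x : ℝ) :
    HasDerivAt (expi l) (2 * Real.pi * Complex.I * l * expi l x) x := by
  have h := ((hasDerivAt_id x).ofReal_comp.const_mul (2 * Real.pi * Complex.I * l : ℂ)).cexp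
  have e : expi l = fun x : ℝ => Complex.exp (2 * Real.pi * Complex.I * l * ((id x : ℝ) : ℂ)) := by
    ext x; simp [expi]
  rw [e]
  convert! h using 1
  push_cast
  ring

/-- Two integrations by parts, with the boundary terms kept so that the two sides of a kink can be
matched. -/
theorem integral_expi_mul_contDiff {H : ℝ → ℂ} (hH : ContDiff ℝ 2 H) {t : ℝ} (ht : t ≠ 0)
    (a b : ℝ) : ∫ x in a..b, expi (-t) x * H x =
      expi (-t) a * (H a / (2 * Real.pi * Complex.I * t) +
        deriv H a / (2 * Real.pi * Complex.I * t) ^ 2) -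
      expi (-t) b * (H b / (2 * Real.pi * Complex.I * t) +
        deriv H b / (2 * Real.pi * Complex.I * t) ^ 2) +
      (∫ x in a..b, expi (-t) x * deriv (deriv H) x) / (2 * Real.pi * Complex.I * t) ^ 2 := by
  set s : ℂ := 2 * Real.pi * Complex.I * t with hs
  have hs0 : s ≠ 0 := by
    have : (t : ℂ) ≠ 0 := by exact_mod_cast ht
    have h2 : (Real.pi : ℂ) ≠ 0 := by exact_mod_cast Real.pi_pos.ne'
    rw [hs]
    simp [this, h2]
  have hd1 : ContDiff ℝ 1 (deriv H) := hH.iterate_deriv' 1 1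
  have hd2 : Continuous (deriv (deriv H)) := hd1.continuous_deriv le_rfl
  have hF : ∀ x, HasDerivAt (fun x => -(expi (-t) x * (H x / s + deriv H x / s ^ 2)))
      (expi (-t) x * H x - expi (-t) x * deriv (deriv H) x / s ^ 2) x := by
    intro x
    have h1 := (hH.differentiable (by norm_num) x).hasDerivAt
    have h2 := (hd1.differentiable (by norm_num) x).hasDerivAt
    have h := ((hasDerivAt_expi (-t) x).mul ((h1.div_const s).add (h2.div_const (s ^ 2)))).neg
    convert! h using 1
    have : (2 * Real.pi * Complex.I * ((-t : ℝ) : ℂ)) = -s := by rw [hs]; push_cast; ring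
    rw [this]
    simp only [Pi.add_apply]
    field_simp
    ring
  have c1 : Continuous fun x => expi (-t) x * H x := (continuous_expi _).mul hH.continuous
  have c2 : Continuous fun x => expi (-t) x * deriv (deriv H) x / s ^ 2 :=
    ((continuous_expi _).mul hd2).div_const _
  have h := intervalIntegral.integral_eq_sub_of_hasDerivAt (a := a) (b := b) (fun x _ => hF x)
    ((c1.sub c2).intervalIntegrable _ _)
  rw [intervalIntegral.integral_sub (c1.intervalIntegrable _ _) (c2.intervalIntegrable _ _),
    intervalIntegral.integral_div, sub_eq_iff_eq_add] at h
  rw [h]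
  ring

theorem HasCompactSupport.exists_bound {H : ℝ → ℂ} (h : HasCompactSupport H) :
    ∃ R : ℝ, 0 < R ∧ ∀ x, R ≤ |x| → x ∉ tsupport H := by
  obtain ⟨R, hR⟩ := h.isCompact.isBounded.subset_closedBall 0
  refine ⟨max R 0 + 1, by positivity, fun x hx hxs => ?_⟩
  have := hR hxs
  rw [mem_closedBall_zero_iff, Real.norm_eq_abs] at this
  linarith [le_max_left R 0]

/-- The Fourier transform of a compactly supported function that is smooth on both closed
half-lines decays quadratically. -/
theorem fourier_le_of_kink {h H₁ H₂ : ℝ → ℂ} (hH₁ : ContDiff ℝ 2 H₁) (hH₂ : ContDiff ℝ 2 H₂)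
    (hc₁ : HasCompactSupport H₁) (hc₂ : HasCompactSupport H₂) (h0 : H₁ 0 = H₂ 0)
    (hpos : ∀ x, 0 ≤ x → h x = H₁ x) (hneg : ∀ x, x ≤ 0 → h x = H₂ x) :
    ∃ C, ∀ t, ‖𝓕 h t‖ ≤ C * (1 + t ^ 2)⁻¹ := by
  obtain ⟨R₁, hR₁, hb₁⟩ := hc₁.exists_bound
  obtain ⟨R₂, hR₂, hb₂⟩ := hc₂.exists_bound
  have z1 : H₁ R₁ = 0 ∧ deriv H₁ R₁ = 0 := by
    have := hb₁ R₁ (le_abs_self _)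
    exact ⟨image_eq_zero_of_notMem_tsupport this, by
      by_contra hne; exact this (support_deriv_subset hne)⟩
  have z2 : H₂ (-R₂) = 0 ∧ deriv H₂ (-R₂) = 0 := by
    have := hb₂ (-R₂) (by rw [abs_neg]; exact le_abs_self _)
    exact ⟨image_eq_zero_of_notMem_tsupport this, by
      by_contra hne; exact this (support_deriv_subset hne)⟩
  have hcont : ∀ t, Continuous fun x => expi (-t) x * H₁ x := fun t =>
    (continuous_expi _).mul hH₁.continuous
  have hcont' : ∀ t, Continuous fun x => expi (-t) x * H₂ x := fun t =>
    (continuous_expi _).mul hH₂.continuous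
  have hsplit : ∀ t, 𝓕 h t = (∫ x in -R₂..0, expi (-t) x * H₂ x) +
      ∫ x in (0 : ℝ)..R₁, expi (-t) x * H₁ x := by
    intro t
    have e1 : ∫ x in -R₂..0, expi (-t) x * H₂ x = ∫ x in -R₂..0, expi (-t) x * h x := by
      refine intervalIntegral.integral_congr fun x hx => ?_
      rw [uIcc_of_le (by linarith)] at hx
      simp only [hneg x hx.2]
    have e2 : ∫ x in (0 : ℝ)..R₁, expi (-t) x * H₁ x = ∫ x in (0 : ℝ)..R₁, expi (-t) x * h x := by
      refine intervalIntegral.integral_congr fun x hx => ?_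
      rw [uIcc_of_le hR₁.le] at hx
      simp only [hpos x hx.1]
    have i1 : IntervalIntegrable (fun x => expi (-t) x * h x) volume (-R₂) 0 := by
      refine ((hcont' t).intervalIntegrable _ _).congr fun x hx => ?_
      rw [uIoc_of_le (by linarith)] at hx
      simp only [hneg x hx.2]
    have i2 : IntervalIntegrable (fun x => expi (-t) x * h x) volume 0 R₁ := by
      refine ((hcont t).intervalIntegrable _ _).congr fun x hx => ?_
      rw [uIoc_of_le hR₁.le] at hx
      simp only [hpos x hx.1.le]
    rw [e1, e2, intervalIntegral.integral_add_adjacent_intervals i1 i2, fourier_eq_integral_expi,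
      intervalIntegral.integral_of_le (by linarith)]
    symm
    refine setIntegral_eq_integral_of_forall_compl_eq_zero fun x hx => ?_
    rw [mem_Ioc, not_and_or, not_lt, not_le] at hx
    rcases hx with hx | hx
    · rw [hneg x (by linarith), image_eq_zero_of_notMem_tsupport
        (hb₂ x (by rw [abs_of_nonpos (by linarith)]; linarith)), mul_zero]
    · rw [hpos x (by linarith), image_eq_zero_of_notMem_tsupport
        (hb₁ x (by rw [abs_of_nonneg (by linarith)]; linarith)), mul_zero]
  set L := (∫ x in -R₂..0, ‖H₂ x‖) + ∫ x in (0 : ℝ)..R₁, ‖H₁ x‖ with hL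
  set K := ‖deriv H₁ 0‖ + ‖deriv H₂ 0‖ + ((∫ x in -R₂..0, ‖deriv (deriv H₂) x‖) +
    ∫ x in (0 : ℝ)..R₁, ‖deriv (deriv H₁) x‖) with hK
  have hbd : ∀ (G : ℝ → ℂ) {a b : ℝ} (_ : a ≤ b) (t : ℝ),
      ‖∫ x in a..b, expi (-t) x * G x‖ ≤ ∫ x in a..b, ‖G x‖ := by
    intro G a b hab t
    refine (intervalIntegral.norm_integral_le_integral_norm hab).trans_eq ?_
    simp only [norm_mul, norm_expi, one_mul]
  have hnR : -R₂ ≤ 0 := by linarith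
  have hK0 : 0 ≤ K := by
    have a1 := intervalIntegral.integral_nonneg (μ := volume) hnR
      fun x _ => norm_nonneg (deriv (deriv H₂) x)
    have a2 := intervalIntegral.integral_nonneg (μ := volume) hR₁.le
      fun x _ => norm_nonneg (deriv (deriv H₁) x)
    positivity
  refine ⟨L + K, fun t => ?_⟩
  have b1 : ‖𝓕 h t‖ ≤ L := by
    rw [hsplit t]
    exact (norm_add_le _ _).trans (add_le_add (hbd H₂ hnR t) (hbd H₁ hR₁.le t))
  have b2 : ‖𝓕 h t‖ * t ^ 2 ≤ K := by
    rcases eq_or_ne t 0 with rfl | ht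
    · simpa using hK0
    rw [hsplit t, integral_expi_mul_contDiff hH₁ ht, integral_expi_mul_contDiff hH₂ ht,
      z1.1, z1.2, z2.1, z2.2, h0, expi_zero_right]
    set s : ℂ := 2 * Real.pi * Complex.I * t with hs
    have hsn : ‖s‖ = 2 * Real.pi * |t| := by
      rw [hs]; simp [abs_of_pos Real.pi_pos]
    -- Continuity at 0 cancels the boundary terms of order 1/s; the jump of the derivative only
    -- contributes at order 1/s².
    have e : ∀ A B : ℂ, (expi (-t) (-R₂) * (0 / s + 0 / s ^ 2) -
        1 * (H₂ 0 / s + deriv H₂ 0 / s ^ 2) + A / s ^ 2) +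
        (1 * (H₂ 0 / s + deriv H₁ 0 / s ^ 2) - expi (-t) R₁ * (0 / s + 0 / s ^ 2) + B / s ^ 2) =
        (deriv H₁ 0 - deriv H₂ 0 + (A + B)) / s ^ 2 := fun A B => by ring
    rw [e, norm_div, norm_pow, hsn, mul_pow, sq_abs]
    have ht2 : 0 < t ^ 2 := by positivity
    have hp : 1 ≤ (2 * Real.pi) ^ 2 := by nlinarith [Real.pi_gt_three]
    rw [div_mul_eq_mul_div, mul_comm ((2 * Real.pi) ^ 2), div_le_iff₀ (by positivity)]
    have hn : ‖deriv H₁ 0 - deriv H₂ 0 + ((∫ x in -R₂..0, expi (-t) x * deriv (deriv H₂) x) +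
        ∫ x in (0 : ℝ)..R₁, expi (-t) x * deriv (deriv H₁) x)‖ ≤ K := by
      refine (norm_add_le _ _).trans (add_le_add (norm_sub_le _ _) ?_)
      exact (norm_add_le _ _).trans (add_le_add (hbd _ hnR t) (hbd _ hR₁.le t))
    calc _ ≤ K * t ^ 2 := mul_le_mul_of_nonneg_right hn ht2.le
      _ ≤ K * (t ^ 2 * (2 * Real.pi) ^ 2) := by
        refine mul_le_mul_of_nonneg_left ?_ hK0
        nlinarith
  rw [← div_eq_mul_inv, le_div_iff₀ (by positivity)]
  linarith

/-! ### Extending the summation formula -/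

/-- Mollify φ by bumps ρ_n. The transform is multiplied by a factor of modulus at most 1 that tends
to 1, so μ is handled by dominated convergence; all supports lie in one compact set, where a is
summable. -/
theorem IsRealAntipodalFSPair.hasSum_of_fourier_le {μ : RealLocFinMeasure} {a : ℝ → ℂ}
    (h : IsRealAntipodalFSPair μ a)
    (hμ : Integrable (fun t : ℝ => (1 + t ^ 2)⁻¹) μ.variation) {φ : ℝ → ℂ} (hφ : Continuous φ)
    (hc : HasCompactSupport φ) {C : ℝ} (hb : ∀ t, ‖𝓕 φ t‖ ≤ C * (1 + t ^ 2)⁻¹) :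
    HasSum (fun l => a l * φ l) (μ.integral (𝓕 φ)) := by
  obtain ⟨R, hR, hsupp⟩ := hc.exists_bound
  have hφz : ∀ x, R ≤ |x| → φ x = 0 := fun x hx => image_eq_zero_of_notMem_tsupport (hsupp x hx)
  obtain ⟨M, hM⟩ := hc.exists_bound_of_continuous hφ
  have hM0 : 0 ≤ M := (norm_nonneg _).trans (hM 0)
  let bump : ℕ → ContDiffBump (0 : ℝ) := fun n =>
    { rIn := 1 / (2 * ((n : ℝ) + 1))
      rOut := 1 / ((n : ℝ) + 1)
      rIn_pos := by positivity
      rIn_lt_rOut := by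
        rw [div_lt_div_iff₀ (by positivity) (by positivity)]
        linarith [n.cast_nonneg (α := ℝ)] }
  have hout : ∀ n, (bump n).rOut ≤ 1 := fun n => by
    change 1 / ((n : ℝ) + 1) ≤ 1
    rw [div_le_one (by positivity)]; linarith [n.cast_nonneg (α := ℝ)]
  have hout0 : Tendsto (fun n => (bump n).rOut) atTop (𝓝 0) := tendsto_one_div_add_atTop_nhds_zero_nat
  set ρ : ℕ → ℝ → ℝ := fun n => (bump n).normed volume with hρ
  have hρ0 : ∀ n x, 0 ≤ ρ n x := fun n x => (bump n).nonneg_normed x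
  have hρc : ∀ n, Continuous (ρ n) := fun n => (bump n).continuous_normed
  have hρs : ∀ n, HasCompactSupport (ρ n) := fun n => (bump n).hasCompactSupport_normed
  have hρi : ∀ n, Integrable (ρ n) := fun n => (hρc n).integrable_of_hasCompactSupport (hρs n)
  have hρ1 : ∀ n, ∫ x, ρ n x = 1 := fun n => (bump n).integral_normed
  have hφi : Integrable φ := hφ.integrable_of_hasCompactSupport hc
  let Φ : ℕ → ℝ → ℂ := fun n => convolution (ρ n) φ (ContinuousLinearMap.lsmul ℝ ℝ) volume
  have hΦ : ∀ n x, Φ n x = ∫ t, ρ n t • φ (x - t) := fun n x => rfl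
  have hΦs : ∀ n, ContDiff ℝ ∞ (Φ n) := fun n =>
    (hρs n).contDiff_convolution_left _ (bump n).contDiff_normed hφ.locallyIntegrable
  have hΦc : ∀ n, HasCompactSupport (Φ n) := fun n => (hρs n).convolution _ hc
  have hΦM : ∀ n x, ‖Φ n x‖ ≤ M := by
    intro n x
    rw [hΦ]
    calc ‖∫ t, ρ n t • φ (x - t)‖ ≤ ∫ t, ρ n t * M := by
          refine norm_integral_le_of_norm_le ((hρi n).mul_const M) (Eventually.of_forall fun t => ?_)
          rw [norm_smul, Real.norm_of_nonneg (hρ0 n t)]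
          exact mul_le_mul_of_nonneg_left (hM _) (hρ0 n t)
      _ = M := by rw [integral_mul_const, hρ1, one_mul]
  have hΦz : ∀ n x, R + 1 ≤ |x| → Φ n x = 0 := by
    intro n x hx
    rw [hΦ]
    refine integral_eq_zero_of_ae (Eventually.of_forall fun t => ?_)
    by_cases ht : |t| < 1
    · have : φ (x - t) = 0 := hφz _ (by linarith [abs_sub_abs_le_abs_sub x t])
      simp [this]
    · have : ρ n t = 0 := by
        by_contra hne
        have h1 : t ∈ Function.support ((bump n).normed volume) := hne
        rw [(bump n).support_normed_eq, mem_ball_zero_iff, Real.norm_eq_abs] at h1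
        exact ht (h1.trans_le (hout n))
      simp [this]
  have hΦlim : ∀ x, Tendsto (fun n => Φ n x) atTop (𝓝 (φ x)) := fun x =>
    ContDiffBump.convolution_tendsto_right_of_continuous hout0 hφ x
  have hF : ∀ n t, 𝓕 (Φ n) t = 𝓕 (fun x => (ρ n x : ℂ)) t * 𝓕 φ t := by
    intro n t
    exact Real.fourier_mul_convolution_eq (R := ℂ) (f₁ := fun x => (ρ n x : ℂ)) (f₂ := φ)
      (hρi n).ofReal hφi t
  have hρF : ∀ n t, ‖𝓕 (fun x => (ρ n x : ℂ)) t‖ ≤ 1 := by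
    intro n t
    refine (norm_fourier_le_integral_norm _ _).trans_eq ?_
    simp only [Complex.norm_real, Real.norm_of_nonneg (hρ0 n _)]
    exact hρ1 n
  have hρlim : ∀ t, Tendsto (fun n => 𝓕 (fun x => (ρ n x : ℂ)) t) atTop (𝓝 1) := by
    intro t
    have h1 := ContDiffBump.convolution_tendsto_right_of_continuous (μ := volume) hout0
      (continuous_expi t) 0
    rw [expi_zero_right] at h1
    refine h1.congr fun n => ?_
    rw [fourier_eq_integral_expi]
    refine integral_congr_ae (Eventually.of_forall fun x => ?_)
    change ρ n x • expi t (0 - x) = expi (-t) x * (ρ n x : ℂ)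
    rw [Complex.real_smul, mul_comm]
    congr 1
    simp [expi]
  have hS : ∀ n, HasSum (fun l => a l * Φ n l) (μ.integral (𝓕 (Φ n))) := fun n =>
    h.summation _ (hΦs n) (hΦc n)
  have hleft : Tendsto (fun n => μ.integral (𝓕 (Φ n))) atTop (𝓝 (μ.integral (𝓕 φ))) := by
    refine RealLocFinMeasure.tendsto_integral_of_dominated (hμ.const_mul C)
      (Eventually.of_forall fun n => continuous_fourier_of_integrable
        ((hΦs n).continuous.integrable_of_hasCompactSupport (hΦc n)))
      (Eventually.of_forall fun n t => ?_) fun t => ?_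
    · rw [hF, norm_mul]
      exact (mul_le_of_le_one_left (norm_nonneg _) (hρF n t)).trans (hb t)
    · simp only [hF]
      simpa using (hρlim t).mul_const (𝓕 φ t)
  have hbs : Summable fun l => M * (Icc (-(R + 1)) (R + 1)).indicator (fun l => ‖a l‖) l :=
    (h.locallySummable.2 (R + 1) (by linarith)).mul_left M
  have hdom : ∀ g : ℝ → ℂ, (∀ x, ‖g x‖ ≤ M) → (∀ x, R + 1 ≤ |x| → g x = 0) → ∀ l,
      ‖a l * g l‖ ≤ M * (Icc (-(R + 1)) (R + 1)).indicator (fun l => ‖a l‖) l := by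
    intro g hg hgz l
    by_cases hl : R + 1 ≤ |l|
    · rw [hgz l hl, mul_zero, norm_zero]
      exact mul_nonneg hM0 (indicator_nonneg (fun _ _ => norm_nonneg _) _)
    · rw [indicator_of_mem (show l ∈ Icc (-(R + 1)) (R + 1) from abs_le.1 (not_le.1 hl).le),
        norm_mul, mul_comm]
      exact mul_le_mul_of_nonneg_right (hg l) (norm_nonneg _)
  have hright := tendsto_tsum_of_dominated_convergence (f := fun n l => a l * Φ n l) hbs
    (fun l => (hΦlim l).const_mul (a l)) (Eventually.of_forall fun n => hdom _ (hΦM n) (hΦz n))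
  have hsum : Summable fun l => a l * φ l :=
    hbs.of_norm_bounded (hdom φ hM fun x hx => hφz x (by linarith))
  have := tendsto_nhds_unique hleft (hright.congr fun n => (hS n).tsum_eq)
  rw [this]
  exact hsum.hasSum

/-! ### The Fejér test functions -/

/-- `e^{2πilz}` for `l ≥ 0` and `e^{2πil w̄}` for `l < 0`, times the tent of half-width `T`. -/
def fejerTent (T : ℝ) (z w : ℂ) (l : ℝ) : ℂ :=
  (if 0 ≤ l then Complex.exp (2 * Real.pi * Complex.I * l * z)
    else Complex.exp (2 * Real.pi * Complex.I * l * conj w)) * ((max (1 - |l| / T) 0 : ℝ) : ℂ)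

theorem continuous_fejerTent (T : ℝ) (z w : ℂ) : Continuous (fejerTent T z w) := by
  refine Continuous.mul ?_ (by fun_prop)
  refine Continuous.if_le (by fun_prop) (by fun_prop) continuous_const continuous_id ?_
  rintro x rfl
  simp

theorem fejerTent_eq_zero {T : ℝ} (hT : 0 < T) (z w : ℂ) {l : ℝ} (hl : T ≤ |l|) :
    fejerTent T z w l = 0 := by
  have : max (1 - |l| / T) 0 = 0 := by
    rw [max_eq_right]; rw [sub_nonpos, le_div_iff₀ hT]; linarith
  rw [fejerTent, this]
  simp

theorem hasCompactSupport_fejerTent {T : ℝ} (hT : 0 < T) (z w : ℂ) :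
    HasCompactSupport (fejerTent T z w) := by
  refine HasCompactSupport.intro (isCompact_Icc (a := -T) (b := T)) fun l hl => ?_
  refine fejerTent_eq_zero hT z w ?_
  by_contra h
  exact hl (abs_le.1 (not_le.1 h).le)

theorem fejerTent_of_nonneg {T : ℝ} (hT : 0 < T) (z w : ℂ) {l : ℝ} (hl : 0 ≤ l) (hlT : l ≤ T) :
    fejerTent T z w l = Complex.exp (2 * Real.pi * Complex.I * l * z) * (1 - l / T) := by
  have : max (1 - |l| / T) 0 = 1 - l / T := by
    rw [abs_of_nonneg hl, max_eq_left]; rw [sub_nonneg, div_le_iff₀ hT]; linarith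
  rw [fejerTent, if_pos hl, this]
  push_cast
  rfl

theorem fejerTent_of_neg {T : ℝ} (hT : 0 < T) (z w : ℂ) {l : ℝ} (hl : l < 0) (hlT : -T ≤ l) :
    fejerTent T z w l = Complex.exp (2 * Real.pi * Complex.I * l * conj w) * (1 + l / T) := by
  have : max (1 - |l| / T) 0 = 1 + l / T := by
    rw [abs_of_neg hl, max_eq_left]
    · ring
    · rw [sub_nonneg, div_le_iff₀ hT]; linarith
  rw [fejerTent, if_neg hl.not_ge, this]
  push_cast
  rfl

/-- The Fourier integral of the right half of a Fejér tent. -/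
def fejerHalf (T : ℝ) (u : ℂ) : ℂ :=
  ∫ l in (0 : ℝ)..T, Complex.exp (2 * Real.pi * Complex.I * l * u) * (1 - l / T)

theorem two_pi_I_mul_ne_zero {u : ℂ} (hu : u ≠ 0) : 2 * Real.pi * Complex.I * u ≠ 0 := by
  have h2 : (Real.pi : ℂ) ≠ 0 := by exact_mod_cast Real.pi_pos.ne'
  simp [hu, h2]

theorem fejerHalf_eq {T : ℝ} (hT : 0 < T) {u : ℂ} (hu : u ≠ 0) :
    fejerHalf T u = -1 / (2 * Real.pi * Complex.I * u) +
      (Complex.exp (2 * Real.pi * Complex.I * u * T) - 1) /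
        ((2 * Real.pi * Complex.I * u) ^ 2 * T) := by
  set s := 2 * Real.pi * Complex.I * u with hs
  have hs0 : s ≠ 0 := two_pi_I_mul_ne_zero hu
  have hT0 : (T : ℂ) ≠ 0 := by exact_mod_cast hT.ne'
  have hF : ∀ l : ℝ, HasDerivAt
      (fun l : ℝ => Complex.exp (s * l) * ((1 - l / T) / s + 1 / (s ^ 2 * T)))
      (Complex.exp (2 * Real.pi * Complex.I * l * u) * (1 - l / T)) l := by
    intro l
    have h1 : HasDerivAt (fun l : ℝ => Complex.exp (s * l)) (Complex.exp (s * l) * (s * 1)) l :=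
      ((hasDerivAt_id l).ofReal_comp.const_mul s).cexp
    have h2 : HasDerivAt (fun l : ℝ => ((1 - (l : ℂ) / T) / s + 1 / (s ^ 2 * T)))
        (-(1 / T) / s) l := by
      have := ((((hasDerivAt_id l).ofReal_comp.div_const (T : ℂ)).const_sub 1).div_const s).add_const
        (1 / (s ^ 2 * T))
      simpa using this
    convert! h1.mul h2 using 1
    have : 2 * Real.pi * Complex.I * l * u = s * l := by rw [hs]; ring
    rw [this]
    field_simp
    ring
  have h := intervalIntegral.integral_eq_sub_of_hasDerivAt (a := 0) (b := T) (fun x _ => hF x)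
    ((by fun_prop : Continuous fun l : ℝ =>
      Complex.exp (2 * Real.pi * Complex.I * l * u) * (1 - l / T)).intervalIntegrable _ _)
  rw [fejerHalf, h]
  simp only [Complex.ofReal_zero, mul_zero, Complex.exp_zero]
  field_simp
  ring

theorem norm_fejerHalf_sub_le {T : ℝ} (hT : 0 < T) {u : ℂ} (hu : 0 < u.im) :
    ‖fejerHalf T u - -1 / (2 * Real.pi * Complex.I * u)‖ ≤ T⁻¹ * (‖u‖ ^ 2)⁻¹ := by
  have hu0 : u ≠ 0 := by rintro rfl; simp at hu
  have hn : 0 < ‖u‖ := norm_pos_iff.2 hu0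
  rw [fejerHalf_eq hT hu0, add_sub_cancel_left, norm_div, norm_mul, norm_pow]
  have h1 : ‖2 * Real.pi * Complex.I * u‖ = 2 * Real.pi * ‖u‖ := by
    simp [abs_of_pos Real.pi_pos]
  have h2 : ‖Complex.exp (2 * Real.pi * Complex.I * u * T) - 1‖ ≤ 2 := by
    refine (norm_sub_le _ _).trans ?_
    rw [Complex.norm_exp, norm_one]
    have : (2 * Real.pi * Complex.I * u * T).re = -(2 * Real.pi * u.im * T) := by simp
    rw [this]
    have : Real.exp (-(2 * Real.pi * u.im * T)) ≤ 1 :=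
      Real.exp_le_one_iff.2 (by have := Real.pi_pos; have : 0 ≤ 2 * Real.pi * u.im * T := by positivity
                                linarith)
    linarith
  rw [h1, Complex.norm_real, Real.norm_of_nonneg hT.le, div_le_iff₀ (by have := Real.pi_pos; positivity)]
  refine h2.trans ?_
  have : T⁻¹ * (‖u‖ ^ 2)⁻¹ * ((2 * Real.pi * ‖u‖) ^ 2 * T) = (2 * Real.pi) ^ 2 := by
    field_simp
  rw [this]
  nlinarith [Real.pi_gt_three]

theorem fourier_fejerTent {T : ℝ} (hT : 0 < T) (z w : ℂ) (t : ℝ) :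
    𝓕 (fejerTent T z w) t = fejerHalf T (z - t) + conj (fejerHalf T (w - t)) := by
  have hc : Continuous fun l => expi (-t) l * fejerTent T z w l :=
    (continuous_expi _).mul (continuous_fejerTent T z w)
  have e1 : ∫ l in (0 : ℝ)..T, expi (-t) l * fejerTent T z w l = fejerHalf T (z - t) := by
    refine intervalIntegral.integral_congr fun l hl => ?_
    rw [uIcc_of_le hT.le] at hl
    rw [fejerTent_of_nonneg hT z w hl.1 hl.2, ← mul_assoc, expi, ← Complex.exp_add]
    congr 2
    push_cast
    ring
  have e2 : ∫ l in -T..0, expi (-t) l * fejerTent T z w l = conj (fejerHalf T (w - t)) := by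
    have h1 := intervalIntegral.integral_comp_neg (a := 0) (b := T)
      fun l => expi (-t) l * fejerTent T z w l
    rw [neg_zero] at h1
    rw [← h1, fejerHalf, intervalIntegral.integral_of_le hT.le, intervalIntegral.integral_of_le hT.le,
      ← integral_conj]
    refine setIntegral_congr_fun measurableSet_Ioc fun l hl => ?_
    rw [fejerTent_of_neg hT z w (by linarith [hl.1]) (by linarith [hl.2]), ← mul_assoc, expi,
      ← Complex.exp_add, map_mul, ← Complex.exp_conj]
    congr 2
    · simp only [map_mul, map_ofNat, Complex.conj_ofReal, Complex.conj_I, map_sub]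
      push_cast
      ring
    · simp
      ring
  rw [fourier_eq_integral_expi, ← e1, ← e2, add_comm,
    intervalIntegral.integral_add_adjacent_intervals (hc.intervalIntegrable _ _)
      (hc.intervalIntegrable _ _), intervalIntegral.integral_of_le (by linarith)]
  symm
  refine setIntegral_eq_integral_of_forall_compl_eq_zero fun l hl => ?_
  rw [fejerTent_eq_zero hT, mul_zero]
  by_contra h
  have := abs_lt.1 (not_le.1 h)
  exact hl ⟨this.1, this.2.le⟩

/-- The leading terms of the two halves, -1/(2πi(z-t)) and the conjugate of -1/(2πi(w-t)), combine
by partial fractions into the kernel. The remainders carry 1/T and quadratic decay in t. -/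
theorem norm_fourier_fejerTent_sub_le {T : ℝ} (hT : 0 < T) {z w : ℂ} (hz : 0 < z.im)
    (hw : 0 < w.im) (t : ℝ) :
    ‖𝓕 (fejerTent T z w) t - 1 / (2 * Real.pi * Complex.I) * ((z - conj w) * cauchyKer z w t)‖ ≤
      T⁻¹ * (cauchyConst z ^ 2 + cauchyConst w ^ 2) * (1 + t ^ 2)⁻¹ := by
  have hzt : 0 < (z - t).im := by simpa using hz
  have hwt : 0 < (w - t).im := by simpa using hw
  have e : 1 / (2 * Real.pi * Complex.I) * ((z - conj w) * cauchyKer z w t) =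
      -1 / (2 * Real.pi * Complex.I * (z - t)) + conj (-1 / (2 * Real.pi * Complex.I * (w - t))) := by
    have h1 := sub_ofReal_ne_zero hz t
    have h2 := conj_sub_ofReal_ne_zero hw t
    have h3 : (Real.pi : ℂ) ≠ 0 := by exact_mod_cast Real.pi_pos.ne'
    rw [cauchyKer_mul_sub hz hw]
    simp only [map_div₀, map_neg, map_one, map_mul, map_ofNat, Complex.conj_ofReal, Complex.conj_I,
      map_sub]
    field_simp
    ring
  rw [fourier_fejerTent hT, e, add_sub_add_comm, ← map_sub]
  refine (norm_add_le _ _).trans ?_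
  rw [RCLike.norm_conj]
  have b1 := norm_fejerHalf_sub_le hT hzt
  have b2 := norm_fejerHalf_sub_le hT hwt
  have k1 := inv_norm_mul_le hz hz t
  have k2 := inv_norm_mul_le hw hw t
  have hTi : 0 ≤ T⁻¹ := by positivity
  rw [← mul_inv, ← sq] at k1 k2
  nlinarith [mul_le_mul_of_nonneg_left k1 hTi, mul_le_mul_of_nonneg_left k2 hTi]

theorem exists_fourier_fejerTent_le {T : ℝ} (hT : 0 < T) {z w : ℂ} (hz : 0 < z.im)
    (hw : 0 < w.im) : ∃ C, ∀ t, ‖𝓕 (fejerTent T z w) t‖ ≤ C * (1 + t ^ 2)⁻¹ := by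
  refine ⟨T⁻¹ * (cauchyConst z ^ 2 + cauchyConst w ^ 2) +
    ‖1 / (2 * Real.pi * Complex.I) * (z - conj w)‖ * (cauchyConst z * cauchyConst w), fun t => ?_⟩
  have h1 := norm_fourier_fejerTent_sub_le hT hz hw t
  have h2 := norm_cauchyKer_le hz hw t
  rw [← mul_assoc] at h1
  have h3 := norm_le_norm_sub_add (𝓕 (fejerTent T z w) t)
    (1 / (2 * Real.pi * Complex.I) * (z - conj w) * cauchyKer z w t)
  rw [norm_mul _ (cauchyKer z w t)] at h3
  have h4 := mul_le_mul_of_nonneg_left h2 (norm_nonneg (1 / (2 * Real.pi * Complex.I) * (z - conj w)))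
  linarith

/-! ### Fejér sums of a summation pair -/

theorem norm_exp_two_pi (l : ℝ) (z : ℂ) :
    ‖Complex.exp (2 * Real.pi * Complex.I * l * z)‖ = Real.exp (-(2 * Real.pi * z.im) * l) := by
  rw [Complex.norm_exp]
  congr 1
  simp
  ring

theorem norm_exp_two_pi_le_one {l : ℝ} (hl : 0 ≤ l) {z : ℂ} (hz : 0 ≤ z.im) :
    ‖Complex.exp (2 * Real.pi * Complex.I * l * z)‖ ≤ 1 := by
  rw [norm_exp_two_pi, Real.exp_le_one_iff]
  have := Real.pi_pos
  have : 0 ≤ 2 * Real.pi * z.im * l := by positivity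
  linarith

theorem LocallySummable.summable_fejer {a : ℝ → ℂ} (ha : LocallySummable a) {T : ℝ} (hT : 0 < T)
    {z : ℂ} (hz : 0 < z.im) : Summable ((Ioo 0 T).indicator fun l : ℝ =>
      a l * ((1 - l / T : ℝ) : ℂ) * Complex.exp (2 * Real.pi * Complex.I * l * z)) := by
  refine (ha.2 T hT).of_norm_bounded fun l => ?_
  by_cases hl : l ∈ Ioo 0 T
  · rw [indicator_of_mem hl, indicator_of_mem (show l ∈ Icc (-T) T from ⟨by linarith [hl.1], hl.2.le⟩),
      norm_mul, norm_mul]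
    have h1 := norm_exp_two_pi_le_one hl.1.le hz.le
    have h2 : ‖((1 - l / T : ℝ) : ℂ)‖ ≤ 1 := by
      rw [Complex.norm_real, Real.norm_eq_abs, abs_le]
      have : 0 ≤ l / T := div_nonneg hl.1.le hT.le
      have : l / T ≤ 1 := (div_le_one hT).2 hl.2.le
      constructor <;> linarith
    calc _ ≤ ‖a l‖ * 1 * 1 := by gcongr
      _ = ‖a l‖ := by ring
  · rw [indicator_of_notMem hl, norm_zero]
    exact indicator_nonneg (fun _ _ => norm_nonneg _) _

/-- Antipodality turns the negative half of the sum into the conjugate of the Fejér sum at w, and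
makes a(0) real, so that it splits into two equal halves. -/
theorem fejerSum_add_conj {a : ℝ → ℂ} (ha : LocallySummable a) (hanti : ∀ l, a (-l) = conj (a l))
    {T : ℝ} (hT : 0 < T) {z w : ℂ} (hz : 0 < z.im) (hw : 0 < w.im) :
    HasSum (fun l => a l * fejerTent T z w l)
      ((a 0 / 2 + fejerSum a T z) + conj (a 0 / 2 + fejerSum a T w)) := by
  have h0 := hasSum_ite_eq (0 : ℝ) (a 0)
  have h1 := (ha.summable_fejer hT hz).hasSum
  have h2 := Complex.hasSum_conj'.2 (ha.summable_fejer hT hw).hasSum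
  have h3 := (Equiv.neg ℝ).hasSum_iff.2 h2
  have ha0 : conj (a 0) = a 0 := by rw [← hanti 0, neg_zero]
  have h := (h1.add h3).add h0
  convert! h using 1
  · ext l
    simp only [Function.comp_apply, Equiv.neg_apply]
    rcases lt_trichotomy l 0 with hl | rfl | hl
    · rw [if_neg hl.ne, indicator_of_notMem (by simp [hl.le]), zero_add, add_zero]
      by_cases hlT : -T < l
      · rw [indicator_of_mem (show -l ∈ Ioo 0 T from ⟨by linarith, by linarith⟩),
          fejerTent_of_neg hT z w hl hlT.le]
        rw [map_mul, map_mul, hanti, Complex.conj_conj, Complex.conj_ofReal, ← Complex.exp_conj]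
        have : conj (2 * Real.pi * Complex.I * ((-l : ℝ) : ℂ) * w) =
            2 * Real.pi * Complex.I * l * conj w := by
          simp only [map_mul, map_ofNat, Complex.conj_ofReal, Complex.conj_I]
          push_cast
          ring
        rw [this]
        push_cast
        ring
      · rw [fejerTent_eq_zero hT z w (by rw [abs_of_neg hl]; linarith),
          indicator_of_notMem (fun h => hlT (by linarith [h.2]))]
        simp
    · simp [fejerTent]
    · rw [if_neg hl.ne', indicator_of_notMem (s := Ioo 0 T) (a := -l)
        (fun h => by linarith [h.1]), map_zero, add_zero, add_zero]
      by_cases hlT : l < T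
      · rw [indicator_of_mem (show l ∈ Ioo 0 T from ⟨hl, hlT⟩), fejerTent_of_nonneg hT z w hl.le hlT.le]
        push_cast
        ring
      · rw [fejerTent_eq_zero hT z w (by rw [abs_of_pos hl]; linarith),
          indicator_of_notMem (fun h => hlT h.2), mul_zero]
  · rw [map_add, map_div₀, ha0, map_ofNat]
    unfold fejerSum
    ring

theorem tendsto_fejerSum {a : ℝ → ℂ} {c : ℝ} (hc : Summable fun l : ℝ => ‖a l‖ * Real.exp (-c * |l|))
    {z : ℂ} (hz : c ≤ 2 * Real.pi * z.im) : Tendsto (fun T => fejerSum a T z) atTop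
      (𝓝 (∑' l : ℝ, (Ioi 0).indicator
        (fun l : ℝ => a l * Complex.exp (2 * Real.pi * Complex.I * l * z)) l)) := by
  refine tendsto_tsum_of_dominated_convergence hc (fun l => ?_) ?_
  · by_cases hl : 0 < l
    · rw [indicator_of_mem (mem_Ioi.2 hl)]
      have h1 : Tendsto (fun T : ℝ => a l * ((1 - l / T : ℝ) : ℂ) *
          Complex.exp (2 * Real.pi * Complex.I * l * z)) atTop
          (𝓝 (a l * ((1 - 0 : ℝ) : ℂ) * Complex.exp (2 * Real.pi * Complex.I * l * z))) := by
        refine Tendsto.mul_const _ (Tendsto.const_mul _ ?_)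
        exact (Complex.continuous_ofReal.tendsto _).comp
          (tendsto_const_nhds.sub (tendsto_const_nhds.div_atTop tendsto_id))
      rw [sub_zero, Complex.ofReal_one, mul_one] at h1
      refine h1.congr' ?_
      filter_upwards [eventually_gt_atTop l] with T hT
      rw [indicator_of_mem (show l ∈ Ioo 0 T from ⟨hl, hT⟩)]
    · rw [indicator_of_notMem (by simpa using hl)]
      refine tendsto_const_nhds.congr fun T => ?_
      rw [indicator_of_notMem (fun h => hl h.1)]
  · filter_upwards [eventually_gt_atTop 0] with T hT l
    by_cases hl : l ∈ Ioo 0 T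
    · rw [indicator_of_mem hl, norm_mul, norm_mul, norm_exp_two_pi]
      have h2 : ‖((1 - l / T : ℝ) : ℂ)‖ ≤ 1 := by
        rw [Complex.norm_real, Real.norm_eq_abs, abs_le]
        have : 0 ≤ l / T := div_nonneg hl.1.le hT.le
        have : l / T ≤ 1 := (div_le_one hT).2 hl.2.le
        constructor <;> linarith
      have h3 : Real.exp (-(2 * Real.pi * z.im) * l) ≤ Real.exp (-c * |l|) := by
        rw [Real.exp_le_exp, abs_of_pos hl.1]
        nlinarith [hl.1]
      calc _ ≤ ‖a l‖ * 1 * Real.exp (-c * |l|) := by gcongr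
        _ = _ := by ring
    · rw [indicator_of_notMem hl, norm_zero]
      positivity

/-- The Fejér sums of a summation pair converge to a function satisfying the kernel identity. -/
theorem IsRealAntipodalFSPair.exists_limit {μ : RealLocFinMeasure} {a : ℝ → ℂ}
    (h : IsRealAntipodalFSPair μ a) (hμ : Integrable (fun t : ℝ => (1 + t ^ 2)⁻¹) μ.variation)
    {c : ℝ} (hc0 : 0 < c) (hc : Summable fun l : ℝ => ‖a l‖ * Real.exp (-c * |l|)) :
    ∃ f : ℂ → ℂ, DifferentiableOn ℂ f upperHalf ∧
      TendstoOnCompacts (fun T z => a 0 / 2 + fejerSum a T z) f ∧ KernelIdentity f μ ∧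
      ∀ z : ℂ, c ≤ 2 * Real.pi * z.im → f z = a 0 / 2 + ∑' l : ℝ, (Ioi 0).indicator
        (fun l : ℝ => a l * Complex.exp (2 * Real.pi * Complex.I * l * z)) l := by
  set S : ℝ → ℂ → ℂ := fun T z => a 0 / 2 + fejerSum a T z with hS
  set L : ℂ → ℂ → ℂ := fun z w =>
    1 / (2 * Real.pi * Complex.I) * ((z - conj w) * μ.integral (cauchyKer z w)) with hL
  set W := ∫ t, (1 + t ^ 2)⁻¹ ∂μ.variation with hW
  have hW0 : 0 ≤ W := integral_nonneg fun t => by positivity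
  have key : ∀ T : ℝ, 0 < T → ∀ z w : ℂ, 0 < z.im → 0 < w.im →
      ‖S T z + conj (S T w) - L z w‖ ≤ T⁻¹ * (cauchyConst z ^ 2 + cauchyConst w ^ 2) * W := by
    intro T hT z w hz hw
    obtain ⟨C, hC⟩ := exists_fourier_fejerTent_le hT hz hw
    have h1 := h.hasSum_of_fourier_le hμ (continuous_fejerTent T z w)
      (hasCompactSupport_fejerTent hT z w) hC
    have h2 := (fejerSum_add_conj h.locallySummable h.antipodal hT hz hw).unique h1
    have hi1 : Integrable (𝓕 (fejerTent T z w)) μ.variation :=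
      Continuous.integrable_of_le_inv_one_add_sq hμ (continuous_fourier_of_integrable
        ((continuous_fejerTent T z w).integrable_of_hasCompactSupport
          (hasCompactSupport_fejerTent hT z w))) hC
    have hi2 : Integrable (fun t => 1 / (2 * Real.pi * Complex.I) *
        ((z - conj w) * cauchyKer z w t)) μ.variation :=
      ((integrable_cauchyKer hz hw hμ).const_mul _).const_mul _
    have e : S T z + conj (S T w) - L z w = μ.integral fun t => 𝓕 (fejerTent T z w) t -
        1 / (2 * Real.pi * Complex.I) * ((z - conj w) * cauchyKer z w t) := by
      rw [RealLocFinMeasure.integral_sub' hi1 hi2, RealLocFinMeasure.integral_const_mul',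
        RealLocFinMeasure.integral_const_mul', ← h2]
    rw [e, hW, ← MeasureTheory.integral_const_mul]
    exact RealLocFinMeasure.norm_integral_le (hμ.const_mul _)
      fun t => norm_fourier_fejerTent_sub_le hT hz hw t
  have hpt : ∀ z w : ℂ, 0 < z.im → 0 < w.im →
      Tendsto (fun T => S T z + conj (S T w)) atTop (𝓝 (L z w)) := by
    intro z w hz hw
    rw [tendsto_iff_norm_sub_tendsto_zero]
    have h0 : Tendsto (fun T : ℝ => T⁻¹ * (cauchyConst z ^ 2 + cauchyConst w ^ 2) * W) atTop
        (𝓝 0) := by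
      have := (tendsto_inv_atTop_zero (𝕜 := ℝ)).mul_const
        ((cauchyConst z ^ 2 + cauchyConst w ^ 2) * W)
      rw [zero_mul] at this
      simpa only [mul_assoc] using this
    refine squeeze_zero' (Eventually.of_forall fun T => norm_nonneg _) ?_ h0
    filter_upwards [eventually_gt_atTop 0] with T hT using key T hT z w hz hw
  -- Here 2π Im z₀ = c, so the growth hypothesis gives absolute convergence at z₀.
  set z₀ : ℂ := (c / (2 * Real.pi) : ℝ) * Complex.I with hz₀
  have him : z₀.im = c / (2 * Real.pi) := by
    rw [hz₀, Complex.im_ofReal_mul, Complex.I_im, mul_one]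
  have hz₀' : 0 < z₀.im := by rw [him]; have := Real.pi_pos; positivity
  have hlim0 := tendsto_fejerSum hc (z := z₀) (by
    rw [him]; have := Real.pi_pos; field_simp; rfl)
  obtain ⟨s, hs⟩ : ∃ s, Tendsto (fun T => S T z₀) atTop (𝓝 s) := ⟨_, hlim0.const_add _⟩
  -- Convergence at z₀ spreads to every z, since S_T(z) = (S_T(z) + conj S_T(z₀)) - conj S_T(z₀).
  set f : ℂ → ℂ := fun z => L z z₀ - conj s with hf
  have hconj : ∀ {g : ℝ → ℂ} {m : ℂ}, Tendsto g atTop (𝓝 m) →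
      Tendsto (fun T => conj (g T)) atTop (𝓝 (conj m)) := fun hg =>
    (Complex.continuous_conj.tendsto _).comp hg
  have hfl : ∀ z : ℂ, 0 < z.im → Tendsto (fun T => S T z) atTop (𝓝 (f z)) := by
    intro z hz
    refine ((hpt z z₀ hz hz₀').sub (hconj hs)).congr fun T => ?_
    ring
  have hKI : KernelIdentity f μ := by
    rw [kernelIdentity_iff]
    intro z hz w hw
    exact tendsto_nhds_unique ((hfl z hz).add (hconj (hfl w hw))) (hpt z w hz hw)
  obtain ⟨κ, hκ⟩ := hKI.exists_eq_herglotz_add hμ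
  refine ⟨f, ((differentiableOn_herglotz hμ).add_const (κ * Complex.I)).congr hκ, ?_, hKI, ?_⟩
  · intro K hK hKU
    have hcK : ContinuousOn cauchyConst K := by
      have : ∀ z ∈ K, z.im ≠ 0 := fun z hz => (hKU hz).ne'
      unfold cauchyConst
      exact continuousOn_const.add (ContinuousOn.div (by fun_prop)
        Complex.continuous_im.continuousOn this)
    obtain ⟨A, hA⟩ := (hK.image_of_continuousOn hcK).isBounded.exists_norm_le
    have hA' : ∀ z ∈ K, cauchyConst z ^ 2 ≤ A ^ 2 := fun z hz => by
      have := hA _ (mem_image_of_mem _ hz)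
      rw [Real.norm_eq_abs] at this
      exact sq_le_sq' (by linarith [abs_le.1 this]) (abs_le.1 this).2
    rw [Metric.tendstoUniformlyOn_iff]
    intro ε hε
    have h0 : Tendsto (fun T : ℝ => T⁻¹ * ((A ^ 2 + cauchyConst z₀ ^ 2) * W)) atTop (𝓝 0) := by
      have := (tendsto_inv_atTop_zero (𝕜 := ℝ)).mul_const ((A ^ 2 + cauchyConst z₀ ^ 2) * W)
      rwa [zero_mul] at this
    filter_upwards [h0.eventually_lt_const (half_pos hε), Metric.tendsto_nhds.1 hs _ (half_pos hε),
      eventually_gt_atTop 0] with T h1 h2 hT z hz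
    have e : S T z - f z = (S T z + conj (S T z₀) - L z z₀) - conj (S T z₀ - s) := by
      rw [hf, map_sub]; ring
    rw [dist_comm, dist_eq_norm]
    change ‖S T z - f z‖ < ε
    rw [e]
    refine (norm_sub_le _ _).trans_lt ?_
    rw [RCLike.norm_conj, ← dist_eq_norm (S T z₀)]
    have h3 := key T hT z z₀ (hKU hz) hz₀'
    have h4 : T⁻¹ * (cauchyConst z ^ 2 + cauchyConst z₀ ^ 2) * W ≤
        T⁻¹ * ((A ^ 2 + cauchyConst z₀ ^ 2) * W) := by
      rw [mul_assoc]
      have := hA' z hz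
      gcongr
    linarith
  · intro z hz
    have hzi : 0 < z.im := by
      have : 0 < 2 * Real.pi * z.im := hc0.trans_le hz
      have hp := Real.pi_pos
      by_contra hn
      nlinarith
    exact tendsto_nhds_unique (hfl z hzi) ((tendsto_fejerSum hc hz).const_add _)

/-! ### Absolutely convergent exponential series -/

theorem IsAP.finset_sum {ι : Type*} {g : ι → ℝ → ℂ} (s : Finset ι) (h : ∀ i ∈ s, IsAP (g i)) :
    IsAP fun x => ∑ i ∈ s, g i x := by
  classical
  induction s using Finset.induction_on with
  | empty => simpa using IsAP.const 0
  | insert i s hi ih =>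
    simp only [Finset.sum_insert hi]
    exact (h i (Finset.mem_insert_self i s)).add
      (ih fun j hj => h j (Finset.mem_insert_of_mem hj))

theorem HasMean.finset_sum {ι : Type*} {g : ι → ℝ → ℂ} {M : ι → ℂ} (s : Finset ι)
    (hc : ∀ i ∈ s, Continuous (g i)) (h : ∀ i ∈ s, HasMean (g i) (M i)) :
    HasMean (fun x => ∑ i ∈ s, g i x) (∑ i ∈ s, M i) := by
  classical
  induction s using Finset.induction_on with
  | empty => simpa using hasMean_const 0
  | insert i s hi ih =>
    simp only [Finset.sum_insert hi]
    have h1 := h i (Finset.mem_insert_self i s)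
    have h2 := ih (fun j hj => hc j (Finset.mem_insert_of_mem hj))
      fun j hj => h j (Finset.mem_insert_of_mem hj)
    have c2 : Continuous fun x => ∑ j ∈ s, g j x :=
      continuous_finsetSum _ fun j hj => hc j (Finset.mem_insert_of_mem hj)
    have := h1.sub (h2.const_mul (-1)) (hc i (Finset.mem_insert_self i s)) (c2.const_smul (-1 : ℂ))
    simpa only [neg_one_mul, sub_neg_eq_add] using this

theorem HasMean.of_uniform_approx {g : ℝ → ℂ} {M : ℂ} (hg : Continuous g)
    (h : ∀ ε : ℝ, 0 < ε → ∃ k : ℝ → ℂ, Continuous k ∧ HasMean k M ∧ ∀ x, ‖g x - k x‖ ≤ ε) :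
    HasMean g M := by
  intro ε hε
  obtain ⟨k, hk, hkM, hgk⟩ := h (ε / 2) (by positivity)
  obtain ⟨T₀, hT₀, hT⟩ := hkM (ε / 2) (by positivity)
  refine ⟨T₀, hT₀, fun T hTT a => ?_⟩
  have h1 := norm_ivlAvg_sub_le hg hk hgk (hT₀.trans_le hTT) a
  have h2 := hT T hTT a
  have h3 := norm_sub_le_norm_sub_add_norm_sub (ivlAvg g T a) (ivlAvg k T a) M
  linarith

theorem HasMean.tendsto_symm {g : ℝ → ℂ} {M : ℂ} (h : HasMean g M) :
    Tendsto (fun T : ℝ => 1 / (2 * T : ℂ) * ∫ x in (-T)..T, g x) atTop (𝓝 M) := by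
  have h1 := (h.tendsto fun S => -S / 2).comp (tendsto_id.const_mul_atTop (two_pos (α := ℝ)))
  refine h1.congr fun T => ?_
  simp only [Function.comp_apply, id, ivlAvg]
  have e1 : -(2 * T) / 2 = -T := by ring
  have e2 : -T + 2 * T = T := by ring
  rw [e1, e2, one_div]
  push_cast
  rfl

/-- The exponential series `∑ A(l) e^{2πilx}`. -/
def expSeries (A : ℝ → ℂ) (x : ℝ) : ℂ := ∑' l : ℝ, A l * expi l x

theorem summable_expSeries {A : ℝ → ℂ} (hA : Summable fun l => ‖A l‖) (x : ℝ) :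
    Summable fun l => A l * expi l x :=
  hA.of_norm_bounded fun l => by rw [norm_mul, norm_expi, mul_one]

theorem exists_finset_tsum_compl_lt {b : ℝ → ℝ} (hb : Summable b) (F₀ : Finset ℝ)
    {ε : ℝ} (hε : 0 < ε) :
    ∃ F : Finset ℝ, F₀ ⊆ F ∧ ∑' l : ↑((F : Set ℝ)ᶜ), b l ≤ ε := by
  classical
  have h := hb.hasSum
  rw [HasSum, Metric.tendsto_nhds] at h
  obtain ⟨F, hF⟩ := (h ε hε).exists_forall_of_atTop
  refine ⟨F ∪ F₀, Finset.subset_union_right, ?_⟩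
  have h1 := hF (F ∪ F₀) Finset.subset_union_left
  have h2 := hb.sum_add_tsum_compl (s := F ∪ F₀)
  rw [Real.dist_eq, ← h2, abs_lt] at h1
  linarith [h1.1]

theorem norm_expSeries_sub_sum_le {A : ℝ → ℂ} (hA : Summable fun l => ‖A l‖) (F : Finset ℝ)
    (x : ℝ) : ‖expSeries A x - ∑ l ∈ F, A l * expi l x‖ ≤ ∑' l : ↑((F : Set ℝ)ᶜ), ‖A l‖ := by
  have h := (summable_expSeries hA x).sum_add_tsum_compl (s := F)
  have hs : Summable fun l : ↑((F : Set ℝ)ᶜ) => ‖A l‖ := hA.subtype _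
  rw [expSeries, ← h, add_sub_cancel_left]
  refine (norm_tsum_le_tsum_norm ?_).trans_eq ?_
  · refine hs.congr fun l => ?_
    rw [norm_mul, norm_expi, mul_one]
  · simp only [norm_mul, norm_expi, mul_one]

theorem isAP_expSeries {A : ℝ → ℂ} (hA : Summable fun l => ‖A l‖) : IsAP (expSeries A) := by
  have hfin : ∀ F : Finset ℝ, IsAP fun x => ∑ l ∈ F, A l * expi l x := fun F =>
    IsAP.finset_sum F fun l _ => (IsAP.const (A l)).mul (isAP_expi l)
  have hc : Continuous (expSeries A) := continuous_tsum (fun l => by fun_prop) hA fun l x => by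
    rw [norm_mul, norm_expi, mul_one]
  refine IsAP.of_uniform_approx (fun ε hε => ?_) hc
  obtain ⟨F, -, hF⟩ := exists_finset_tsum_compl_lt hA ∅ hε
  exact ⟨_, hfin F, fun x => (norm_expSeries_sub_sum_le hA F x).trans hF⟩

theorem hasMean_expSeries_mul {A : ℝ → ℂ} (hA : Summable fun l => ‖A l‖) (θ : ℝ) :
    HasMean (fun x => expSeries A x * expi (-θ) x) (A θ) := by
  classical
  refine HasMean.of_uniform_approx
    ((isAP_expSeries hA).continuous.mul (continuous_expi _)) fun ε hε => ?_
  obtain ⟨F, hF0, hF⟩ := exists_finset_tsum_compl_lt hA {θ} hε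
  refine ⟨fun x => ∑ l ∈ F, A l * expi (l - θ) x, by fun_prop, ?_, fun x => ?_⟩
  · have h := HasMean.finset_sum (g := fun l x => A l * expi (l - θ) x)
      (M := fun l => A l * if l = θ then 1 else 0) F (fun l _ => by fun_prop) fun l _ => by
        refine HasMean.const_mul ?_ (A l)
        split_ifs with hl
        · rw [hl, sub_self]
          have e0 : expi 0 = fun _ => 1 := funext expi_zero_left
          rw [e0]
          exact hasMean_const 1
        · exact hasMean_expi (sub_ne_zero.2 hl)
    simpa [hF0 (Finset.mem_singleton_self θ)] using h
  · have e : ∑ l ∈ F, A l * expi (l - θ) x = (∑ l ∈ F, A l * expi l x) * expi (-θ) x := by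
      rw [Finset.sum_mul]
      refine Finset.sum_congr rfl fun l _ => ?_
      rw [mul_assoc, expi_mul_expi, sub_eq_add_neg]
    beta_reduce
    rw [e, ← sub_mul, norm_mul, norm_expi, mul_one]
    exact (norm_expSeries_sub_sum_le hA F x).trans hF

theorem exists_relativelyDense_tsum_le {b : ℝ → ℝ} (hb : Summable b) (hb0 : ∀ l, 0 ≤ b l)
    {ε : ℝ} (hε : 0 < ε) : ∃ τ : Set ℝ, RelativelyDense τ ∧
      ∀ t ∈ τ, ∑' l, b l * ‖expi l t - 1‖ ≤ ε := by
  obtain ⟨F, -, hF⟩ := exists_finset_tsum_compl_lt hb ∅ (ε := ε / 4) (by positivity)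
  have hS0 : 0 ≤ ∑' l, b l := tsum_nonneg hb0
  -- Only the finitely many characters in F need common almost periods; the tail is estimated
  -- trivially by |e^{2πilt} - 1| ≤ 2.
  obtain ⟨τ, hτ, hτF⟩ := exists_relativelyDense_expi F (ε := ε / (2 * (1 + ∑' l, b l)))
    (by positivity)
  refine ⟨τ, hτ, fun t ht => ?_⟩
  have h2 : ∀ l, ‖expi l t - 1‖ ≤ 2 := fun l => by
    refine (norm_sub_le _ _).trans ?_
    rw [norm_expi, norm_one]; norm_num
  have hs : Summable fun l => b l * ‖expi l t - 1‖ :=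
    (hb.mul_right 2).of_nonneg_of_le (fun l => mul_nonneg (hb0 l) (norm_nonneg _))
      fun l => mul_le_mul_of_nonneg_left (h2 l) (hb0 l)
  rw [← hs.sum_add_tsum_compl (s := F)]
  have h3 : ∑ l ∈ F, b l * ‖expi l t - 1‖ ≤ ε / 2 := by
    calc ∑ l ∈ F, b l * ‖expi l t - 1‖ ≤ ∑ l ∈ F, b l * (ε / (2 * (1 + ∑' l, b l))) :=
          Finset.sum_le_sum fun l hl => mul_le_mul_of_nonneg_left (hτF t ht l hl) (hb0 l)
      _ = (∑ l ∈ F, b l) * (ε / (2 * (1 + ∑' l, b l))) := by rw [Finset.sum_mul]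
      _ ≤ (1 + ∑' l, b l) * (ε / (2 * (1 + ∑' l, b l))) := by
          refine mul_le_mul_of_nonneg_right ?_ (by positivity)
          linarith [hb.sum_le_tsum F fun l _ => hb0 l]
      _ = ε / 2 := by field_simp
  have h4 : ∑' l : ↑((F : Set ℝ)ᶜ), b l * ‖expi l t - 1‖ ≤ ε / 2 := by
    calc _ ≤ ∑' l : ↑((F : Set ℝ)ᶜ), b l * 2 :=
          (hs.subtype _).tsum_le_tsum (fun l => mul_le_mul_of_nonneg_left (h2 l) (hb0 l))
            ((hb.mul_right 2).subtype _)
      _ = (∑' l : ↑((F : Set ℝ)ᶜ), b l) * 2 := tsum_mul_right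
      _ ≤ ε / 2 := by linarith
  linarith

/-! ### Almost periodicity and bounded coefficients of the limit -/

/-- One majorant ‖a(l)‖e^{-c|l|} dominates the series above height k, so a single set of almost
periods serves the whole shifted half-plane. -/
theorem isAlmostPeriodicH_of_eq_tsum {f : ℂ → ℂ} {a : ℝ → ℂ} {c k : ℝ} {k₀ : ℂ}
    (hf : DifferentiableOn ℂ f upperHalf) (hk : 0 < k) (hck : c ≤ 2 * Real.pi * k)
    (hc : Summable fun l : ℝ => ‖a l‖ * Real.exp (-c * |l|))
    (h : ∀ z : ℂ, c ≤ 2 * Real.pi * z.im → f z = k₀ + ∑' l : ℝ, (Ioi 0).indicator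
        (fun l : ℝ => a l * Complex.exp (2 * Real.pi * Complex.I * l * z)) l) :
    IsAlmostPeriodicH fun z => f (z + k * Complex.I) := by
  have hpi := Real.pi_pos
  refine ⟨hf.comp (by fun_prop) fun z hz => ?_, fun α β ε hα hαβ hε => ?_⟩
  · change 0 < (z + k * Complex.I).im
    have : 0 < z.im := hz
    simp
    linarith
  obtain ⟨τ, hτ, hτ'⟩ := exists_relativelyDense_tsum_le hc
    (fun l => mul_nonneg (norm_nonneg _) (Real.exp_pos _).le) hε
  refine ⟨τ, hτ, fun t ht z hz _ => ?_⟩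
  have him : ∀ w : ℂ, w.im = z.im + k → c ≤ 2 * Real.pi * w.im := fun w hw => by
    rw [hw]
    nlinarith
  set b : ℝ → ℝ := fun l => ‖a l‖ * Real.exp (-c * |l|) with hb
  have hterm : ∀ w : ℂ, w.im = z.im + k → ∀ l, ‖(Ioi 0).indicator (fun l : ℝ =>
      a l * Complex.exp (2 * Real.pi * Complex.I * l * w)) l‖ ≤ b l := by
    intro w hw l
    by_cases hl : 0 < l
    · rw [indicator_of_mem (mem_Ioi.2 hl), norm_mul, norm_exp_two_pi]
      refine mul_le_mul_of_nonneg_left ?_ (norm_nonneg _)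
      rw [Real.exp_le_exp, abs_of_pos hl]
      have := him w hw
      nlinarith
    · rw [indicator_of_notMem (by simpa using hl), norm_zero]
      positivity
  have i1 : (z + k * Complex.I).im = z.im + k := by simp
  have i2 : (z + t + k * Complex.I).im = z.im + k := by simp
  have s1 : Summable _ := hc.of_norm_bounded (hterm _ i1)
  have s2 : Summable _ := hc.of_norm_bounded (hterm _ i2)
  have hs : Summable fun l => b l * ‖expi l t - 1‖ := by
    refine (hc.mul_right 2).of_nonneg_of_le (fun l => by positivity) fun l => ?_
    refine mul_le_mul_of_nonneg_left ?_ (by positivity)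
    refine (norm_sub_le _ _).trans ?_
    rw [norm_expi, norm_one]; norm_num
  simp only
  rw [h _ (him _ i1), h _ (him _ i2), add_sub_add_left_eq_sub, ← s1.tsum_sub s2]
  refine (tsum_of_norm_bounded hs.hasSum fun l => ?_).trans (hτ' t ht)
  have e : (Ioi 0).indicator (fun l : ℝ =>
      a l * Complex.exp (2 * Real.pi * Complex.I * l * (z + t + k * Complex.I))) l =
      (Ioi 0).indicator (fun l : ℝ =>
      a l * Complex.exp (2 * Real.pi * Complex.I * l * (z + k * Complex.I))) l * expi l t := by
    by_cases hl : 0 < l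
    · rw [indicator_of_mem (mem_Ioi.2 hl), indicator_of_mem (mem_Ioi.2 hl), mul_assoc (a l), expi,
        ← Complex.exp_add]
      congr 2
      ring
    · rw [indicator_of_notMem (by simpa using hl), indicator_of_notMem (by simpa using hl), zero_mul]
  rw [e, ← mul_one_sub, norm_mul, norm_sub_rev 1]
  exact mul_le_mul_of_nonneg_right (hterm _ i1 l) (norm_nonneg _)

theorem conj_trigPoly {N : ℕ} (θ : Fin N → ℝ) (p : Fin N → ℂ) (x : ℝ) :
    conj (trigPoly θ p x) = ∑ n, conj (p n) * expi (-θ n) x := by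
  rw [trigPoly, map_sum]
  refine Finset.sum_congr rfl fun n _ => ?_
  rw [map_mul, ← conj_expi, expi]

theorem hasMean_mul_conj_trigPoly {g : ℝ → ℂ} (hg : Continuous g) {M : ℝ → ℂ}
    (h : ∀ θ, HasMean (fun x => g x * expi (-θ) x) (M θ)) {N : ℕ} (θ : Fin N → ℝ)
    (p : Fin N → ℂ) :
    HasMean (fun x => g x * conj (trigPoly θ p x)) (∑ n, conj (p n) * M (θ n)) := by
  have := HasMean.finset_sum (g := fun n x => conj (p n) * (g x * expi (-θ n) x)) Finset.univ
    (fun n _ => by fun_prop) fun n _ => (h (θ n)).const_mul (conj (p n))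
  convert this using 2 with x
  rw [conj_trigPoly, Finset.mul_sum]
  refine Finset.sum_congr rfl fun n _ => ?_
  ring

/-- The mean equals ∑ conj(p_n) A(θ_n), and distinct frequencies make ∑ ‖A(θ_n)‖ a partial sum of
the ℓ¹ norm. The added 1 keeps the constant positive. -/
theorem boundedCoeffs_of_eq_expSeries {f : ℂ → ℂ} {A : ℝ → ℂ} {k : ℝ}
    (hA : Summable fun l => ‖A l‖) (h : ∀ x : ℝ, f (x + k * Complex.I) = expSeries A x) :
    BoundedCoeffs f k (1 + ∑' l, ‖A l‖) := by
  intro N θ p hθ _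
  have hm := (hasMean_mul_conj_trigPoly (isAP_expSeries hA).continuous
    (hasMean_expSeries_mul hA) θ p).tendsto_symm.norm
  simp only [h]
  have hlim := ((continuous_coe_real_ereal.tendsto _).comp hm).limsup_eq
  refine hlim.trans_le (EReal.coe_le_coe_iff.2 ?_)
  have hbdd : BddAbove (range fun n => ‖p n‖) := (finite_range _).bddAbove
  have hsup : 0 ≤ ⨆ n, ‖p n‖ := Real.iSup_nonneg fun n => norm_nonneg _
  calc ‖∑ n, conj (p n) * A (θ n)‖ ≤ ∑ n, (⨆ n, ‖p n‖) * ‖A (θ n)‖ := by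
        refine (norm_sum_le _ _).trans (Finset.sum_le_sum fun n _ => ?_)
        rw [norm_mul, RCLike.norm_conj]
        exact mul_le_mul_of_nonneg_right (le_ciSup hbdd n) (norm_nonneg _)
    _ = (⨆ n, ‖p n‖) * ∑ l ∈ Finset.univ.map ⟨θ, hθ⟩, ‖A l‖ := by
        rw [Finset.mul_sum, Finset.sum_map]; rfl
    _ ≤ (⨆ n, ‖p n‖) * (1 + ∑' l, ‖A l‖) := by
        refine mul_le_mul_of_nonneg_left ?_ hsup
        linarith [hA.sum_le_tsum (Finset.univ.map ⟨θ, hθ⟩) fun l _ => norm_nonneg _]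
    _ = _ := mul_comm _ _

/-- The direct part of the theorem. -/
theorem IsRealAntipodalFSPair.exists_holomorphic {μ : RealLocFinMeasure} {a : ℝ → ℂ}
    (h : IsRealAntipodalFSPair μ a) (hdeg : μ.degree ≤ 2) (ha : HasExpGrowth a) :
    ∃ f : ℂ → ℂ, DifferentiableOn ℂ f upperHalf ∧
      TendstoOnCompacts (fun T z => a 0 / 2 + fejerSum a T z) f ∧
      ConditionsIIandIII f ∧ ConditionIV f := by
  have hμ := (degree_le_two_iff μ).1 hdeg
  obtain ⟨c, hc0, hc⟩ := ha
  obtain ⟨f, hf, hlim, hKI, hfs⟩ := h.exists_limit hμ hc0 hc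
  have hpi := Real.pi_pos
  set k := c / (2 * Real.pi) with hk
  have hk0 : 0 < k := by positivity
  have hck : c = 2 * Real.pi * k := by rw [hk]; field_simp
  -- These are the Fourier coefficients of f on the line Im z = k, where e^{2πilz} has modulus
  -- e^{-cl} for l > 0.
  set A : ℝ → ℂ := fun l => if l = 0 then a 0 / 2 else
    (Ioi 0).indicator (fun l : ℝ => a l * (Real.exp (-c * |l|) : ℂ)) l with hA
  have hAs : Summable fun l => ‖A l‖ := by
    refine hc.of_nonneg_of_le (fun l => norm_nonneg _) fun l => ?_
    simp only [hA]
    split_ifs with hl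
    · rw [hl]
      simp
    · by_cases hl : 0 < l
      · rw [indicator_of_mem (mem_Ioi.2 hl), norm_mul, Complex.norm_real,
          Real.norm_of_nonneg (Real.exp_pos _).le]
      · rw [indicator_of_notMem (by simpa using hl), norm_zero]
        positivity
  have hS0 : 0 ≤ ∑' l, ‖A l‖ := tsum_nonneg fun l => norm_nonneg _
  refine ⟨f, hf, hlim, ⟨k, hk0, isAlmostPeriodicH_of_eq_tsum hf hk0 hck.le hc hfs, k,
    1 + ∑' l, ‖A l‖, hk0, by linarith, le_rfl,
    boundedCoeffs_of_eq_expSeries hAs fun x => ?_⟩, hKI.conditionIV hμ⟩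
  have him : (x + k * Complex.I : ℂ).im = k := by simp
  rw [hfs _ (by rw [him]; exact hck.le), expSeries,
    (summable_expSeries hAs x).tsum_eq_add_tsum_ite 0]
  congr 1
  · simp [hA]
  · refine tsum_congr fun l => ?_
    split_ifs with hl
    · rw [hl, indicator_of_notMem (by simp)]
    · simp only [hA, if_neg hl]
      by_cases hl : 0 < l
      · rw [indicator_of_mem (mem_Ioi.2 hl), indicator_of_mem (mem_Ioi.2 hl), mul_assoc (a l), expi,
          Complex.ofReal_exp, ← Complex.exp_add]
        congr 2
        rw [abs_of_pos hl, hck]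
        push_cast
        linear_combination (2 * Real.pi * l * k : ℂ) * Complex.I_mul_I
      · rw [indicator_of_notMem (by simpa using hl), indicator_of_notMem (by simpa using hl),
          zero_mul]

/-! ### Gaussian means -/

/-- The Gaussian average of `G` at scale `R`. -/
def gaussMean (R : ℝ) (G : ℝ → ℂ) : ℂ := ∫ u : ℝ, G (R * u) * (Real.exp (-Real.pi * u ^ 2) : ℂ)

theorem integrable_gauss : Integrable fun u : ℝ => Real.exp (-Real.pi * u ^ 2) :=
  integrable_exp_neg_mul_sq Real.pi_pos

theorem integral_gauss : ∫ u : ℝ, Real.exp (-Real.pi * u ^ 2) = 1 := by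
  rw [integral_gaussian, div_self Real.pi_pos.ne', Real.sqrt_one]

theorem gauss_le (u : ℝ) : (1 + u ^ 2) ^ 2 * Real.exp (-Real.pi * u ^ 2) ≤ 1 := by
  have h1 : 1 + u ^ 2 ≤ Real.exp (u ^ 2) := by linarith [Real.add_one_le_exp (u ^ 2)]
  have h2 : (1 + u ^ 2) ^ 2 ≤ Real.exp (u ^ 2) ^ 2 := pow_le_pow_left₀ (by positivity) h1 2
  rw [← Real.exp_nat_mul] at h2
  calc _ ≤ Real.exp ((2 : ℕ) * u ^ 2) * Real.exp (-Real.pi * u ^ 2) := by gcongr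
    _ = Real.exp ((2 - Real.pi) * u ^ 2) := by rw [← Real.exp_add]; congr 1; push_cast; ring
    _ ≤ 1 := by
      rw [Real.exp_le_one_iff]
      nlinarith [Real.pi_gt_three, sq_nonneg u]

theorem one_add_sq_mul_gauss_le (u : ℝ) :
    (1 + u ^ 2) * Real.exp (-Real.pi * u ^ 2) ≤ (1 + u ^ 2)⁻¹ := by
  rw [← one_div, le_div_iff₀ (by positivity)]
  have := gauss_le u
  nlinarith

theorem integrable_of_le_one_add_sq_gauss {g : ℝ → ℂ} (hg : Continuous g) {C : ℝ} (hC : 0 ≤ C)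
    (h : ∀ u, ‖g u‖ ≤ C * ((1 + u ^ 2) * Real.exp (-Real.pi * u ^ 2))) : Integrable g :=
  Continuous.integrable_of_le_inv_one_add_sq integrable_inv_one_add_sq hg (C := C) fun u =>
    (h u).trans (mul_le_mul_of_nonneg_left (one_add_sq_mul_gauss_le u) hC)

theorem integrable_gaussMean {G : ℝ → ℂ} (hG : Continuous G) {C : ℝ}
    (h : ∀ x, ‖G x‖ ≤ C * (1 + x ^ 2)) {R : ℝ} (hR : 1 ≤ R) :
    Integrable fun u : ℝ => G (R * u) * (Real.exp (-Real.pi * u ^ 2) : ℂ) := by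
  have hC : 0 ≤ C := by
    have := (norm_nonneg _).trans (h 0)
    simpa using this
  refine integrable_of_le_one_add_sq_gauss (by fun_prop) (C := C * R ^ 2) (by positivity)
    fun u => ?_
  rw [norm_mul, Complex.norm_real, Real.norm_of_nonneg (Real.exp_pos _).le, ← mul_assoc]
  refine mul_le_mul_of_nonneg_right ((h _).trans ?_) (Real.exp_pos _).le
  rw [mul_assoc]
  refine mul_le_mul_of_nonneg_left ?_ hC
  nlinarith [sq_nonneg u]

theorem hasDerivAt_gauss (u : ℝ) : HasDerivAt (fun u : ℝ => Real.exp (-Real.pi * u ^ 2))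
    (-(2 * Real.pi * u * Real.exp (-Real.pi * u ^ 2))) u := by
  have h := ((hasDerivAt_pow 2 u).const_mul (-Real.pi)).exp
  convert! h using 1
  push_cast
  ring

/-- Integration by parts turns the left side into k plus 2b times the Gaussian integral over [0, N],
which is at most 1/2. -/
theorem linear_gauss_le {b k : ℝ} (hb : 0 ≤ b) {N : ℝ} (hN : 0 ≤ N) :
    (2 * b * N + k) * Real.exp (-Real.pi * N ^ 2) +
      ∫ u in (0 : ℝ)..N, (2 * b * u + k) * (2 * Real.pi * u * Real.exp (-Real.pi * u ^ 2)) ≤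
      b + k := by
  have h := intervalIntegral.integral_mul_deriv_eq_deriv_mul (a := 0) (b := N)
    (u := fun u => 2 * b * u + k) (v := fun u : ℝ => Real.exp (-Real.pi * u ^ 2))
    (u' := fun _ => 2 * b * 1) (v' := fun u => -(2 * Real.pi * u * Real.exp (-Real.pi * u ^ 2)))
    (fun u _ => ((hasDerivAt_id u).const_mul (2 * b)).add_const k) (fun u _ => hasDerivAt_gauss u)
    (by simp) (by apply Continuous.intervalIntegrable; fun_prop)
  simp only [mul_neg, intervalIntegral.integral_neg] at h
  have h1 : ∫ u in (0 : ℝ)..N, 2 * b * 1 * Real.exp (-Real.pi * u ^ 2) ≤ b := by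
    rw [intervalIntegral.integral_const_mul]
    have e : ∫ u in (0 : ℝ)..N, Real.exp (-Real.pi * u ^ 2) =
        ∫ u in -N..0, Real.exp (-Real.pi * u ^ 2) := by
      have := intervalIntegral.integral_comp_neg (a := -N) (b := 0)
        fun u : ℝ => Real.exp (-Real.pi * u ^ 2)
      simp only [neg_sq, neg_zero, neg_neg] at this
      exact this.symm
    have hi := integrable_gauss
    have h2 := intervalIntegral.integral_add_adjacent_intervals (a := -N) (b := 0) (c := N)
      hi.intervalIntegrable hi.intervalIntegrable
    have h3 : ∫ u in -N..N, Real.exp (-Real.pi * u ^ 2) ≤ 1 := by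
      rw [intervalIntegral.integral_of_le (by linarith), ← integral_gauss]
      exact setIntegral_le_integral hi (Eventually.of_forall fun u => (Real.exp_pos _).le)
    have h4 : ∫ u in (0 : ℝ)..N, Real.exp (-Real.pi * u ^ 2) ≤ 1 / 2 := by linarith
    nlinarith
  have h0 : Real.exp (-Real.pi * 0 ^ 2) = 1 := by simp
  rw [h0] at h
  linarith

/-- A Gaussian is a superposition of symmetric intervals: integrating by parts against u ↦
∫_{-u}^{u} G reduces the estimate to the interval bounds. -/
theorem norm_truncated_gaussMean_le {G : ℝ → ℂ} (hG : Continuous G) {b k : ℝ} (hb : 0 ≤ b)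
    (h : ∀ u, 0 ≤ u → ‖∫ v in -u..u, G v‖ ≤ 2 * b * u + k) {N : ℝ}
    (hN : 0 ≤ N) :
    ‖∫ u in -N..N, G u * (Real.exp (-Real.pi * u ^ 2) : ℂ)‖ ≤ b + k := by
  set w : ℝ → ℂ := fun u => (Real.exp (-Real.pi * u ^ 2) : ℂ) with hw
  have hwc : Continuous w := by fun_prop
  set Φ : ℝ → ℂ := fun u => ∫ v in -u..u, G v with hΦ
  have hsplit : ∀ g : ℝ → ℂ, Continuous g → ∀ u, ∫ v in -u..u, g v =
      ∫ v in (0 : ℝ)..u, (g v + g (-v)) := by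
    intro g hg u
    have e := intervalIntegral.integral_comp_neg (a := 0) (b := u) g
    rw [neg_zero] at e
    have hgn : Continuous fun v => g (-v) := by fun_prop
    rw [intervalIntegral.integral_add (hg.intervalIntegrable _ _) (hgn.intervalIntegrable _ _)]
    have := intervalIntegral.integral_add_adjacent_intervals (a := -u) (b := 0) (c := u)
      (hg.intervalIntegrable (μ := volume) _ _) (hg.intervalIntegrable _ _)
    rw [← this]
    have e' : ∫ x in (0 : ℝ)..u, g (-x) = ∫ x in -u..0, g x := e
    rw [e', add_comm]
  have hgc : Continuous fun v => G v + G (-v) := by fun_prop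
  have hΦd : ∀ u, HasDerivAt Φ (G u + G (-u)) u := by
    intro u
    have e : Φ = fun u => ∫ v in (0 : ℝ)..u, (G v + G (-v)) := funext fun u => hsplit G hG u
    rw [e]
    exact intervalIntegral.integral_hasDerivAt_right (hgc.intervalIntegrable _ _)
      (hgc.stronglyMeasurableAtFilter _ _) hgc.continuousAt
  have hΦc : Continuous Φ := continuous_iff_continuousAt.2 fun u => (hΦd u).continuousAt
  have hibp := intervalIntegral.integral_mul_deriv_eq_deriv_mul (a := 0) (b := N)
    (u := Φ) (v := w) (u' := fun u => G u + G (-u))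
    (v' := fun u => ((-(2 * Real.pi * u * Real.exp (-Real.pi * u ^ 2)) : ℝ) : ℂ))
    (fun u _ => hΦd u) (fun u _ => (hasDerivAt_gauss u).ofReal_comp)
    (hgc.intervalIntegrable _ _) (by apply Continuous.intervalIntegrable; fun_prop)
  have hΦ0 : Φ 0 = 0 := by simp [hΦ]
  have e1 : ∫ u in -N..N, G u * w u = ∫ u in (0 : ℝ)..N, (G u + G (-u)) * w u := by
    rw [hsplit (fun u => G u * w u) (hG.mul hwc)]
    refine intervalIntegral.integral_congr fun u _ => ?_
    have : w (-u) = w u := by simp [hw]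
    simp only [this, add_mul]
  rw [hΦ0, zero_mul, sub_zero] at hibp
  have e2 : ∫ u in -N..N, G u * w u = Φ N * w N - ∫ u in (0 : ℝ)..N, Φ u *
      ((-(2 * Real.pi * u * Real.exp (-Real.pi * u ^ 2)) : ℝ) : ℂ) := by
    rw [e1, hibp]; ring
  have hwN : ‖w N‖ = Real.exp (-Real.pi * N ^ 2) := by
    rw [hw, Complex.norm_real, Real.norm_of_nonneg (Real.exp_pos _).le]
  rw [e2]
  refine (norm_sub_le _ _).trans ((add_le_add ?_ ?_).trans (linear_gauss_le hb hN))
  · rw [norm_mul, hwN]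
    exact mul_le_mul_of_nonneg_right (h N hN) (Real.exp_pos _).le
  · refine intervalIntegral.norm_integral_le_of_norm_le hN
      (Eventually.of_forall fun u hu => ?_) (by apply Continuous.intervalIntegrable; fun_prop)
    have hu0 : 0 ≤ u := hu.1.le
    rw [norm_mul, Complex.norm_real, norm_neg, Real.norm_of_nonneg
      (by have := Real.pi_pos; positivity)]
    exact mul_le_mul_of_nonneg_right (h u hu0) (by have := Real.pi_pos; positivity)

/-- Bounds on interval means for T ≥ T₀ pass to Gaussian means. Short intervals cost a fixed amount
2T₀M, which rescaling by R turns into K/R. -/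
theorem exists_norm_gaussMean_le {G : ℝ → ℂ} (hG : Continuous G) {C : ℝ}
    (hC : ∀ x, ‖G x‖ ≤ C * (1 + x ^ 2)) {b T₀ : ℝ} (hb : 0 ≤ b) (hT₀ : 0 < T₀)
    (h : ∀ T, T₀ ≤ T → ‖∫ x in -T..T, G x‖ ≤ 2 * b * T) :
    ∃ K, ∀ R, 1 ≤ R → ‖gaussMean R G‖ ≤ b + K / R := by
  obtain ⟨M, hM⟩ := (isCompact_Icc (a := -T₀) (b := T₀)).exists_bound_of_continuousOn hG.continuousOn
  have hM0 : 0 ≤ M := (norm_nonneg _).trans (hM 0 ⟨by linarith, hT₀.le⟩)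
  have hall : ∀ T, 0 ≤ T → ‖∫ x in -T..T, G x‖ ≤ 2 * b * T + 2 * T₀ * M := by
    intro T hT
    rcases le_total T₀ T with hTT | hTT
    · have := h T hTT
      have : 0 ≤ 2 * T₀ * M := by positivity
      linarith
    · have h1 := intervalIntegral.norm_integral_le_of_norm_le_const (a := -T) (b := T) (f := G)
        (C := M) fun x hx => by
          rw [uIoc_of_le (by linarith)] at hx
          exact hM x ⟨by linarith [hx.1], by linarith [hx.2]⟩
      have h2 : |T - -T| = 2 * T := by rw [abs_of_nonneg (by linarith)]; ring
      rw [h2] at h1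
      have : M * (2 * T) ≤ 2 * T₀ * M := by nlinarith
      have : 0 ≤ 2 * b * T := by positivity
      linarith
  refine ⟨2 * T₀ * M, fun R hR => ?_⟩
  have hR0 : 0 < R := by linarith
  have hi := integrable_gaussMean hG hC hR
  have hlim := intervalIntegral_tendsto_integral hi tendsto_neg_atTop_atBot tendsto_id
  refine le_of_tendsto hlim.norm ?_
  filter_upwards [eventually_ge_atTop 0] with N hN
  refine norm_truncated_gaussMean_le (G := fun u => G (R * u)) (by fun_prop) hb (fun u hu => ?_) hN
  rw [intervalIntegral.integral_comp_mul_left G hR0.ne', norm_smul, norm_inv,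
    Real.norm_of_nonneg hR0.le, mul_neg]
  have := hall (R * u) (by positivity)
  rw [inv_mul_le_iff₀ hR0]
  refine this.trans_eq ?_
  field_simp

theorem HasMean.tendsto_gaussMean {G : ℝ → ℂ} (hG : Continuous G) {C : ℝ} (hC : ∀ x, ‖G x‖ ≤ C)
    {M : ℂ} (h : HasMean G M) : Tendsto (fun R => gaussMean R G) atTop (𝓝 M) := by
  have hC0 : 0 ≤ C := (norm_nonneg _).trans (hC 0)
  rw [Metric.tendsto_nhds]
  intro ε hε
  obtain ⟨T₀, hT₀, hT⟩ := h (ε / 2) (by positivity)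
  have hbd : ∀ x, ‖G x - M‖ ≤ (C + ‖M‖) * (1 + x ^ 2) := fun x => by
    have h1 := _root_.norm_sub_le (G x) M
    have h2 := hC x
    have h3 := norm_nonneg M
    nlinarith [mul_nonneg (add_nonneg hC0 h3) (sq_nonneg x)]
  obtain ⟨K, hK⟩ := exists_norm_gaussMean_le (G := fun x => G x - M) (by fun_prop) hbd
    (b := ε / 2) (by positivity) hT₀ fun T hTT => by
      have hT0 : 0 < T := hT₀.trans_le hTT
      have h1 := hT (2 * T) (by linarith) (-T)
      have h2 : ivlAvg G (2 * T) (-T) - M = ivlAvg (fun x => G x - M) (2 * T) (-T) := by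
        rw [ivlAvg_sub hG continuous_const, ivlAvg_const M (by positivity)]
      rw [h2, ivlAvg, norm_mul, norm_inv, Complex.norm_real, Real.norm_of_nonneg (by positivity),
        inv_mul_le_iff₀ (by positivity)] at h1
      have e : -T + 2 * T = T := by ring
      rw [e] at h1
      linarith
  have hK0 : Tendsto (fun R : ℝ => K / R) atTop (𝓝 0) := tendsto_const_nhds.div_atTop tendsto_id
  filter_upwards [eventually_ge_atTop 1, hK0.eventually_lt_const (half_pos hε)] with R hR hKR
  have hi1 := integrable_gaussMean hG (C := C) (fun x => (hC x).trans (by nlinarith [sq_nonneg x])) hR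
  have e : gaussMean R G - M = gaussMean R fun x => G x - M := by
    have hM' : ∫ u : ℝ, M * (Real.exp (-Real.pi * u ^ 2) : ℂ) = M := by
      rw [MeasureTheory.integral_const_mul, integral_complex_ofReal, integral_gauss]; simp
    have hi2 : Integrable fun u : ℝ => M * (Real.exp (-Real.pi * u ^ 2) : ℂ) :=
      (integrable_gauss.ofReal (𝕜 := ℂ)).const_mul M
    simp only [gaussMean, sub_mul]
    rw [MeasureTheory.integral_sub hi1 hi2, hM']
  rw [dist_eq_norm, e]
  linarith [hK R hR]

/-- Shifting a line of integration inside a strip. -/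
theorem integral_line_eq_of_strip {h : ℂ → ℂ} {s : ℝ} (hs : 0 ≤ s)
    (hd : ∀ z : ℂ, 0 ≤ z.im → z.im ≤ s → DifferentiableAt ℂ h z) {C : ℝ}
    (hC : ∀ z : ℂ, 0 ≤ z.im → z.im ≤ s → ‖h z‖ ≤ C * (1 + z.re ^ 2)⁻¹) :
    ∫ x : ℝ, h x = ∫ x : ℝ, h (x + s * Complex.I) := by
  have hint : ∀ y : ℝ, 0 ≤ y → y ≤ s → Integrable fun x : ℝ => h (x + y * Complex.I) := by
    intro y hy hys
    have him : ∀ x : ℝ, (x + y * Complex.I : ℂ).im = y := fun x => by simp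
    have hre : ∀ x : ℝ, (x + y * Complex.I : ℂ).re = x := fun x => by simp
    refine Continuous.integrable_of_le_inv_one_add_sq integrable_inv_one_add_sq (C := C) ?_
      fun x => ?_
    · refine continuous_iff_continuousAt.2 fun x => ?_
      have h1 : ContinuousAt h (x + y * Complex.I) :=
        (hd _ (by rw [him]; exact hy) (by rw [him]; exact hys)).continuousAt
      exact ContinuousAt.comp (f := fun x : ℝ => (x + y * Complex.I : ℂ)) h1 (by fun_prop)
    · have := hC (x + y * Complex.I) (by rw [him]; exact hy) (by rw [him]; exact hys)
      rwa [hre] at this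
  have i0 := hint 0 le_rfl hs
  have i1 := hint s hs le_rfl
  simp only [Complex.ofReal_zero, zero_mul, add_zero] at i0
  have l0 := intervalIntegral_tendsto_integral i0 tendsto_neg_atTop_atBot tendsto_id
  have l1 := intervalIntegral_tendsto_integral i1 tendsto_neg_atTop_atBot tendsto_id
  have hrect : ∀ N : ℝ, (∫ x in -N..N, h x) - (∫ x in -N..N, h (x + s * Complex.I)) =
      Complex.I * (∫ y in (0 : ℝ)..s, h (((-N : ℝ) : ℂ) + y * Complex.I)) -
      Complex.I * ∫ y in (0 : ℝ)..s, h (N + y * Complex.I) := by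
    intro N
    have := Complex.integral_boundary_rect_eq_zero_of_differentiableOn h
      (((-N : ℝ) : ℂ)) (N + s * Complex.I) (by
        intro z hz
        rw [Complex.mem_reProdIm] at hz
        have h2 := hz.2
        simp only [Complex.ofReal_im, Complex.add_im, Complex.mul_im, Complex.ofReal_re,
          Complex.I_im, mul_one, Complex.I_re, mul_zero, add_zero, zero_add] at h2
        rw [uIcc_of_le hs] at h2
        exact (hd z h2.1 h2.2).differentiableWithinAt)
    simp only [Complex.ofReal_re, Complex.ofReal_im, Complex.add_re, Complex.add_im,
      Complex.mul_re, Complex.mul_im, Complex.I_re, Complex.I_im, mul_zero, mul_one, sub_zero,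
      add_zero, zero_add, Complex.ofReal_zero, zero_mul, smul_eq_mul] at this
    linear_combination this
  have hv : ∀ N : ℝ, ‖∫ y in (0 : ℝ)..s, h (N + y * Complex.I)‖ ≤ C * (1 + N ^ 2)⁻¹ * s := by
    intro N
    have := intervalIntegral.norm_integral_le_of_norm_le_const (a := 0) (b := s)
      (f := fun y : ℝ => h (N + y * Complex.I)) (C := C * (1 + N ^ 2)⁻¹) fun y hy => by
        rw [uIoc_of_le hs] at hy
        have := hC (N + y * Complex.I) (by simpa using hy.1.le) (by simpa using hy.2)
        simpa using this
    rwa [sub_zero, abs_of_nonneg hs] at this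
  have hz : Tendsto (fun N : ℝ => C * (1 + N ^ 2)⁻¹ * s + C * (1 + N ^ 2)⁻¹ * s) atTop (𝓝 0) := by
    have h1 : Tendsto (fun N : ℝ => (1 + N ^ 2)⁻¹) atTop (𝓝 0) :=
      tendsto_inv_atTop_zero.comp (tendsto_atTop_add_const_left _ _
        (tendsto_pow_atTop two_ne_zero))
    have h2 := (h1.const_mul C).mul_const s
    simpa using h2.add h2
  have hdiff := l0.sub l1
  refine sub_eq_zero.1 (tendsto_nhds_unique hdiff ?_)
  refine squeeze_zero_norm (fun N => ?_) hz
  simp only [id]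
  rw [hrect]
  refine (norm_sub_le _ _).trans ?_
  rw [norm_mul, norm_mul, Complex.norm_I, one_mul, one_mul]
  have h1 := hv (-N)
  rw [neg_sq] at h1
  exact add_le_add h1 (hv N)

theorem norm_complex_gauss (u v : ℝ) : ‖Complex.exp (-Real.pi * (u + v * Complex.I) ^ 2)‖ =
    Real.exp (Real.pi * v ^ 2) * Real.exp (-Real.pi * u ^ 2) := by
  rw [Complex.norm_exp, ← Real.exp_add]
  congr 1
  have : (-Real.pi * (u + v * Complex.I) ^ 2 : ℂ) =
      ((Real.pi * v ^ 2 + -Real.pi * u ^ 2 : ℝ) : ℂ) + ((-2 * Real.pi * u * v : ℝ) : ℂ) * Complex.I := by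
    push_cast
    linear_combination (-Real.pi * v ^ 2 : ℂ) * Complex.I_sq
  rw [this]
  simp only [Complex.add_re, Complex.ofReal_re, Complex.re_ofReal_mul, Complex.I_re, mul_zero,
    add_zero]

/-- The Gaussian factor beats the growth of G, so the contour can move. A rise by s in the variable
of G is a rise by s/R in the variable u. -/
theorem gaussMean_eq_shift {G : ℂ → ℂ} {s : ℝ} (hs : 0 ≤ s)
    (hd : ∀ z : ℂ, 0 ≤ z.im → z.im ≤ s → DifferentiableAt ℂ G z) {C : ℝ}
    (hC : ∀ z : ℂ, 0 ≤ z.im → z.im ≤ s → ‖G z‖ ≤ C * (1 + z.re ^ 2)) {R : ℝ} (hR : 1 ≤ R) :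
    gaussMean R (fun x => G x) = ∫ u : ℝ, G ((R * u : ℝ) + s * Complex.I) *
      Complex.exp (-Real.pi * (u + (s / R : ℝ) * Complex.I) ^ 2) := by
  have hR0 : 0 < R := by linarith
  have hC0 : 0 ≤ C := by
    have := (norm_nonneg _).trans (hC 0 (by simp) (by simpa using hs))
    simpa using this
  have hmul : ∀ z : ℂ, 0 ≤ z.im → z.im ≤ s / R → 0 ≤ ((R : ℂ) * z).im ∧ ((R : ℂ) * z).im ≤ s := by
    intro z hz hzs
    rw [Complex.im_ofReal_mul]
    exact ⟨by positivity, by rwa [le_div_iff₀' hR0] at hzs⟩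
  have h := integral_line_eq_of_strip (h := fun z => G (R * z) * Complex.exp (-Real.pi * z ^ 2))
    (s := s / R) (by positivity) (fun z hz hzs => ?_)
    (C := C * R ^ 2 * Real.exp (Real.pi * (s / R) ^ 2)) fun z hz hzs => ?_
  · rw [gaussMean]
    refine Eq.trans ?_ (h.trans ?_)
    · refine integral_congr_ae (Eventually.of_forall fun u => ?_)
      push_cast
      rfl
    · refine integral_congr_ae (Eventually.of_forall fun u => ?_)
      simp only
      congr 2
      have : (R : ℂ) ≠ 0 := by exact_mod_cast hR0.ne'
      push_cast
      field_simp
  · obtain ⟨a1, a2⟩ := hmul z hz hzs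
    have h1 : DifferentiableAt ℂ (fun z => G (R * z)) z :=
      DifferentiableAt.comp (g := G) z (hd _ a1 a2) (by fun_prop)
    exact h1.mul (by fun_prop)
  · obtain ⟨a1, a2⟩ := hmul z hz hzs
    have h1 := hC _ a1 a2
    rw [Complex.re_ofReal_mul] at h1
    have h2 := norm_complex_gauss z.re z.im
    rw [Complex.re_add_im] at h2
    have h3 := one_add_sq_mul_gauss_le z.re
    have h4 : Real.exp (Real.pi * z.im ^ 2) ≤ Real.exp (Real.pi * (s / R) ^ 2) := by
      rw [Real.exp_le_exp]
      have := Real.pi_pos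
      gcongr
    have h5 : 1 + (R * z.re) ^ 2 ≤ R ^ 2 * (1 + z.re ^ 2) := by nlinarith
    rw [norm_mul, h2]
    calc _ ≤ (C * (R ^ 2 * (1 + z.re ^ 2))) *
          (Real.exp (Real.pi * (s / R) ^ 2) * Real.exp (-Real.pi * z.re ^ 2)) := by
          refine mul_le_mul (h1.trans (mul_le_mul_of_nonneg_left h5 hC0)) ?_ (by positivity)
            (by positivity)
          exact mul_le_mul_of_nonneg_right h4 (Real.exp_pos _).le
      _ = C * R ^ 2 * Real.exp (Real.pi * (s / R) ^ 2) *
          ((1 + z.re ^ 2) * Real.exp (-Real.pi * z.re ^ 2)) := by ring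
      _ ≤ _ := mul_le_mul_of_nonneg_left h3 (by positivity)

/-- If `G` has a mean on the upper edge of a strip, then its Gaussian averages on the lower edge
converge to that mean. -/
theorem tendsto_gaussMean_of_shift {G : ℂ → ℂ} {s : ℝ} (hs : 0 ≤ s)
    (hd : ∀ z : ℂ, 0 ≤ z.im → z.im ≤ s → DifferentiableAt ℂ G z) {C : ℝ}
    (hC : ∀ z : ℂ, 0 ≤ z.im → z.im ≤ s → ‖G z‖ ≤ C * (1 + z.re ^ 2)) {B : ℝ}
    (hB : ∀ x : ℝ, ‖G (x + s * Complex.I)‖ ≤ B) {M : ℂ}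
    (hM : HasMean (fun x : ℝ => G (x + s * Complex.I)) M) :
    Tendsto (fun R => gaussMean R fun x => G x) atTop (𝓝 M) := by
  have hB0 : 0 ≤ B := (norm_nonneg _).trans (hB 0)
  have hGc : Continuous fun x : ℝ => G (x + s * Complex.I) := by
    refine continuous_iff_continuousAt.2 fun x => ?_
    have h1 : ContinuousAt G (x + s * Complex.I) :=
      (hd _ (by simpa using hs) (by simp)).continuousAt
    exact ContinuousAt.comp (f := fun x : ℝ => (x + s * Complex.I : ℂ)) h1 (by fun_prop)
  have hmain := hM.tendsto_gaussMean hGc hB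
  have hdiff : Tendsto (fun R : ℝ => ∫ u : ℝ, G ((R * u : ℝ) + s * Complex.I) *
      (Complex.exp (-Real.pi * (u + (s / R : ℝ) * Complex.I) ^ 2) -
        (Real.exp (-Real.pi * u ^ 2) : ℂ))) atTop (𝓝 (∫ _ : ℝ, 0)) := by
    have hexp1 : ∀ R : ℝ, 1 ≤ R → Real.exp (Real.pi * (s / R) ^ 2) ≤ Real.exp (Real.pi * s ^ 2) := by
      intro R hR
      rw [Real.exp_le_exp]
      have := Real.pi_pos
      have : s / R ≤ s := div_le_self hs hR
      have : 0 ≤ s / R := by positivity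
      gcongr
    refine tendsto_integral_filter_of_dominated_convergence
      (fun u => B * ((Real.exp (Real.pi * s ^ 2) + 1) * Real.exp (-Real.pi * u ^ 2))) ?_ ?_ ?_ ?_
    · refine Eventually.of_forall fun R => ?_
      have h1 : Continuous fun u : ℝ => G ((R * u : ℝ) + s * Complex.I) :=
        hGc.comp (continuous_const.mul continuous_id)
      exact (h1.mul (by fun_prop)).aestronglyMeasurable
    · filter_upwards [eventually_ge_atTop 1] with R hR
      refine Eventually.of_forall fun u => ?_
      rw [norm_mul]
      refine mul_le_mul (hB _) ?_ (norm_nonneg _) hB0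
      refine (norm_sub_le _ _).trans ?_
      rw [norm_complex_gauss, Complex.norm_real, Real.norm_of_nonneg (Real.exp_pos _).le, add_mul,
        one_mul]
      have := hexp1 R hR
      gcongr
    · exact (integrable_gauss.const_mul _).const_mul B
    · refine Eventually.of_forall fun u => ?_
      have h1 : Tendsto (fun R : ℝ => Complex.exp (-Real.pi * (u + (s / R : ℝ) * Complex.I) ^ 2) -
          (Real.exp (-Real.pi * u ^ 2) : ℂ)) atTop (𝓝 0) := by
        have h2 : Tendsto (fun R : ℝ => s / R) atTop (𝓝 0) := tendsto_const_nhds.div_atTop tendsto_id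
        have h3 : Continuous fun v : ℝ => Complex.exp (-Real.pi * (u + (v : ℂ) * Complex.I) ^ 2) -
          (Real.exp (-Real.pi * u ^ 2) : ℂ) := by fun_prop
        have h5 : Complex.exp (-Real.pi * (u + ((0 : ℝ) : ℂ) * Complex.I) ^ 2) -
            (Real.exp (-Real.pi * u ^ 2) : ℂ) = 0 := by push_cast; simp
        have h4 := (h3.tendsto 0).comp h2
        beta_reduce at h4
        rw [h5] at h4
        exact h4
      have h6 := h1.norm.const_mul B
      rw [norm_zero, mul_zero] at h6
      refine squeeze_zero_norm (fun R => ?_) h6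
      rw [norm_mul]
      exact mul_le_mul_of_nonneg_right (hB _) (norm_nonneg _)
  rw [integral_zero] at hdiff
  have hsum := hdiff.add hmain
  rw [zero_add] at hsum
  refine hsum.congr' ?_
  filter_upwards [eventually_ge_atTop 1] with R hR
  rw [gaussMean_eq_shift hs hd hC hR, gaussMean]
  have hi1 := integrable_gaussMean hGc (C := B) (fun x => (hB x).trans (by nlinarith [sq_nonneg x])) hR
  have hGR : Continuous fun u : ℝ => G ((R * u : ℝ) + s * Complex.I) :=
    hGc.comp (continuous_const.mul continuous_id)
  have hi2 : Integrable fun u : ℝ => G ((R * u : ℝ) + s * Complex.I) *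
      Complex.exp (-Real.pi * (u + (s / R : ℝ) * Complex.I) ^ 2) := by
    refine integrable_of_le_one_add_sq_gauss (hGR.mul (by fun_prop))
      (C := B * Real.exp (Real.pi * (s / R) ^ 2)) (by positivity) fun u => ?_
    rw [norm_mul, norm_complex_gauss, mul_assoc]
    refine mul_le_mul (hB _) ?_ (by positivity) hB0
    refine mul_le_mul_of_nonneg_left ?_ (Real.exp_pos _).le
    exact le_mul_of_one_le_left (Real.exp_pos _).le (by nlinarith [sq_nonneg u])
  simp only [mul_sub]
  rw [MeasureTheory.integral_sub hi2 hi1]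
  ring

/-! ### Bohr coefficients in the half-plane -/

theorem IsAlmostPeriodicH.isAP_line {g : ℂ → ℂ} (h : IsAlmostPeriodicH g) {y : ℝ} (hy : 0 < y) :
    IsAP fun x : ℝ => g (x + y * Complex.I) := by
  have him : ∀ x : ℝ, (x + y * Complex.I : ℂ).im = y := fun x => by simp
  refine IsAP.of_bohr ?_ fun ε hε => ?_
  · refine h.1.continuousOn.comp_continuous (by fun_prop) fun x => ?_
    change 0 < (x + y * Complex.I : ℂ).im
    rwa [him]
  · obtain ⟨τ, hτ, hτ'⟩ := h.2 (y / 2) (2 * y) ε (by positivity) (by linarith) hε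
    refine ⟨τ, hτ, fun t ht x => ?_⟩
    have := hτ' t ht (x + y * Complex.I) (by rw [him]; linarith) (by rw [him]; linarith)
    have e : ((x + t : ℝ) : ℂ) + y * Complex.I = x + y * Complex.I + t := by push_cast; ring
    rwa [e]

theorem isAP_line_of_shift {f : ℂ → ℂ} {c : ℝ}
    (h : IsAlmostPeriodicH fun z => f (z + c * Complex.I)) {y : ℝ} (hy : c < y) :
    IsAP fun x : ℝ => f (x + y * Complex.I) := by
  convert h.isAP_line (sub_pos.2 hy) using 3 with x
  push_cast
  ring

theorem strip_growth {f : ℂ → ℂ} {c C : ℝ} (hC0 : 0 ≤ C)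
    (hC : ∀ z : ℂ, c ≤ z.im → ‖f z‖ ≤ C * (1 + ‖z‖) ^ 2) {y s : ℝ} (hy0 : 0 ≤ y) (hy : c ≤ y)
    {z : ℂ} (hz : 0 ≤ z.im) (hzs : z.im ≤ s) :
    ‖f (z + y * Complex.I)‖ ≤ C * (2 * (1 + s + y) ^ 2) * (1 + z.re ^ 2) := by
  have him : (z + y * Complex.I).im = z.im + y := by simp
  have h1 : ‖z + y * Complex.I‖ ≤ |z.re| + s + y := by
    have h2 := Complex.norm_le_abs_re_add_abs_im (z + y * Complex.I)
    have h3 : (z + y * Complex.I).re = z.re := by simp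
    rw [him, h3, abs_of_nonneg (show 0 ≤ z.im + y by linarith)] at h2
    linarith
  have h4 : (1 + ‖z + y * Complex.I‖) ^ 2 ≤ 2 * (1 + s + y) ^ 2 * (1 + z.re ^ 2) := by
    have h5 : (1 + ‖z + y * Complex.I‖) ^ 2 ≤ ((1 + s + y) + |z.re|) ^ 2 :=
      pow_le_pow_left₀ (by positivity) (by linarith) 2
    have h6 : ((1 + s + y) + |z.re|) ^ 2 ≤ 2 * (1 + s + y) ^ 2 + 2 * |z.re| ^ 2 := by
      nlinarith [sq_nonneg ((1 + s + y) - |z.re|)]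
    rw [sq_abs] at h6
    have h7 : 1 ≤ (1 + s + y) ^ 2 := by nlinarith
    nlinarith [mul_le_mul_of_nonneg_right h7 (sq_nonneg z.re)]
  calc _ ≤ C * (1 + ‖z + y * Complex.I‖) ^ 2 := hC _ (by rw [him]; linarith)
    _ ≤ C * (2 * (1 + s + y) ^ 2 * (1 + z.re ^ 2)) := mul_le_mul_of_nonneg_left h4 hC0
    _ = _ := by ring

theorem norm_exp_neg_two_pi (l : ℝ) (z : ℂ) :
    ‖Complex.exp (-(2 * Real.pi * Complex.I * l * z))‖ = Real.exp (2 * Real.pi * l * z.im) := by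
  rw [Complex.norm_exp]
  congr 1
  simp

theorem exp_neg_two_pi_line (l x y : ℝ) :
    Complex.exp (-(2 * Real.pi * Complex.I * l * (x + y * Complex.I))) =
      (Real.exp (2 * Real.pi * l * y) : ℂ) * expi (-l) x := by
  rw [expi, Complex.ofReal_exp, ← Complex.exp_add]
  congr 1
  push_cast
  linear_combination (-(2 * Real.pi * l * y) : ℂ) * Complex.I_mul_I

theorem differentiableAt_shift {f : ℂ → ℂ} (hf : DifferentiableOn ℂ f upperHalf) {y : ℝ}
    (hy : 0 < y) {z : ℂ} (hz : 0 ≤ z.im) : DifferentiableAt ℂ (fun z => f (z + y * Complex.I)) z := by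
  have h1 : DifferentiableAt ℂ f (z + y * Complex.I) :=
    hf.differentiableAt (isOpen_upperHalf.mem_nhds (by
      change 0 < (z + y * Complex.I).im
      simp
      linarith))
  exact DifferentiableAt.comp (g := f) z h1 (by fun_prop)

/-- The integrand of the Bohr means, as a function on the half-plane above height `y`. -/
def bohrFun (f : ℂ → ℂ) (l y : ℝ) (z : ℂ) : ℂ :=
  f (z + y * Complex.I) * Complex.exp (-(2 * Real.pi * Complex.I * l * (z + y * Complex.I)))

theorem bohrFun_growth {f : ℂ → ℂ} {c C : ℝ} (hC0 : 0 ≤ C)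
    (hC : ∀ z : ℂ, c ≤ z.im → ‖f z‖ ≤ C * (1 + ‖z‖) ^ 2) {y s : ℝ} (hy0 : 0 ≤ y) (hy : c ≤ y)
    (l : ℝ) {z : ℂ} (hz : 0 ≤ z.im) (hzs : z.im ≤ s) :
    ‖bohrFun f l y z‖ ≤ C * (2 * (1 + s + y) ^ 2) * Real.exp (2 * Real.pi * |l| * (s + y)) *
      (1 + z.re ^ 2) := by
  have him : (z + y * Complex.I).im = z.im + y := by simp
  have h2 : Real.exp (2 * Real.pi * l * (z.im + y)) ≤ Real.exp (2 * Real.pi * |l| * (s + y)) := by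
    rw [Real.exp_le_exp]
    have := Real.pi_pos
    have := le_abs_self l
    have h3 : 0 ≤ z.im + y := by linarith
    calc 2 * Real.pi * l * (z.im + y) ≤ 2 * Real.pi * |l| * (z.im + y) := by gcongr
      _ ≤ _ := by gcongr
  rw [bohrFun, norm_mul, norm_exp_neg_two_pi, him]
  calc _ ≤ C * (2 * (1 + s + y) ^ 2) * (1 + z.re ^ 2) * Real.exp (2 * Real.pi * |l| * (s + y)) :=
        mul_le_mul (strip_growth hC0 hC hy0 hy hz hzs) h2 (Real.exp_pos _).le (by positivity)
    _ = _ := by ring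

theorem differentiableAt_bohrFun {f : ℂ → ℂ} (hf : DifferentiableOn ℂ f upperHalf) (l : ℝ) {y : ℝ}
    (hy : 0 < y) {z : ℂ} (hz : 0 ≤ z.im) : DifferentiableAt ℂ (bohrFun f l y) z :=
  (differentiableAt_shift hf hy hz).mul (by fun_prop)

theorem isAP_bohrFun {f : ℂ → ℂ} {y : ℝ} (h : IsAP fun x : ℝ => f (x + y * Complex.I)) (l : ℝ) :
    IsAP fun x : ℝ => bohrFun f l y x := by
  have := (h.mul (isAP_expi (-l))).mul (IsAP.const (Real.exp (2 * Real.pi * l * y) : ℂ))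
  convert this using 2 with x
  rw [bohrFun, exp_neg_two_pi_line]
  ring

/-- The Bohr coefficients exist on every line in the domain of almost periodicity, and do not
depend on the line. -/
theorem exists_bohr_coeff {f : ℂ → ℂ} (hf : DifferentiableOn ℂ f upperHalf) {c C : ℝ} (hc : 0 < c)
    (hAP : IsAlmostPeriodicH fun z => f (z + c * Complex.I)) (hC0 : 0 ≤ C)
    (hC : ∀ z : ℂ, c ≤ z.im → ‖f z‖ ≤ C * (1 + ‖z‖) ^ 2) :
    ∃ E : ℝ → ℂ, ∀ l y, c < y → HasMean (fun x : ℝ => bohrFun f l y x) (E l) := by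
  have hm : ∀ l y, ∃ m, c < y → HasMean (fun x : ℝ => bohrFun f l y x) m := by
    intro l y
    by_cases hy : c < y
    · obtain ⟨m, hm⟩ := (isAP_bohrFun (isAP_line_of_shift hAP hy) l).exists_hasMean
      exact ⟨m, fun _ => hm⟩
    · exact ⟨0, fun h => absurd h hy⟩
  choose m hm using hm
  -- The Gaussian means on the lower line converge to the mean there and, after a contour shift,
  -- also to the mean on the upper line. Quadratic growth of f is all the shift needs.
  have key : ∀ l y y', c < y → y ≤ y' → m l y = m l y' := by
    intro l y y' hy hyy
    have hy0 : 0 < y := hc.trans hy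
    have hap := isAP_bohrFun (isAP_line_of_shift hAP hy) l
    have hap' := isAP_bohrFun (isAP_line_of_shift hAP (hy.trans_le hyy)) l
    obtain ⟨K, -, hK⟩ := hap.exists_bound
    obtain ⟨K', -, hK'⟩ := hap'.exists_bound
    have e : ∀ x : ℝ, bohrFun f l y (x + (y' - y : ℝ) * Complex.I) = bohrFun f l y' x := by
      intro x
      have : (x + (y' - y : ℝ) * Complex.I + y * Complex.I : ℂ) = x + y' * Complex.I := by
        push_cast; ring
      rw [bohrFun, bohrFun, this]
    have h1 := (hm l y hy).tendsto_gaussMean hap.continuous hK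
    have h2 := tendsto_gaussMean_of_shift (G := bohrFun f l y) (s := y' - y) (by linarith)
      (fun z hz _ => differentiableAt_bohrFun hf l hy0 hz)
      (fun z hz hzs => bohrFun_growth hC0 hC hy0.le hy.le l hz hzs) (B := K')
      (fun x => by rw [e]; exact hK' x) (M := m l y')
      (by simp only [e]; exact hm l y' (hy.trans_le hyy))
    exact tendsto_nhds_unique h1 h2
  refine ⟨fun l => m l (c + 1), fun l y hy => ?_⟩
  have : m l (c + 1) = m l y := by
    rcases le_total (c + 1) y with h | h
    · exact key l _ _ (by linarith) h
    · exact (key l _ _ hy h).symm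
  beta_reduce
  rw [this]
  exact hm l y hy

/-- In the Gaussian mean at scale R, shift the contour upwards by |l|R². The character gains
e^{-2πl²R²}, the Gaussian loses e^{πl²R²}, and the net decay beats the polynomial factor R⁶. -/
theorem bohr_coeff_eq_zero_of_neg {f : ℂ → ℂ} (hf : DifferentiableOn ℂ f upperHalf) {c C : ℝ}
    (hc : 0 < c) (hAP : IsAlmostPeriodicH fun z => f (z + c * Complex.I)) (hC0 : 0 ≤ C)
    (hC : ∀ z : ℂ, c ≤ z.im → ‖f z‖ ≤ C * (1 + ‖z‖) ^ 2) {l y : ℝ} (hl : l < 0) (hy : c < y) {m : ℂ}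
    (hm : HasMean (fun x : ℝ => bohrFun f l y x) m) : m = 0 := by
  have hy0 : 0 < y := hc.trans hy
  have hpi := Real.pi_pos
  have hap := isAP_bohrFun (isAP_line_of_shift hAP hy) l
  obtain ⟨K, -, hK⟩ := hap.exists_bound
  have h1 := hm.tendsto_gaussMean hap.continuous hK
  refine tendsto_nhds_unique h1 ?_
  set k := 2 * C * (1 + |l| + y) ^ 2 * Real.pi with hk
  have hk0 : 0 ≤ k := by positivity
  have hlim : Tendsto (fun R : ℝ => k * (R ^ 6 * Real.exp (-(Real.pi * l ^ 2 * R ^ 2)))) atTop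
      (𝓝 0) := by
    have hq : 0 < Real.pi * l ^ 2 := by have := sq_pos_of_neg hl; positivity
    have h2 := (Real.tendsto_pow_mul_exp_neg_atTop_nhds_zero 3).comp
      ((tendsto_pow_atTop (α := ℝ) two_ne_zero).const_mul_atTop hq)
    have h3 := h2.const_mul (k * ((Real.pi * l ^ 2) ^ 3)⁻¹)
    rw [mul_zero] at h3
    refine h3.congr fun R => ?_
    simp only [Function.comp_apply]
    have := hl.ne
    field_simp
  refine squeeze_zero_norm' ?_ hlim
  filter_upwards [eventually_ge_atTop 1] with R hR
  have hR0 : 0 < R := by linarith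
  set s := |l| * R ^ 2 with hs
  have hs0 : 0 ≤ s := by positivity
  rw [gaussMean_eq_shift (G := bohrFun f l y) hs0
    (fun z hz _ => differentiableAt_bohrFun hf l hy0 hz)
    (fun z hz hzs => bohrFun_growth hC0 hC hy0.le hy.le l hz hzs) hR]
  have hbound : ∀ u : ℝ, ‖bohrFun f l y ((R * u : ℝ) + s * Complex.I) *
      Complex.exp (-Real.pi * (u + (s / R : ℝ) * Complex.I) ^ 2)‖ ≤
      k * (R ^ 6 * Real.exp (-(Real.pi * l ^ 2 * R ^ 2))) * Real.pi⁻¹ * (1 + u ^ 2)⁻¹ := by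
    intro u
    have him : ((R * u : ℝ) + s * Complex.I : ℂ).im = s := by simp
    have hre : ((R * u : ℝ) + s * Complex.I : ℂ).re = R * u := by simp
    have h1 := strip_growth hC0 hC hy0.le hy.le (z := (R * u : ℝ) + s * Complex.I) (s := s)
      (by rw [him]; exact hs0) (by rw [him])
    rw [hre] at h1
    have him2 : ((R * u : ℝ) + s * Complex.I + y * Complex.I : ℂ).im = s + y := by simp
    have e1 : Real.exp (2 * Real.pi * l * (s + y)) ≤ Real.exp (-(2 * Real.pi * l ^ 2 * R ^ 2)) := by
      rw [Real.exp_le_exp, hs, abs_of_neg hl]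
      have : 0 < Real.pi * -l * y := mul_pos (mul_pos hpi (neg_pos.2 hl)) hy0
      nlinarith
    have e2 : (s / R) ^ 2 = l ^ 2 * R ^ 2 := by
      rw [hs, div_pow, mul_pow, sq_abs]
      field_simp
    have e3 : 1 + s + y ≤ R ^ 2 * (1 + |l| + y) := by
      have : 1 ≤ R ^ 2 := by nlinarith
      rw [hs]
      nlinarith
    have e4 : 1 + (R * u) ^ 2 ≤ R ^ 2 * (1 + u ^ 2) := by nlinarith
    have e5 := one_add_sq_mul_gauss_le u
    have e6 : Real.exp (-(2 * Real.pi * l ^ 2 * R ^ 2)) * Real.exp (Real.pi * (l ^ 2 * R ^ 2)) =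
        Real.exp (-(Real.pi * l ^ 2 * R ^ 2)) := by
      rw [← Real.exp_add]; congr 1; ring
    rw [bohrFun, norm_mul, norm_mul, norm_exp_neg_two_pi, norm_complex_gauss, him2, e2]
    calc _ ≤ C * (2 * (R ^ 2 * (1 + |l| + y)) ^ 2) * (R ^ 2 * (1 + u ^ 2)) *
          Real.exp (-(2 * Real.pi * l ^ 2 * R ^ 2)) *
          (Real.exp (Real.pi * (l ^ 2 * R ^ 2)) * Real.exp (-Real.pi * u ^ 2)) := by
          refine mul_le_mul_of_nonneg_right ?_ (by positivity)
          refine mul_le_mul (h1.trans ?_) e1 (Real.exp_pos _).le (by positivity)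
          gcongr
      _ = C * 2 * (1 + |l| + y) ^ 2 * R ^ 6 * (Real.exp (-(2 * Real.pi * l ^ 2 * R ^ 2)) *
          Real.exp (Real.pi * (l ^ 2 * R ^ 2))) *
          ((1 + u ^ 2) * Real.exp (-Real.pi * u ^ 2)) := by ring
      _ ≤ C * 2 * (1 + |l| + y) ^ 2 * R ^ 6 * Real.exp (-(Real.pi * l ^ 2 * R ^ 2)) *
          (1 + u ^ 2)⁻¹ := by
          rw [e6]
          gcongr
      _ = _ := by rw [hk]; field_simp
  refine (norm_integral_le_of_norm_le (integrable_inv_one_add_sq.const_mul _)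
    (Eventually.of_forall hbound)).trans_eq ?_
  rw [MeasureTheory.integral_const_mul, integral_univ_inv_one_add_sq]
  field_simp

/-- This is ℓ¹–ℓ^∞ duality: take for p_n the phases of the weighted coefficients. Since c₂ may equal
c₁, almost periodicity may fail on the line Im z = c₂, so means there are only controlled by the
limsup bound; Gaussian means link that line with Im z = c₂ + 1. -/
theorem sum_bohr_coeff_le {f : ℂ → ℂ} (hf : DifferentiableOn ℂ f upperHalf) {c₁ C : ℝ}
    (hc : 0 < c₁) (hAP : IsAlmostPeriodicH fun z => f (z + c₁ * Complex.I)) (hC0 : 0 ≤ C)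
    (hC : ∀ z : ℂ, c₁ ≤ z.im → ‖f z‖ ≤ C * (1 + ‖z‖) ^ 2) {E : ℝ → ℂ}
    (hE : ∀ l y, c₁ < y → HasMean (fun x : ℝ => bohrFun f l y x) (E l)) {c₂ B : ℝ} (hB0 : 0 < B)
    (hcc : c₁ ≤ c₂) (hB : BoundedCoeffs f c₂ B) {N : ℕ} (θ : Fin N → ℝ)
    (hθ : Function.Injective θ) (hθ0 : ∀ n, 0 ≤ θ n) :
    ∑ n, ‖E (θ n)‖ * Real.exp (-(2 * Real.pi * c₂) * θ n) ≤ B := by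
  have hc₂ : 0 < c₂ := hc.trans_le hcc
  have hpi := Real.pi_pos
  set X : Fin N → ℂ := fun n => (Real.exp (-(2 * Real.pi * c₂) * θ n) : ℂ) * E (θ n) with hX
  -- Where X n = 0 the division convention gives p n = 0, which is harmless.
  set p : Fin N → ℂ := fun n => X n / ‖X n‖ with hp
  have hp1 : ∀ n, ‖p n‖ ≤ 1 := fun n => by
    rw [hp, norm_div, Complex.norm_real, norm_norm]
    exact div_self_le_one _
  have hsup : B * ⨆ n, ‖p n‖ ≤ B := by
    refine mul_le_of_le_one_right hB0.le (Real.iSup_le hp1 zero_le_one)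
  have hpX : ∀ n, conj (p n) * X n = (‖X n‖ : ℂ) := by
    intro n
    rcases eq_or_ne (X n) 0 with h0 | h0
    · simp [h0]
    · have : (‖X n‖ : ℂ) ≠ 0 := by exact_mod_cast norm_ne_zero_iff.2 h0
      rw [hp, map_div₀, Complex.conj_ofReal, div_mul_eq_mul_div, Complex.conj_mul', sq,
        mul_div_cancel_right₀ _ this]
  -- P is the entire extension of the conjugated trigonometric polynomial, so that f times it can be
  -- shifted.
  set P : ℂ → ℂ := fun z => ∑ n, conj (p n) * Complex.exp (-(2 * Real.pi * Complex.I * θ n * z))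
    with hP
  set G : ℂ → ℂ := fun z => f (z + c₂ * Complex.I) * P z with hG
  have hPline : ∀ x : ℝ, P x = conj (trigPoly θ p x) := by
    intro x
    rw [conj_trigPoly]
    refine Finset.sum_congr rfl fun n _ => ?_
    congr 1
    rw [expi]
    congr 1
    push_cast
    ring
  have hPb : ∀ z : ℂ, 0 ≤ z.im → z.im ≤ 1 → ‖P z‖ ≤ ∑ n, Real.exp (2 * Real.pi * θ n) := by
    intro z hz hz1
    refine (norm_sum_le _ _).trans (Finset.sum_le_sum fun n _ => ?_)
    rw [norm_mul, RCLike.norm_conj, norm_exp_neg_two_pi]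
    refine (mul_le_of_le_one_left (Real.exp_pos _).le (hp1 n)).trans ?_
    rw [Real.exp_le_exp]
    exact mul_le_of_le_one_right (by have := hθ0 n; positivity) hz1
  have hgrow : ∀ z : ℂ, 0 ≤ z.im → z.im ≤ 1 → ‖G z‖ ≤ C * (2 * (1 + 1 + c₂) ^ 2) *
      (∑ n, Real.exp (2 * Real.pi * θ n)) * (1 + z.re ^ 2) := by
    intro z hz hz1
    rw [hG, norm_mul]
    have h1 := strip_growth hC0 hC hc₂.le hcc hz hz1
    calc _ ≤ C * (2 * (1 + 1 + c₂) ^ 2) * (1 + z.re ^ 2) * ∑ n, Real.exp (2 * Real.pi * θ n) :=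
          mul_le_mul h1 (hPb z hz hz1) (norm_nonneg _) (by positivity)
      _ = _ := by ring
  have hGd : ∀ z : ℂ, 0 ≤ z.im → z.im ≤ 1 → DifferentiableAt ℂ G z := fun z hz _ =>
    (differentiableAt_shift hf hc₂ hz).mul (by fun_prop)
  have hGc : Continuous fun x : ℝ => G x := by
    refine continuous_iff_continuousAt.2 fun x => ?_
    exact ContinuousAt.comp (f := fun x : ℝ => (x : ℂ)) (hGd x (by simp) (by simp)).continuousAt
      (by fun_prop)
  have htop : ∀ x : ℝ, G (x + (1 : ℝ) * Complex.I) = ∑ n, conj (p n) *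
      (Real.exp (-(2 * Real.pi * c₂) * θ n) : ℂ) * bohrFun f (θ n) (c₂ + 1) x := by
    intro x
    rw [hG, hP]
    simp only [Finset.mul_sum, bohrFun]
    refine Finset.sum_congr rfl fun n _ => ?_
    have e1 : (x + (1 : ℝ) * Complex.I + c₂ * Complex.I : ℂ) = x + (c₂ + 1 : ℝ) * Complex.I := by
      push_cast; ring
    have e2 : Complex.exp (-(2 * Real.pi * Complex.I * θ n * (x + (1 : ℝ) * Complex.I))) =
        (Real.exp (-(2 * Real.pi * c₂) * θ n) : ℂ) *
        Complex.exp (-(2 * Real.pi * Complex.I * θ n * (x + (c₂ + 1 : ℝ) * Complex.I))) := by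
      rw [Complex.ofReal_exp, ← Complex.exp_add]
      congr 1
      push_cast
      linear_combination (2 * Real.pi * c₂ * θ n : ℂ) * Complex.I_mul_I
    rw [e1, e2]
    ring
  have hcy : c₁ < c₂ + 1 := by linarith
  have hAPl : ∀ n, IsAP fun x : ℝ => bohrFun f (θ n) (c₂ + 1) x := fun n =>
    isAP_bohrFun (isAP_line_of_shift hAP hcy) _
  have htopAP : IsAP fun x : ℝ => G (x + (1 : ℝ) * Complex.I) := by
    simp only [htop]
    exact IsAP.finset_sum Finset.univ fun n _ => (IsAP.const _).mul (hAPl n)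
  obtain ⟨K, -, hK⟩ := htopAP.exists_bound
  have hmean : HasMean (fun x : ℝ => G (x + (1 : ℝ) * Complex.I)) (∑ n, (‖X n‖ : ℂ)) := by
    simp only [htop]
    have := HasMean.finset_sum (g := fun n x => conj (p n) *
      (Real.exp (-(2 * Real.pi * c₂) * θ n) : ℂ) * bohrFun f (θ n) (c₂ + 1) x) Finset.univ
      (fun n _ => continuous_const.mul (hAPl n).continuous)
      fun n _ => (hE (θ n) (c₂ + 1) hcy).const_mul (conj (p n) *
        (Real.exp (-(2 * Real.pi * c₂) * θ n) : ℂ))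
    convert this using 2 with n
    rw [← hpX, hX]
    ring
  have hlim := tendsto_gaussMean_of_shift (G := G) zero_le_one hGd hgrow hK hmean
  have hle : ‖∑ n, (‖X n‖ : ℂ)‖ ≤ B := by
    -- The limsup bound with slack ε holds for all large T, passes to the Gaussian means on Im z =
    -- c₂, and these converge to ∑ ‖X n‖.
    refine le_of_forall_pos_le_add fun ε hε => ?_
    have hls := hB N θ p hθ hθ0
    have hlt : ((B * ⨆ n, ‖p n‖ : ℝ) : EReal) < ((B + ε : ℝ) : EReal) :=
      EReal.coe_lt_coe_iff.2 (by linarith)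
    have hev := eventually_lt_of_limsup_lt (hls.trans_lt hlt)
    obtain ⟨T₀, hT₀⟩ := hev.exists_forall_of_atTop
    obtain ⟨k, hk⟩ := exists_norm_gaussMean_le (G := fun x : ℝ => G x) hGc (b := B + ε)
      (T₀ := max T₀ 1) (fun x => by simpa using hgrow x (by simp) (by simp)) (by positivity)
      (by positivity) fun T hT => by
        have hT1 : 0 < T := lt_of_lt_of_le one_pos ((le_max_right _ _).trans hT)
        have h1 := EReal.coe_lt_coe_iff.1 (hT₀ T ((le_max_left _ _).trans hT))
        rw [norm_mul, norm_div, norm_one, norm_mul, Complex.norm_real, Real.norm_of_nonneg hT1.le,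
          Complex.norm_ofNat, one_div, inv_mul_lt_iff₀ (by positivity)] at h1
        simp only [hG, hPline]
        linarith
    have hk0 : Tendsto (fun R : ℝ => B + ε + k / R) atTop (𝓝 (B + ε + 0)) :=
      tendsto_const_nhds.add (tendsto_const_nhds.div_atTop tendsto_id)
    rw [add_zero] at hk0
    refine le_of_tendsto_of_tendsto hlim.norm hk0 ?_
    filter_upwards [eventually_ge_atTop 1] with R hR using hk R hR
  have e : ‖∑ n, (‖X n‖ : ℂ)‖ = ∑ n, ‖X n‖ := by
    rw [← Complex.ofReal_sum, Complex.norm_real, Real.norm_of_nonneg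
      (Finset.sum_nonneg fun n _ => norm_nonneg _)]
  rw [e] at hle
  refine le_of_eq_of_le (Finset.sum_congr rfl fun n _ => ?_) hle
  rw [hX, norm_mul, Complex.norm_real, Real.norm_of_nonneg (Real.exp_pos _).le, mul_comm]

/-! ### The exponential series of `f` -/

theorem summable_bohr_coeff {E : ℝ → ℂ} (hneg : ∀ l, l < 0 → E l = 0) {c B : ℝ}
    (h : ∀ (N : ℕ) (θ : Fin N → ℝ), Function.Injective θ → (∀ n, 0 ≤ θ n) →
      ∑ n, ‖E (θ n)‖ * Real.exp (-(2 * Real.pi * c) * θ n) ≤ B) :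
    Summable fun l : ℝ => ‖E l‖ * Real.exp (-(2 * Real.pi * c) * |l|) := by
  classical
  refine summable_of_sum_le (fun l => by positivity) (c := B) fun u => ?_
  set F := u.filter fun l => 0 ≤ l with hF
  have h1 : ∑ l ∈ u, ‖E l‖ * Real.exp (-(2 * Real.pi * c) * |l|) =
      ∑ l ∈ F, ‖E l‖ * Real.exp (-(2 * Real.pi * c) * |l|) := by
    rw [hF, Finset.sum_filter]
    refine Finset.sum_congr rfl fun l _ => ?_
    split_ifs with hl
    · rfl
    · rw [hneg l (not_le.1 hl), norm_zero, zero_mul]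
  have h2 := h F.card (fun n => (F.equivFin.symm n : ℝ))
    (Subtype.val_injective.comp F.equivFin.symm.injective)
    fun n => (Finset.mem_filter.1 (F.equivFin.symm n).2).2
  rw [F.equivFin.symm.sum_comp (fun l : F => ‖E l‖ * Real.exp (-(2 * Real.pi * c) * (l : ℝ))),
    Finset.sum_coe_sort F fun l => ‖E l‖ * Real.exp (-(2 * Real.pi * c) * l)] at h2
  rw [h1]
  refine le_of_eq_of_le (Finset.sum_congr rfl fun l hl => ?_) h2
  rw [abs_of_nonneg (Finset.mem_filter.1 hl).2]

theorem summable_mul_exp_of_le {E : ℝ → ℂ} {c y : ℝ}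
    (h : Summable fun l : ℝ => ‖E l‖ * Real.exp (-(2 * Real.pi * c) * |l|)) (hy : c ≤ y) :
    Summable fun l : ℝ => ‖E l‖ * Real.exp (-(2 * Real.pi * y) * |l|) := by
  refine h.of_nonneg_of_le (fun l => by positivity) fun l => ?_
  refine mul_le_mul_of_nonneg_left ?_ (norm_nonneg _)
  rw [Real.exp_le_exp]
  have := Real.pi_pos
  have : 2 * Real.pi * c * |l| ≤ 2 * Real.pi * y * |l| := by gcongr
  linarith

theorem locallySummable_of_summable_exp {E : ℝ → ℂ} {c : ℝ} (hc : 0 ≤ c)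
    (h : Summable fun l : ℝ => ‖E l‖ * Real.exp (-c * |l|)) : LocallySummable E := by
  constructor
  · refine h.countable_support.mono fun l hl => ?_
    rw [Function.mem_support] at hl ⊢
    have := norm_pos_iff.2 hl
    positivity
  · intro T hT
    refine (h.mul_left (Real.exp (c * T))).of_nonneg_of_le
      (fun l => indicator_nonneg (fun _ _ => norm_nonneg _) _) fun l => ?_
    by_cases hl : l ∈ Icc (-T) T
    · rw [indicator_of_mem hl]
      have h1 : |l| ≤ T := abs_le.2 hl
      have h2 : 1 ≤ Real.exp (c * T) * Real.exp (-c * |l|) := by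
        rw [← Real.exp_add]
        apply Real.one_le_exp
        nlinarith
      calc ‖E l‖ = ‖E l‖ * 1 := (mul_one _).symm
        _ ≤ ‖E l‖ * (Real.exp (c * T) * Real.exp (-c * |l|)) := by gcongr
        _ = _ := by ring
    · rw [indicator_of_notMem hl]
      positivity

theorem summable_norm_mul_exp {E : ℝ → ℂ} (hneg : ∀ l, l < 0 → E l = 0) {y : ℝ}
    (h : Summable fun l : ℝ => ‖E l‖ * Real.exp (-(2 * Real.pi * y) * |l|)) :
    Summable fun l : ℝ => ‖E l * (Real.exp (-(2 * Real.pi * y) * l) : ℂ)‖ := by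
  refine h.congr fun l => ?_
  rw [norm_mul, Complex.norm_real, Real.norm_of_nonneg (Real.exp_pos _).le]
  rcases lt_or_ge l 0 with hl | hl
  · rw [hneg l hl]; simp
  · rw [abs_of_nonneg hl]

/-- An almost periodic line is the sum of its Fourier series when that converges absolutely. -/
theorem eq_expSeries_of_hasMean {f : ℂ → ℂ} {y : ℝ} (hAP : IsAP fun x : ℝ => f (x + y * Complex.I))
    {E : ℝ → ℂ} (hneg : ∀ l, l < 0 → E l = 0)
    (hE : ∀ l, HasMean (fun x : ℝ => bohrFun f l y x) (E l))
    (h : Summable fun l : ℝ => ‖E l‖ * Real.exp (-(2 * Real.pi * y) * |l|)) (x : ℝ) :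
    f (x + y * Complex.I) =
      expSeries (fun l => E l * (Real.exp (-(2 * Real.pi * y) * l) : ℂ)) x := by
  have hs := summable_norm_mul_exp hneg h
  set A : ℝ → ℂ := fun l => E l * (Real.exp (-(2 * Real.pi * y) * l) : ℂ) with hA
  have hser := isAP_expSeries hs
  refine sub_eq_zero.1 ((hAP.sub hser).eq_zero_of_hasMean_zero (fun l => ?_) x)
  have h1 : HasMean (fun x : ℝ => f (x + y * Complex.I) * expi l x) (A (-l)) := by
    have h2 := (hE (-l)).const_mul (Real.exp (-(2 * Real.pi * y) * -l) : ℂ)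
    convert h2 using 1
    · ext x
      rw [bohrFun, exp_neg_two_pi_line, neg_neg]
      have : (Real.exp (-(2 * Real.pi * y) * -l) : ℂ) * (Real.exp (2 * Real.pi * -l * y) : ℂ) = 1 := by
        rw [← Complex.ofReal_mul, ← Real.exp_add, ← Complex.ofReal_one]
        congr 1
        rw [Real.exp_eq_one_iff]
        ring
      linear_combination (-(f (x + y * Complex.I) * expi l x)) * this
    · simp only [hA]; ring
  have h3 := hasMean_expSeries_mul hs (-l)
  rw [neg_neg] at h3
  have h4 := h1.sub h3 (hAP.continuous.mul (continuous_expi l))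
    (hser.continuous.mul (continuous_expi l))
  rw [sub_self] at h4
  simpa only [sub_mul] using h4

/-- Since E vanishes on negative frequencies, the case distinction collapses into one symmetric
formula. -/
theorem antipodalCoeff_eq {E : ℝ → ℂ} (hneg : ∀ l, l < 0 → E l = 0) (l : ℝ) :
    antipodalCoeff E l = E l + conj (E (-l)) := by
  unfold antipodalCoeff
  split_ifs with h1 h2
  · rw [hneg (-l) (by linarith), map_zero, add_zero]
  · rw [h2, neg_zero, Complex.add_conj]
  · rw [hneg l (lt_of_le_of_ne (not_lt.1 h1) h2), zero_add]

theorem summable_antipodalCoeff {E : ℝ → ℂ} (hneg : ∀ l, l < 0 → E l = 0) {k : ℝ}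
    (h : Summable fun l : ℝ => ‖E l‖ * Real.exp (-k * |l|)) :
    Summable fun l : ℝ => ‖antipodalCoeff E l‖ * Real.exp (-k * |l|) := by
  have h1 := (Equiv.neg ℝ).summable_iff.2 h
  refine (h.add h1).of_nonneg_of_le (fun l => by positivity) fun l => ?_
  rw [antipodalCoeff_eq hneg]
  simp only [Function.comp_apply, Equiv.neg_apply, abs_neg]
  rw [← add_mul]
  refine mul_le_mul_of_nonneg_right ?_ (Real.exp_pos _).le
  refine (norm_add_le _ _).trans_eq ?_
  rw [RCLike.norm_conj]

theorem two_mul_re_eq_expSeries {f : ℂ → ℂ} {E : ℝ → ℂ} (hneg : ∀ l, l < 0 → E l = 0) {y : ℝ}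
    (h : Summable fun l : ℝ => ‖E l‖ * Real.exp (-(2 * Real.pi * y) * |l|)) {x : ℝ}
    (hf : f (x + y * Complex.I) =
      expSeries (fun l => E l * (Real.exp (-(2 * Real.pi * y) * l) : ℂ)) x) :
    ((2 * (f (x + y * Complex.I)).re : ℝ) : ℂ) =
      expSeries (fun l => antipodalCoeff E l * (Real.exp (-(2 * Real.pi * y) * |l|) : ℂ)) x := by
  have h1 := (summable_expSeries (summable_norm_mul_exp hneg h) x).hasSum
  have h2 := Complex.hasSum_conj'.2 h1
  have h3 := (Equiv.neg ℝ).hasSum_iff.2 h2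
  have h4 := h1.add h3
  rw [← Complex.add_conj, hf]
  refine (HasSum.tsum_eq ?_).symm
  unfold expSeries
  convert! h4 using 1
  ext l
  simp only [Function.comp_apply, Equiv.neg_apply]
  rw [antipodalCoeff_eq hneg, map_mul, map_mul, conj_expi, neg_neg, Complex.conj_ofReal]
  rcases lt_trichotomy l 0 with hl | rfl | hl
  · rw [hneg l hl, abs_of_neg hl]; ring
  · simp
  · rw [hneg (-l) (by linarith), abs_of_pos hl]; simp

/-! ### The summation formula -/

/-- Finite sums may be integrated termwise, and the tail is uniformly small against the integrable
ψ. -/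
theorem hasSum_integral_expSeries {A : ℝ → ℂ} (hA : Summable fun l => ‖A l‖) {ψ : ℝ → ℂ}
    (hψ : Integrable ψ) : HasSum (fun l => A l * ∫ x, expi l x * ψ x)
      (∫ x, expSeries A x * ψ x) := by
  have hi : ∀ l, Integrable fun x => expi l x * ψ x := fun l =>
    hψ.bdd_mul (continuous_expi l).aestronglyMeasurable (c := 1)
      (Eventually.of_forall fun x => (norm_expi l x).le)
  have hcs := (isAP_expSeries hA).continuous
  have hes : ∀ x, ‖expSeries A x‖ ≤ ∑' l, ‖A l‖ := fun x =>
    tsum_of_norm_bounded hA.hasSum fun l => by rw [norm_mul, norm_expi, mul_one]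
  have hii : Integrable fun x => expSeries A x * ψ x :=
    hψ.bdd_mul hcs.aestronglyMeasurable (Eventually.of_forall hes)
  have hI0 : 0 ≤ ∫ x, ‖ψ x‖ := integral_nonneg fun x => norm_nonneg _
  rw [HasSum, Metric.tendsto_nhds]
  intro ε hε
  have htail := hA.hasSum
  rw [HasSum, Metric.tendsto_nhds] at htail
  filter_upwards [htail (ε / (1 + ∫ x, ‖ψ x‖)) (by positivity)] with F hF
  have hsub := hA.sum_add_tsum_compl (s := F)
  rw [Real.dist_eq, abs_sub_comm, ← hsub, add_sub_cancel_left, abs_of_nonneg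
    (tsum_nonneg fun l => norm_nonneg _)] at hF
  have e1 : ∑ l ∈ F, A l * ∫ x, expi l x * ψ x = ∫ x, (∑ l ∈ F, A l * expi l x) * ψ x := by
    simp only [Finset.sum_mul, mul_assoc]
    rw [integral_finsetSum F fun l _ => (hi l).const_mul (A l)]
    simp only [MeasureTheory.integral_const_mul]
  have i2 : Integrable fun x => (∑ l ∈ F, A l * expi l x) * ψ x := by
    simp only [Finset.sum_mul, mul_assoc]
    exact integrable_finsetSum F fun l _ => (hi l).const_mul (A l)
  rw [e1, dist_comm, dist_eq_norm, ← MeasureTheory.integral_sub hii i2]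
  simp only [← sub_mul]
  calc _ ≤ ∫ x, (∑' l : ↑((F : Set ℝ)ᶜ), ‖A l‖) * ‖ψ x‖ := by
        refine norm_integral_le_of_norm_le (hψ.norm.const_mul _) (Eventually.of_forall fun x => ?_)
        rw [norm_mul]
        exact mul_le_mul_of_nonneg_right (norm_expSeries_sub_sum_le hA F x) (norm_nonneg _)
    _ = (∑' l : ↑((F : Set ℝ)ᶜ), ‖A l‖) * ∫ x, ‖ψ x‖ := MeasureTheory.integral_const_mul _ _
    _ ≤ (ε / (1 + ∫ x, ‖ψ x‖)) * ∫ x, ‖ψ x‖ := by gcongr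
    _ < (ε / (1 + ∫ x, ‖ψ x‖)) * (1 + ∫ x, ‖ψ x‖) := by
        refine mul_lt_mul_of_pos_left (by linarith) (by positivity)
    _ = ε := by field_simp

theorem integrable_exp_neg_mul_abs {k : ℝ} (hk : 0 < k) :
    Integrable fun l : ℝ => Real.exp (-k * |l|) := by
  rw [← integrableOn_univ, ← Iic_union_Ioi (a := (0 : ℝ))]
  refine ((integrableOn_exp_mul_Iic hk 0).congr_fun (fun l hl => ?_) measurableSet_Iic).union
    ((integrableOn_exp_mul_Ioi (neg_lt_zero.2 hk) 0).congr_fun (fun l hl => ?_) measurableSet_Ioi)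
  · rw [abs_of_nonpos hl, neg_mul_neg]
  · rw [abs_of_pos hl]

theorem integrable_exp_abs_mul_expi {y : ℝ} (hy : 0 < y) (t : ℝ) :
    Integrable fun l : ℝ => (Real.exp (-(2 * Real.pi * y) * |l|) : ℂ) * expi t l := by
  have hpi := Real.pi_pos
  have h1 : Integrable fun l : ℝ => Real.exp (-(2 * Real.pi * y) * |l|) :=
    integrable_exp_neg_mul_abs (by positivity)
  have h2 := (h1.ofReal (𝕜 := ℂ)).bdd_mul (continuous_expi t).aestronglyMeasurable (c := 1)
    (Eventually.of_forall fun x => (norm_expi t x).le)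
  refine h2.congr (Eventually.of_forall fun l => ?_)
  exact mul_comm _ _

theorem fourier_exp_abs_mul_expi {y : ℝ} (hy : 0 < y) (t x : ℝ) :
    𝓕 (fun l : ℝ => (Real.exp (-(2 * Real.pi * y) * |l|) : ℂ) * expi t l) x =
      (poisson y (x - t) : ℂ) := by
  have hpi := Real.pi_pos
  set v := t - x with hv
  have e0 : ∀ l : ℝ, expi (-x) l * ((Real.exp (-(2 * Real.pi * y) * |l|) : ℂ) * expi t l) =
      (Real.exp (-(2 * Real.pi * y) * |l|) : ℂ) * expi v l := by
    intro l
    have : expi v l = expi (-x) l * expi t l := by rw [expi_mul_expi, hv]; congr 1; ring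
    rw [this]; ring
  rw [fourier_eq_integral_expi]
  simp only [e0]
  have hi := integrable_exp_abs_mul_expi hy v
  rw [← integral_add_compl measurableSet_Iic (s := Iic 0) hi, compl_Iic]
  have hp : ((2 * Real.pi * y : ℝ) + (2 * Real.pi * v : ℝ) * Complex.I : ℂ).re = 2 * Real.pi * y := by
    simp
  have hn : (-(2 * Real.pi * y : ℝ) + (2 * Real.pi * v : ℝ) * Complex.I : ℂ).re =
    -(2 * Real.pi * y) := by simp
  have h1 : ∫ l in Iic (0 : ℝ), (Real.exp (-(2 * Real.pi * y) * |l|) : ℂ) * expi v l =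
      1 / ((2 * Real.pi * y : ℝ) + (2 * Real.pi * v : ℝ) * Complex.I : ℂ) := by
    have := integral_exp_mul_complex_Iic
      (a := ((2 * Real.pi * y : ℝ) + (2 * Real.pi * v : ℝ) * Complex.I : ℂ))
      (by rw [hp]; positivity) 0
    rw [Complex.ofReal_zero, mul_zero, Complex.exp_zero] at this
    rw [← this]
    refine setIntegral_congr_fun measurableSet_Iic fun l hl => ?_
    rw [abs_of_nonpos hl, expi, Complex.ofReal_exp, ← Complex.exp_add]
    congr 1
    push_cast
    ring
  have h2 : ∫ l in Ioi (0 : ℝ), (Real.exp (-(2 * Real.pi * y) * |l|) : ℂ) * expi v l =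
      -1 / (-(2 * Real.pi * y : ℝ) + (2 * Real.pi * v : ℝ) * Complex.I : ℂ) := by
    have := integral_exp_mul_complex_Ioi
      (a := (-(2 * Real.pi * y : ℝ) + (2 * Real.pi * v : ℝ) * Complex.I : ℂ))
      (by rw [hn]; have : 0 < 2 * Real.pi * y := by positivity
          linarith) 0
    rw [Complex.ofReal_zero, mul_zero, Complex.exp_zero] at this
    rw [← this]
    refine setIntegral_congr_fun measurableSet_Ioi fun l hl => ?_
    rw [abs_of_pos hl, expi, Complex.ofReal_exp, ← Complex.exp_add]
    congr 1
    push_cast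
    ring
  have n1 : ((2 * Real.pi * y : ℝ) + (2 * Real.pi * v : ℝ) * Complex.I : ℂ) ≠ 0 := by
    intro h
    rw [h] at hp
    have : 0 < 2 * Real.pi * y := by positivity
    simp only [Complex.zero_re] at hp
    linarith
  have n2 : (-(2 * Real.pi * y : ℝ) + (2 * Real.pi * v : ℝ) * Complex.I : ℂ) ≠ 0 := by
    intro h
    rw [h] at hn
    have : 0 < 2 * Real.pi * y := by positivity
    simp only [Complex.zero_re] at hn
    linarith
  have hxt : (x - t) ^ 2 = v ^ 2 := by rw [hv]; ring
  have n3 : ((v ^ 2 + y ^ 2 : ℝ) : ℂ) ≠ 0 := by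
    have : 0 < v ^ 2 + y ^ 2 := by positivity
    exact_mod_cast this.ne'
  have n4 : (Real.pi : ℂ) ≠ 0 := by exact_mod_cast hpi.ne'
  rw [h1, h2, poisson, hxt, div_add_div _ _ n1 n2, div_eq_iff (mul_ne_zero n1 n2)]
  push_cast at n3 ⊢
  field_simp
  linear_combination (-(2 * y * v ^ 2) : ℂ) * Complex.I_sq

/-- Write φ = e^{-2πy|l|} h. The two-sided exponential has the Poisson kernel as transform;
self-adjointness of the Fourier transform and inversion for h turn the product into a Poisson
average. -/
theorem fourier_eq_integral_poisson {φ h : ℝ → ℂ} {y : ℝ} (hy : 0 < y)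
    (hh : ∀ l, h l = φ l * (Real.exp (2 * Real.pi * y * |l|) : ℂ)) (hc : Continuous h)
    (hi : Integrable h) (hF : Integrable (𝓕 h)) (t : ℝ) :
    𝓕 φ t = ∫ x, poisson y (x - t) • 𝓕 h x := by
  set g : ℝ → ℂ := fun l => (Real.exp (-(2 * Real.pi * y) * |l|) : ℂ) * expi t l with hg
  have hgi := integrable_exp_abs_mul_expi hy t
  have hflip := VectorFourier.integral_fourierIntegral_smul_eq_flip (μ := volume) (ν := volume)
    (L := innerₗ ℝ) Real.continuous_fourierChar continuous_inner hgi hF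
  rw [flip_innerₗ] at hflip
  have h1 : ∫ x, poisson y (x - t) • 𝓕 h x = ∫ x, 𝓕 g x • 𝓕 h x := by
    refine integral_congr_ae (Eventually.of_forall fun x => ?_)
    simp only
    rw [hg, fourier_exp_abs_mul_expi hy, Complex.real_smul, smul_eq_mul]
  have h2 : ∫ x, 𝓕 g x • 𝓕 h x = ∫ l, g l • 𝓕 (𝓕 h) l := hflip
  have hinv := hc.fourierInv_fourier_eq hi hF
  have h3 : ∀ l, 𝓕 (𝓕 h) l = h (-l) := fun l => by
    rw [← hinv, Real.fourierInv_eq_fourier_neg, neg_neg, hinv]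
  rw [h1, h2, fourier_eq_integral_expi, ← integral_neg_eq_self (fun l => g l • 𝓕 (𝓕 h) l)]
  refine integral_congr_ae (Eventually.of_forall fun l => ?_)
  simp only [h3, neg_neg, hg, hh, smul_eq_mul, abs_neg]
  have e1 : (Real.exp (-(2 * Real.pi * y) * |l|) : ℂ) * (Real.exp (2 * Real.pi * y * |l|) : ℂ) = 1 := by
    rw [← Complex.ofReal_mul, ← Real.exp_add, ← Complex.ofReal_one]
    congr 1
    rw [Real.exp_eq_one_iff]
    ring
  have e2 : expi t (-l) = expi (-t) l := by
    unfold expi; congr 1; push_cast; ring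
  rw [e2]
  linear_combination (-(expi (-t) l * φ l)) * e1

/-- With h = φ e^{2πy|l|}, the integral of the transform of φ against μ becomes the integral of 2 Re
f against the transform of h on Im z = y. Expanding 2 Re f in its series and inverting term by term
gives a(l)e^{-2πy|l|}h(l) = a(l)φ(l). -/
theorem KernelIdentity.hasSum_summation {f : ℂ → ℂ} {μ : RealLocFinMeasure}
    (hμ : Integrable (fun t : ℝ => (1 + t ^ 2)⁻¹) μ.variation) (hKI : KernelIdentity f μ)
    {a : ℝ → ℂ} {y : ℝ} (hy : 0 < y)
    (ha : Summable fun l : ℝ => ‖a l‖ * Real.exp (-(2 * Real.pi * y) * |l|))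
    (hf : ∀ x : ℝ, ((2 * (f (x + y * Complex.I)).re : ℝ) : ℂ) =
      expSeries (fun l => a l * (Real.exp (-(2 * Real.pi * y) * |l|) : ℂ)) x)
    {φ : ℝ → ℂ} (hφ : ContDiff ℝ ∞ φ) (hφc : HasCompactSupport φ) :
    HasSum (fun l => a l * φ l) (μ.integral (𝓕 φ)) := by
  set h : ℝ → ℂ := fun l => φ l * (Real.exp (2 * Real.pi * y * |l|) : ℂ) with hh
  have hφ2 : ContDiff ℝ 2 φ := contDiff_infty.1 hφ 2
  have hc : Continuous h := by have := hφ.continuous; fun_prop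
  have hcs : HasCompactSupport h := hφc.mul_right
  have hi : Integrable h := hc.integrable_of_hasCompactSupport hcs
  have hexp : ∀ k : ℝ, ContDiff ℝ 2 fun l : ℝ => (Real.exp (k * l) : ℂ) := fun k =>
    Complex.ofRealCLM.contDiff.comp (Real.contDiff_exp.comp (contDiff_const.mul contDiff_id))
  -- The factor e^{2πy|l|} has a corner at 0, so the transform of h decays quadratically; this
  -- suffices both for Fourier inversion and for Fubini against μ.
  obtain ⟨C, hC⟩ := fourier_le_of_kink (h := h)
    (H₁ := fun l => φ l * (Real.exp (2 * Real.pi * y * l) : ℂ))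
    (H₂ := fun l => φ l * (Real.exp (-(2 * Real.pi * y) * l) : ℂ))
    (hφ2.mul (hexp _)) (hφ2.mul (hexp _)) hφc.mul_right hφc.mul_right (by simp)
    (fun x hx => by simp only [hh, abs_of_nonneg hx])
    (fun x hx => by simp only [hh, abs_of_nonpos hx]; congr 3; ring)
  have hFc := continuous_fourier_of_integrable hi
  have hFi : Integrable (𝓕 h) :=
    Continuous.integrable_of_le_inv_one_add_sq integrable_inv_one_add_sq hFc hC
  have e1 : 𝓕 φ = fun t => ∫ x, poisson y (x - t) • 𝓕 h x :=
    funext fun t => fourier_eq_integral_poisson hy (fun _ => rfl) hc hi hFi t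
  rw [e1, RealLocFinMeasure.integral_poisson_swap hμ hFc hC hy]
  simp only [← hKI.two_mul_re_eq hy, hf]
  have hA : Summable fun l : ℝ => ‖a l * (Real.exp (-(2 * Real.pi * y) * |l|) : ℂ)‖ :=
    ha.congr fun l => by
      rw [norm_mul, Complex.norm_real, Real.norm_of_nonneg (Real.exp_pos _).le]
  have hsum := hasSum_integral_expSeries hA hFi
  have hinv : ∀ l, ∫ x, expi l x * 𝓕 h x = h l := fun l => by
    have e2 := fourier_eq_integral_expi (𝓕 h) (-l)
    rw [neg_neg] at e2
    rw [← e2, ← Real.fourierInv_eq_fourier_neg, hc.fourierInv_fourier_eq hi hFi]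
  have e4 : (fun l => a l * φ l) = fun l =>
      a l * (Real.exp (-(2 * Real.pi * y) * |l|) : ℂ) * ∫ x, expi l x * 𝓕 h x := by
    ext l
    have e3 : (Real.exp (-(2 * Real.pi * y) * |l|) : ℂ) * (Real.exp (2 * Real.pi * y * |l|) : ℂ) =
        1 := by
      rw [← Complex.ofReal_mul, ← Real.exp_add, ← Complex.ofReal_one]
      congr 1
      rw [Real.exp_eq_one_iff]
      ring
    rw [hinv, hh]
    linear_combination (-(a l * φ l)) * e3
  rw [e4]
  exact hsum

/-! ### The converse -/

theorem exists_of_conditions {f : ℂ → ℂ} (hf : DifferentiableOn ℂ f upperHalf)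
    (h23 : ConditionsIIandIII f) (h4 : ConditionIV f) :
      ∃ (c : ℝ) (E : ℝ → ℂ), 0 ≤ c ∧
        (∀ l y : ℝ, c < y → Tendsto (bohrMean f l y) atTop (𝓝 (E l))) ∧
        (∀ l : ℝ, l < 0 → E l = 0) ∧
        LocallySummable E ∧ HasExpGrowth E ∧
        (∀ y : ℝ, c < y → Summable fun l : ℝ => ‖E l‖ * Real.exp (-(2 * Real.pi * y) * |l|)) ∧
        ∃ μ : RealLocFinMeasure, μ.degree ≤ 2 ∧ KernelIdentity f μ ∧
          (∀ ν : RealLocFinMeasure, ν.degree ≤ 2 → KernelIdentity f ν → ν = μ) ∧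
          IsRealAntipodalFSPair μ (antipodalCoeff E) ∧
          TendstoOnCompacts
            (fun T z => antipodalCoeff E 0 / 2 + fejerSum (antipodalCoeff E) T z)
            (fun z => f z - (E 0).im * Complex.I) := by
  have hpi := Real.pi_pos
  obtain ⟨c₁, hc₁, hAP, c₂, B, hc₂, hB0, hcc, hB⟩ := h23
  obtain ⟨μ, hμ, hKI⟩ := h4.exists_measure hf
  obtain ⟨C, hC0, hC⟩ := hKI.norm_le hμ hc₁
  obtain ⟨E, hE⟩ := exists_bohr_coeff hf hc₁ hAP hC0 hC
  have hneg : ∀ l, l < 0 → E l = 0 := fun l hl =>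
    bohr_coeff_eq_zero_of_neg hf hc₁ hAP hC0 hC hl (lt_add_one c₁) (hE l _ (lt_add_one c₁))
  have hsum := summable_bohr_coeff hneg fun N θ hθ hθ0 =>
    sum_bohr_coeff_le hf hc₁ hAP hC0 hC hE hB0 hcc hB θ hθ hθ0
  have hk : 0 < 2 * Real.pi * c₂ := by positivity
  have hsumy : ∀ y : ℝ, c₂ < y →
      Summable fun l : ℝ => ‖E l‖ * Real.exp (-(2 * Real.pi * y) * |l|) := fun y hy =>
    summable_mul_exp_of_le hsum hy.le
  have hser : ∀ y : ℝ, c₂ < y → ∀ x : ℝ, f (x + y * Complex.I) =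
      expSeries (fun l => E l * (Real.exp (-(2 * Real.pi * y) * l) : ℂ)) x := fun y hy x =>
    eq_expSeries_of_hasMean (isAP_line_of_shift hAP (hcc.trans_lt hy)) hneg
      (fun l => hE l y (hcc.trans_lt hy)) (hsumy y hy) x
  have hasum := summable_antipodalCoeff hneg hsum
  set y₀ := c₂ + 1 with hy₀
  have hy₀c : c₂ < y₀ := lt_add_one c₂
  have hy₀0 : 0 < y₀ := hc₂.trans hy₀c
  have hFS : IsRealAntipodalFSPair μ (antipodalCoeff E) :=
    { stronglyTempered := stronglyTempered_of_integrable hμ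
      locallySummable := locallySummable_of_summable_exp hk.le hasum
      summation := fun φ hφ hφc => hKI.hasSum_summation hμ hy₀0
        (summable_mul_exp_of_le hasum hy₀c.le)
        (fun x => two_mul_re_eq_expSeries hneg (hsumy y₀ hy₀c) (hser y₀ hy₀c x)) hφ hφc
      antipodal := fun l => by
        rw [antipodalCoeff_eq hneg, antipodalCoeff_eq hneg, map_add, Complex.conj_conj, neg_neg,
          add_comm] }
  refine ⟨c₂, E, hc₂.le, fun l y hy => ?_, hneg, locallySummable_of_summable_exp hk.le hsum,
    ⟨_, hk, hsum⟩, hsumy, μ, (degree_le_two_iff μ).2 hμ, hKI,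
    fun ν hν hν' => hν'.measure_unique ((degree_le_two_iff ν).1 hν) hμ hKI, hFS, ?_⟩
  · exact (hE l y (hcc.trans_lt hy)).tendsto_symm
  -- The direct half applies to the new pair, and its limit g satisfies the same kernel identity as
  -- f. Hence f - g is an imaginary constant, found by comparing the two series at the single point
  -- z₁.
  obtain ⟨g, -, hlim, hKg, hgs⟩ := hFS.exists_limit hμ hk hasum
  have hEq : ∀ z ∈ upperHalf, g z = f z - (E 0).im * Complex.I := by
    rw [kernelIdentity_iff] at hKI hKg
    set z₁ : ℂ := (0 : ℝ) + y₀ * Complex.I with hz₁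
    have him : z₁.im = y₀ := by simp [hz₁]
    have hz₁U : z₁ ∈ upperHalf := by change 0 < z₁.im; rwa [him]
    have hf1 : f z₁ = E 0 + ∑' l : ℝ, (Ioi 0).indicator (fun l : ℝ =>
        antipodalCoeff E l * Complex.exp (2 * Real.pi * Complex.I * l * z₁)) l := by
      rw [hz₁, hser y₀ hy₀c 0, expSeries,
        (summable_expSeries (summable_norm_mul_exp hneg (hsumy y₀ hy₀c)) 0).tsum_eq_add_tsum_ite 0]
      congr 1
      · simp
      · refine tsum_congr fun l => ?_
        split_ifs with hl
        · rw [hl, indicator_of_notMem (by simp)]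
        · by_cases hl0 : 0 < l
          · rw [indicator_of_mem (mem_Ioi.2 hl0), antipodalCoeff, if_pos hl0, expi_zero_right,
              mul_one, Complex.ofReal_exp]
            congr 2
            push_cast
            linear_combination (-(2 * Real.pi * y₀ * l) : ℂ) * Complex.I_mul_I
          · rw [indicator_of_notMem (by simpa using hl0),
              hneg l (lt_of_le_of_ne (not_lt.1 hl0) hl)]
            simp
    have hg1 := hgs z₁ (by rw [him]; gcongr)
    have ha0 : antipodalCoeff E 0 / 2 = (E 0).re := by
      simp [antipodalCoeff]
    have hd1 : f z₁ - g z₁ = (E 0).im * Complex.I := by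
      rw [hf1, hg1, ha0, add_sub_add_right_eq_sub]
      nth_rewrite 1 [← Complex.re_add_im (E 0)]
      ring
    intro z hz
    have h1 : f z + conj (f z₁) = g z + conj (g z₁) :=
      (hKI z hz z₁ hz₁U).trans (hKg z hz z₁ hz₁U).symm
    have h2 := congrArg conj hd1
    rw [map_sub, map_mul, Complex.conj_ofReal, Complex.conj_I] at h2
    linear_combination -h1 + h2
  intro K hK hKU
  exact (hlim K hK hKU).congr_right fun z hz => hEq z (hKU hz)

end

theorem theorem1 :
    (∀ (μ : RealLocFinMeasure) (a : ℝ → ℂ), IsRealAntipodalFSPair μ a → μ.degree ≤ 2 →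
      HasExpGrowth a →
      ∃ f : ℂ → ℂ, DifferentiableOn ℂ f upperHalf ∧
        TendstoOnCompacts (fun T z => a 0 / 2 + fejerSum a T z) f ∧
        ConditionsIIandIII f ∧ ConditionIV f) ∧
    (∀ f : ℂ → ℂ, DifferentiableOn ℂ f upperHalf → ConditionsIIandIII f → ConditionIV f →
      ∃ (c : ℝ) (E : ℝ → ℂ), 0 ≤ c ∧
        (∀ l y : ℝ, c < y → Tendsto (bohrMean f l y) atTop (𝓝 (E l))) ∧
        (∀ l : ℝ, l < 0 → E l = 0) ∧
        LocallySummable E ∧ HasExpGrowth E ∧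
        (∀ y : ℝ, c < y → Summable fun l : ℝ => ‖E l‖ * Real.exp (-(2 * Real.pi * y) * |l|)) ∧
        ∃ μ : RealLocFinMeasure, μ.degree ≤ 2 ∧ KernelIdentity f μ ∧
          (∀ ν : RealLocFinMeasure, ν.degree ≤ 2 → KernelIdentity f ν → ν = μ) ∧
          IsRealAntipodalFSPair μ (antipodalCoeff E) ∧
          TendstoOnCompacts
            (fun T z => antipodalCoeff E 0 / 2 + fejerSum (antipodalCoeff E) T z)
            (fun z => f z - (E 0).im * Complex.I)) :=
  ⟨fun _ _ h hdeg ha => h.exists_holomorphic hdeg ha,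
    fun _ hf h23 h4 => exists_of_conditions hf h23 h4⟩
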